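/- Let $n\ge 1$ and let $M$ be a locally (quaternionic) projective flat manifold without boundary (Hausdorff, second countable): it has an atlas of charts $\phi_\alpha:U_\alpha\to\mathbb H^n$ whose transition maps $\phi_\beta\circ\phi_\alpha^{-1}$ are fractional linear maps $\mathbf q\mapsto(\mathbf c+\mathbf d\mathbf q)(\mathbf a+\mathbf b\mathbf q)^{-1}$ with $\begin{pmatrix}\mathbf a&\mathbf b\\ \mathbf c&\mathbf d\end{pmatrix}\in \mathrm{SL}(n+1,\mathbb H)$. Put $J_1=\mathbf a+\mathbf b\mathbf q$ and $J_2=\mathbf d-(\mathbf c+\mathbf d\mathbf q)(\mathbf a+\mathbf b\mathbf q)^{-1}\mathbf b$. Let $\tau$ be the standard embedding of quaternionic $p\times m$ matrices in complex $2p\times 2m$ matrices. A section of $\wedge^pE^*[-w]$ ($p$ even) is a family of $\wedge^p\mathbb C^{2n}$-valued functions $f_\alpha$ on $\phi_\alpha(U_\alpha)$ with $f_\alpha(\mathbf q)=|J_1|^{-2w}\,\tau(J_2)^t.f_\beta(\phi_\beta\phi_\alpha^{-1}(\mathbf q))$; sections of the real line bundle $\mathbb R[-1]$ are families of real functions with $u_\alpha=|J_1|^{-2}\,u_\beta\circ\phi_\beta\phi_\alpha^{-1}$,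 and $\mathbb R_-[-1]$ is the subbundle with fibre $(-\infty,0)$. Sections $(\eta_{0'},\eta_{1'})$ of $H^*\otimes\wedge^pE^*[-w]$ ($p$ odd) are glued by the additional action of $\tau(J_1^{-1})$ on the index $A'\in\{0',1'\}$. Let $\omega^0,\dots,\omega^{2n-1}$ be the Grassmann generators of $\wedge^\bullet\mathbb C^{2n}$. On $\mathbb H^n$, with $\mathbf q_l=x_{4l}+\mathbf i x_{4l+1}+\mathbf j x_{4l+2}+\mathbf k x_{4l+3}$ for $l=0,\dots,n-1$, set $$\begin{pmatrix}\nabla_{(2l)0'}&\nabla_{(2l)1'}\\ \nabla_{(2l+1)0'}&\nabla_{(2l+1)1'}\end{pmatrix}=\tfrac12\begin{pmatrix}\partial_{x_{4l}}+i\partial_{x_{4l+1}}&-\partial_{x_{4l+2}}-i\partial_{x_{4l+3}}\\ \partial_{x_{4l+2}}-i\partial_{x_{4l+3}}&\partial_{x_{4l}}-i\partial_{x_{4l+1}}\end{pmatrix},$$ $d_{A'}F=\sum_{A}\omega^A\wedge\nabla_{AA'}F$ (derivatives taken coefficientwise), and $\triangle u=d_{0'}d_{1'}u$. Applied chart by chart,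 $\triangle$ maps sections of $\mathbb R[-1]$ to sections of $\wedge^2E^*[-2]$. Let $dV$ be a positive volume form on $M$. A section $\Phi$ of $\wedge^{2n}E^*[-2n-1]\cong\wedge^{4n}T^*M$, equal to $F_\alpha\,\omega^0\wedge\cdots\wedge\omega^{2n-1}$ in the chart $\phi_\alpha$, corresponds to $F_\alpha\,dx_0\cdots dx_{4n-1}=f\,dV$, and $\int_K\Phi:=\int_K f\,dV$ (this does not depend on $dV$). A $C^2$ section $u$ of $\mathbb R[-1]$ is plurisubharmonic if the current $T(\eta)=\int_M\triangle u\wedge\eta$ is closed, i.e. $T(d_{0'}\eta_{1'}-d_{1'}\eta_{0'})=0$ for all smooth compactly supported sections $\eta$ of $H^*\otimes\wedge^{2n-3}E^*[-(2n-2)]$ (no condition if $n=1$), and positive, i.e. $T(\eta)\ge0$ for all smooth compactly supported sections $\eta$ of $\wedge^{2n-2}E^*[-(2n-1)]$ with values in the convex cone generated by the elements $\bigwedge_{j=1}^{n-1}(\eta_j^*\tilde\omega^0\wedge\eta_j^*\tilde\omega^1)$, where $\eta_1,\dots,\eta_{n-1}:\mathbb H^n\to\mathbb H$ are linearly independent right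 $\mathbb H$-linear maps (row vectors) and $\eta_j^*\tilde\omega^\beta=\sum_A\tau(\eta_j)_{\beta A}\,\omega^A$. Fix a continuous metric $h$ on the line bundle $\mathbb R[-1]$ and let $\|u\|_{L^\infty}=\sup_M|u|_h\in[0,\infty]$. **Theorem (Chern–Levine–Nirenberg estimate).** (1) If $M$ is compact, there is a constant $C$ depending only on $M$ and $h$ such that for all plurisubharmonic $C^2$ sections $u_0,\dots,u_n$ of $\mathbb R_-[-1]$ the integral below converges and $$0\le\int_M-u_0\,\triangle u_1\wedge\cdots\wedge\triangle u_n\le C\prod_{i=0}^n\|u_i\|_{L^\infty}.$$ (2) If $M$ is arbitrary, compact or not, then for every compact $K\subset M$ there is a constant $C$ depending only on $M$, $h$ and $K$ such that for all such $u_0,\dots,u_n$ the integral below converges and $$0\le\int_K-u_0\,\triangle u_1\wedge\cdots\wedge\triangle u_n\le C\prod_{i=0}^n\|u_i\|_{L^\infty}.$$ -/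

import Mathlib

open scoped Quaternion ENNReal NNReal ContDiff ComplexOrder

noncomputable section

namespace QuatProj

/-! ### Quaternionic space and fractional linear transformations -/

/-- The right quaternionic vector space of column vectors with `n` quaternionic entries. -/
abbrev Hn (n : ℕ) : Type := Fin n → ℍ[ℝ]

/-- Quaternions carry their Borel sets. -/
instance instMeasurableSpaceQuaternion : MeasurableSpace ℍ[ℝ] := borel _

instance instBorelSpaceQuaternion : BorelSpace ℍ[ℝ] := ⟨rfl⟩

/-- Lebesgue measure on the quaternions, in the coordinates `x₀ + x₁ i + x₂ j + x₃ k`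
(the basis `1, i, j, k` is orthonormal). The induced product measure on `Hn n` is the
Lebesgue measure of `ℝ⁴ⁿ`. -/
instance instMeasureSpaceQuaternion : MeasureTheory.MeasureSpace ℍ[ℝ] :=
  measureSpaceOfInnerProductSpace

/-- The complex `2 × 2` matrix of a quaternion. -/
def tauQ (x : ℍ[ℝ]) : Matrix (Fin 2) (Fin 2) ℂ :=
  !![⟨x.re, -x.imI⟩, ⟨-x.imJ, x.imK⟩;
     ⟨x.imJ, x.imK⟩, ⟨x.re, x.imI⟩]

/-- The complex `2p × 2m` matrix of a quaternionic `p × m` matrix, block by block. The pair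
`(l, α)` corresponds to the index `2 l + α`. -/
def tau {p m : ℕ} (a : Matrix (Fin p) (Fin m) ℍ[ℝ]) :
    Matrix (Fin (p * 2)) (Fin (m * 2)) ℂ :=
  Matrix.of fun A B =>
    tauQ (a (finProdFinEquiv.symm A).1 (finProdFinEquiv.symm B).1)
      (finProdFinEquiv.symm A).2 (finProdFinEquiv.symm B).2

/-- Membership in `SL(n+1, ℍ)`. -/
def IsSL {n : ℕ} (g : Matrix (Fin (n + 1)) (Fin (n + 1)) ℍ[ℝ]) : Prop :=
  (tau g).det = 1

/-- `J₁(g, q) = a + b q`, for `g` with blocks `a, b; c, d`. -/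
def J1 {n : ℕ} (g : Matrix (Fin (n + 1)) (Fin (n + 1)) ℍ[ℝ]) (q : Hn n) : ℍ[ℝ] :=
  g 0 0 + ∑ j : Fin n, g 0 j.succ * q j

/-- The vector `c + d q`. -/
def numer {n : ℕ} (g : Matrix (Fin (n + 1)) (Fin (n + 1)) ℍ[ℝ]) (q : Hn n) : Hn n :=
  fun i => g i.succ 0 + ∑ j : Fin n, g i.succ j.succ * q j

/-- The fractional linear transformation `q ↦ (c + d q) (a + b q)⁻¹`. -/
def frac {n : ℕ} (g : Matrix (Fin (n + 1)) (Fin (n + 1)) ℍ[ℝ]) (q : Hn n) : Hn n :=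
  fun i => numer g q i * (J1 g q)⁻¹

/-- `J₂(g, q) = d - (c + d q) (a + b q)⁻¹ b`. -/
def J2 {n : ℕ} (g : Matrix (Fin (n + 1)) (Fin (n + 1)) ℍ[ℝ]) (q : Hn n) :
    Matrix (Fin n) (Fin n) ℍ[ℝ] :=
  Matrix.of fun i j => g i.succ j.succ - numer g q i * (J1 g q)⁻¹ * g 0 j.succ

/-! ### Grassmann variables and the operators `d_{0'}`, `d_{1'}` and `△` -/

/-- The Grassmann algebra on `ω⁰, …, ω²ⁿ⁻¹`. -/
abbrev Gr (n : ℕ) : Type := ExteriorAlgebra ℂ (Fin (n * 2) → ℂ)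

/-- The Grassmann variable `ω^A`. -/
def omega {n : ℕ} (A : Fin (n * 2)) : Gr n :=
  ExteriorAlgebra.ι ℂ (Pi.single A (1 : ℂ))

/-- The basis of increasing monomials `ω^𝐀` of the Grassmann algebra. -/
def monoBasis (n : ℕ) : Module.Basis (Finset (Fin (n * 2))) ℂ (Gr n) :=
  (Pi.basisFun ℂ (Fin (n * 2))).ExteriorAlgebra

/-- The coefficient of `Ω = ω⁰ ∧ ω¹ ∧ ⋯ ∧ ω²ⁿ⁻¹`. -/
def topCoeff {n : ℕ} (w : Gr n) : ℂ := (monoBasis n).repr w Finset.univ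

/-- The action `M . ω^A = M_{BA} ω^B` of a matrix, extended to the Grassmann algebra. -/
def grAct {n : ℕ} (M : Matrix (Fin (n * 2)) (Fin (n * 2)) ℂ) (w : Gr n) : Gr n :=
  ExteriorAlgebra.map (Matrix.toLin' M) w

/-- The real unit quaternions `1, i, j, k`. -/
def unitQ (m : Fin 4) : ℍ[ℝ] :=
  ![⟨1, 0, 0, 0⟩, ⟨0, 1, 0, 0⟩, ⟨0, 0, 1, 0⟩, ⟨0, 0, 0, 1⟩] m

/-- The partial derivative `∂/∂x_{4l+m}` of a Grassmann algebra valued function, taken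
coefficient by coefficient. -/
def partialD {n : ℕ} (l : Fin n) (m : Fin 4) (F : Hn n → Gr n) (q : Hn n) : Gr n :=
  ∑ s : Finset (Fin (n * 2)),
    (fderiv ℝ (fun p => (monoBasis n).repr (F p) s) q (Pi.single l (unitQ m))) • monoBasis n s

/-- The complex vector fields `∇_{AA'}`, with `A = 2 l + α`. -/
def nabla {n : ℕ} (A : Fin (n * 2)) (A' : Fin 2) (F : Hn n → Gr n) (q : Hn n) : Gr n :=
  let l := (finProdFinEquiv.symm A).1
  let α := (finProdFinEquiv.symm A).2
  (1 / 2 : ℂ) •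
    (!![partialD l 0 F q + Complex.I • partialD l 1 F q,
        -partialD l 2 F q - Complex.I • partialD l 3 F q;
        partialD l 2 F q - Complex.I • partialD l 3 F q,
        partialD l 0 F q - Complex.I • partialD l 1 F q] : Matrix (Fin 2) (Fin 2) (Gr n)) α A'

/-- `d_{A'} F = ∇_{AA'} f_𝐀 ω^A ω^𝐀` for `F = f_𝐀 ω^𝐀`. -/
def dOp {n : ℕ} (A' : Fin 2) (F : Hn n → Gr n) (q : Hn n) : Gr n :=
  ∑ A : Fin (n * 2), omega A * nabla A A' F q

/-- The Baston operator `△ u = d_{0'} d_{1'} u` on real functions. -/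
def baston {n : ℕ} (u : Hn n → ℝ) : Hn n → Gr n :=
  dOp 0 (dOp 1 (fun p => algebraMap ℂ (Gr n) (u p : ℂ)))

/-! ### Strongly positive elements -/

/-- The pull back `η^* ω̃^β = τ(η)_{βA} ω^A` under the right quaternionic linear map with
row vector `η`. -/
def pullForm {n : ℕ} (η : Fin n → ℍ[ℝ]) (β : Fin 2) : Gr n :=
  ∑ A : Fin (n * 2),
    tauQ (η (finProdFinEquiv.symm A).1) β (finProdFinEquiv.symm A).2 • omega A

/-- Elementary strongly positive `2p`-elements
`η₁^* ω̃⁰ ∧ η₁^* ω̃¹ ∧ ⋯ ∧ η_p^* ω̃⁰ ∧ η_p^* ω̃¹`. -/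
def IsElementaryStronglyPositive {n : ℕ} (p : ℕ) (w : Gr n) : Prop :=
  ∃ η : Fin p → Fin n → ℍ[ℝ], LinearIndependent ℍ[ℝ] η ∧
    w = (List.ofFn fun j => pullForm (η j) 0 * pullForm (η j) 1).prod

/-- The convex cone `SP^{2p}` generated by the elementary strongly positive elements. -/
def stronglyPositiveCone (n p : ℕ) : Submodule ℝ≥0 (Gr n) :=
  Submodule.span ℝ≥0 {w | IsElementaryStronglyPositive p w}

/-! ### Locally projective flat manifolds, bundles and their sections

A section of one of the bundles is a family of local sections over the images of the
charts of the atlas, related by the gluing rule of the bundle. -/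

section Manifold

variable (n : ℕ) (M : Type*) [TopologicalSpace M] [ChartedSpace (Hn n) M]

/-- The fractional linear transformation of `g ∈ SL(n+1, ℍ)` is the transition map from the
chart `e` to the chart `e'`. -/
def IsTransition {n : ℕ} {M : Type*} [TopologicalSpace M]
    (g : Matrix (Fin (n + 1)) (Fin (n + 1)) ℍ[ℝ]) (e e' : OpenPartialHomeomorph M (Hn n)) :
    Prop :=
  IsSL g ∧ ∀ x ∈ e.source ∩ e'.source, J1 g (e x) ≠ 0 ∧ e' x = frac g (e x)

/-- The atlas makes `M` a locally (quaternionic) projective flat manifold. -/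
def IsLocallyProjectiveFlat : Prop :=
  ∀ e ∈ atlas (Hn n) M, ∀ e' ∈ atlas (Hn n) M, ∃ g, IsTransition g e e'

/-- Sections of the real line bundle `ℝ[-1]`. -/
structure LineSection where
  rep : OpenPartialHomeomorph M (Hn n) → Hn n → ℝ
  glue : ∀ e ∈ atlas (Hn n) M, ∀ e' ∈ atlas (Hn n) M, ∀ g, IsTransition g e e' →
    ∀ x ∈ e.source ∩ e'.source,
      rep e (e x) = (‖J1 g (e x)‖ ^ 2)⁻¹ * rep e' (e' x)

/-- Sections of the complex bundle `⋀^p E^*[-w]`, for even `p`. (For odd `p` the action of the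
matrix `-1`, which induces the identity transformation, is not trivial.) -/
structure FormSection (p w : ℕ) where
  rep : OpenPartialHomeomorph M (Hn n) → Hn n → Gr n
  mem : ∀ e ∈ atlas (Hn n) M, ∀ x ∈ e.source,
    rep e (e x) ∈ ⋀[ℂ]^p (Fin (n * 2) → ℂ)
  glue : ∀ e ∈ atlas (Hn n) M, ∀ e' ∈ atlas (Hn n) M, ∀ g, IsTransition g e e' →
    ∀ x ∈ e.source ∩ e'.source,
      rep e (e x) = (((‖J1 g (e x)‖ ^ (2 * w))⁻¹ : ℝ) : ℂ) •
        grAct (tau (J2 g (e x))).transpose (rep e' (e' x))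

/-- Sections `η = η_{A'} s^{A'}` of the complex bundle `H^* ⊗ ⋀^p E^*[-w]`, for odd `p`. -/
structure HFormSection (p w : ℕ) where
  rep : OpenPartialHomeomorph M (Hn n) → Fin 2 → Hn n → Gr n
  mem : ∀ e ∈ atlas (Hn n) M, ∀ x ∈ e.source, ∀ A',
    rep e A' (e x) ∈ ⋀[ℂ]^p (Fin (n * 2) → ℂ)
  glue : ∀ e ∈ atlas (Hn n) M, ∀ e' ∈ atlas (Hn n) M, ∀ g, IsTransition g e e' →
    ∀ x ∈ e.source ∩ e'.source, ∀ B',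
      rep e B' (e x) = (((‖J1 g (e x)‖ ^ (2 * w))⁻¹ : ℝ) : ℂ) •
        ∑ A' : Fin 2, tauQ ((J1 g (e x))⁻¹) B' A' •
          grAct (tau (J2 g (e x))).transpose (rep e' A' (e' x))

/-- A (continuous) metric on the line bundle `ℝ[-1]`: in the chart `e` the norm of the
element `t` of the fibre over `q` is `weight e q * |t|`. -/
structure LineMetric where
  weight : OpenPartialHomeomorph M (Hn n) → Hn n → ℝ
  pos : ∀ e ∈ atlas (Hn n) M, ∀ q ∈ e.target, 0 < weight e q
  cont : ∀ e ∈ atlas (Hn n) M, ContinuousOn (weight e) e.target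
  glue : ∀ e ∈ atlas (Hn n) M, ∀ e' ∈ atlas (Hn n) M, ∀ g, IsTransition g e e' →
    ∀ x ∈ e.source ∩ e'.source,
      weight e (e x) = ‖J1 g (e x)‖ ^ 2 * weight e' (e' x)

/-- A (continuous) nowhere vanishing section `dV` of `⋀^{4n} T^*M`, positive in the charts of
the atlas: in the chart `e` it is `rep e` times the standard volume form. -/
structure VolumeForm where
  rep : OpenPartialHomeomorph M (Hn n) → Hn n → ℝ
  pos : ∀ e ∈ atlas (Hn n) M, ∀ q ∈ e.target, 0 < rep e q
  cont : ∀ e ∈ atlas (Hn n) M, ContinuousOn (rep e) e.target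
  glue : ∀ e ∈ atlas (Hn n) M, ∀ e' ∈ atlas (Hn n) M, ∀ x ∈ e.source ∩ e'.source,
    rep e (e x) = (fderiv ℝ (fun q => e' (e.symm q)) (e x)).det * rep e' (e' x)

end Manifold

section Analysis

variable {n : ℕ} {M : Type*} [TopologicalSpace M] [ChartedSpace (Hn n) M]

/-- The section is of class `C²`. -/
def LineSection.IsC2 (u : LineSection n M) : Prop :=
  ∀ e ∈ atlas (Hn n) M, ContDiffOn ℝ 2 (u.rep e) e.target

/-- The section takes values in `ℝ_-[-1]`, where `ℝ_- = (-∞, 0)`. -/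
def LineSection.IsNegative (u : LineSection n M) : Prop :=
  ∀ e ∈ atlas (Hn n) M, ∀ q ∈ e.target, u.rep e q < 0

/-- The `L^∞`-norm of a continuous section of `ℝ[-1]` with respect to the metric `h`. -/
def LineSection.supNorm (h : LineMetric n M) (u : LineSection n M) : ℝ≥0∞ :=
  ⨆ x : M, ENNReal.ofReal
    (h.weight (chartAt (Hn n) x) (chartAt (Hn n) x x) *
      |u.rep (chartAt (Hn n) x) (chartAt (Hn n) x x)|)

/-- Smooth compactly supported sections of `⋀^p E^*[-w]`. -/
def FormSection.IsTest {p w : ℕ} (η : FormSection n M p w) : Prop :=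
  (∀ e ∈ atlas (Hn n) M, ∀ s,
    ContDiffOn ℝ ∞ (fun q => (monoBasis n).repr (η.rep e q) s) e.target) ∧
  ∃ K : Set M, IsCompact K ∧
    ∀ e ∈ atlas (Hn n) M, ∀ x ∈ e.source, x ∉ K → η.rep e (e x) = 0

/-- Smooth compactly supported sections of `H^* ⊗ ⋀^p E^*[-w]`. -/
def HFormSection.IsTest {p w : ℕ} (η : HFormSection n M p w) : Prop :=
  (∀ e ∈ atlas (Hn n) M, ∀ A' s,
    ContDiffOn ℝ ∞ (fun q => (monoBasis n).repr (η.rep e A' q) s) e.target) ∧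
  ∃ K : Set M, IsCompact K ∧
    ∀ e ∈ atlas (Hn n) M, ∀ x ∈ e.source, x ∉ K → ∀ A', η.rep e A' (e x) = 0

/-- A test form with values in the strongly positive cone `SP^{2p} E^*[-w]`. -/
def FormSection.IsStronglyPositive {p w : ℕ} (η : FormSection n M (2 * p) w) : Prop :=
  ∀ e ∈ atlas (Hn n) M, ∀ x ∈ e.source, η.rep e (e x) ∈ stronglyPositiveCone n p

/-- The operator `𝒟 η = ∂^{A'} d_{A'} η = d_{0'} η_{1'} - d_{1'} η_{0'}`, chart by chart (primed
indices are raised by `ε^{0'1'} = -1`, `ε^{1'0'} = 1`). -/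
def HFormSection.D {p w : ℕ} (η : HFormSection n M p w)
    (e : OpenPartialHomeomorph M (Hn n)) : Hn n → Gr n :=
  fun q => dOp 0 (η.rep e 1) q - dOp 1 (η.rep e 0) q

/-! ### Integration

A section `Φ` of `⋀^{2n} E^*[-2n-1] ≅ ⋀^{4n} T^*M` is written `Φ ≅ f dV`, and its integral is
the integral of the function `f` against the measure of the volume form `dV`. -/

variable [MeasurableSpace M]

/-- The measure of a volume form: the least measure that, for each chart `e`, dominates the
image under `e⁻¹` of `rep e` times Lebesgue measure on the image of `e`. -/
def VolumeForm.measure (dV : VolumeForm n M) : MeasureTheory.Measure M :=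
  ⨆ e ∈ atlas (Hn n) M,
    ((MeasureTheory.volume.restrict e.target).withDensity
      (fun q => ENNReal.ofReal (dV.rep e q))).map e.symm

/-- The function `f` with `Φ ≅ f dV`, for a family `Φ` of local representatives of a section of
`⋀^{2n} E^*[-2n-1]`: in a chart `e`, `Φ = F Ω` corresponds to `F` times the standard volume
form. -/
def VolumeForm.ratio (dV : VolumeForm n M) (Φ : OpenPartialHomeomorph M (Hn n) → Hn n → Gr n)
    (x : M) : ℂ :=
  topCoeff (Φ (chartAt (Hn n) x) (chartAt (Hn n) x x)) /
    (dV.rep (chartAt (Hn n) x) (chartAt (Hn n) x x) : ℂ)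

/-- `Φ` is integrable over `K`. -/
def VolumeForm.FormIntegrableOn (dV : VolumeForm n M)
    (Φ : OpenPartialHomeomorph M (Hn n) → Hn n → Gr n) (K : Set M) : Prop :=
  MeasureTheory.IntegrableOn (dV.ratio Φ) K dV.measure

/-- The integral `∫_K Φ`. -/
def VolumeForm.formIntegral (dV : VolumeForm n M)
    (Φ : OpenPartialHomeomorph M (Hn n) → Hn n → Gr n) (K : Set M) : ℂ :=
  ∫ x in K, dV.ratio Φ x ∂dV.measure

/-- The current `T_{△u}(η) = ∫_M △u ∧ η` of a `C²` section, on local representatives `η`. -/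
def LineSection.bastonCurrent (dV : VolumeForm n M) (u : LineSection n M)
    (η : OpenPartialHomeomorph M (Hn n) → Hn n → Gr n) : ℂ :=
  dV.formIntegral (fun e q => baston (u.rep e) q * η e q) Set.univ

/-- A `C²` section `u` of `ℝ[-1]` is plurisubharmonic if `△u` is a closed positive `2`-current:
closed means `T_{△u}(𝒟 η) = 0` for all test sections `η` of `H^* ⊗ ⋀^{2n-3} E^*[-(2n-2)]`
(an empty condition if `n ≤ 1`), and positive means `T_{△u}(η) ≥ 0` for all strongly positive
test forms `η`, sections of `SP^{2n-2} E^*[-(2n-2)-1]`. -/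
def LineSection.IsPSH (dV : VolumeForm n M) (u : LineSection n M) : Prop :=
  (∀ p, p + 3 = 2 * n → ∀ η : HFormSection n M p (p + 1), η.IsTest →
    u.bastonCurrent dV η.D = 0) ∧
  (∀ p, p + 1 = n → ∀ η : FormSection n M (2 * p) (2 * p + 1), η.IsTest →
    η.IsStronglyPositive → 0 ≤ u.bastonCurrent dV η.rep)

/-- The local representatives of `-u₀ △u₁ ∧ ⋯ ∧ △uₙ`. -/
def monge (u : Fin (n + 1) → LineSection n M) (e : OpenPartialHomeomorph M (Hn n)) :
    Hn n → Gr n :=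
  fun q => ((-(u 0).rep e q : ℝ) : ℂ) •
    (List.ofFn fun i : Fin n => baston ((u i.succ).rep e) q).prod

end Analysis

end QuatProj

end

open scoped Quaternion ENNReal NNReal ContDiff ComplexOrder

noncomputable section

namespace QuatProj

/-! ### The complex matrices of quaternionic matrices -/

section Tau

/-! In a chart, `baston u` is a 2-form depending linearly on the real Hessian of `u` (this is
`Lam`), and it sees only `lineAvg`, the sum of the Hessian over right multiplications by 1, i, j, k.
Positivity of the current △u, tested on forms concentrated near a point and built from rows that
annihilate a vector v, says that this sum is nonnegative on v (`LineSection.linePSD_of_isPSH`). A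
semidefinite form is a sum of squares, so △u is pointwise a finite sum of elementary elements
(`exists_Lam_eq_sum_elemForm`), and the top coefficient of a product of n of these is a determinant
det τ ≥ 0 (`topCoeff_elemForms`, `det_tau_nonneg`). Hence all mixed products are nonnegative.

The estimate itself is an induction on the number of Baston factors (`local_estimate`). If χ is a
cut-off equal to 1 on K and w is the product of the remaining factors, two integrations by parts
turn χ △u₁ ∧ w into u₁ △χ ∧ w, and -Aβ ≤ △χ ≤ Aβ on the support of χ, where β is the Baston form of
|q|²/2. One factor △u₁ is thus exchanged for sup |u₁| and a factor β, at the price of a larger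
compact set. As the functions are only C², the forms △u are only continuous, and closedness of their
products is meant weakly (`weaklyClosedOn_baston_mul`, `integral_mul_baston_comm`).

To pass to the manifold, `baston_transform` shows that △ is covariant from weight -1 to weight -2.
The integrand is then a density whose total weight is that of the Jacobian, |J₁|^(-4n-4), so its
integral over a compact subset of a chart is a Lebesgue integral in which dV no longer appears
(`VolumeForm.integrable_and_integral_chart`). Comparing |u| with the metric on a compact set gives
`chart_estimate`. Because the integrand is nonnegative, the bounds for finitely many charts add up
(`compact_estimate`). -/

lemma tauQ_mul (x y : ℍ[ℝ]) : tauQ (x * y) = tauQ x * tauQ y := by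
  ext i j
  fin_cases i <;> fin_cases j <;>
    simp [tauQ, Matrix.mul_apply, Fin.sum_univ_two, Complex.ext_iff] <;> constructor <;> ring

lemma tauQ_add (x y : ℍ[ℝ]) : tauQ (x + y) = tauQ x + tauQ y := by
  ext i j
  fin_cases i <;> fin_cases j <;> simp [tauQ, Complex.ext_iff] <;> ring

lemma tauQ_one : tauQ 1 = 1 := by
  ext i j
  fin_cases i <;> fin_cases j <;> simp [tauQ, Complex.ext_iff]

lemma tauQ_zero : tauQ 0 = 0 := by
  ext i j
  fin_cases i <;> fin_cases j <;> simp [tauQ, Complex.ext_iff]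

/-- The embedding of the quaternions in the complex `2 × 2` matrices as a ring homomorphism. -/
def tauQHom : ℍ[ℝ] →+* Matrix (Fin 2) (Fin 2) ℂ where
  toFun := tauQ
  map_one' := tauQ_one
  map_mul' := tauQ_mul
  map_zero' := tauQ_zero
  map_add' := tauQ_add

@[simp] lemma tauQHom_apply (x : ℍ[ℝ]) : tauQHom x = tauQ x := rfl

lemma tauQ_smul (r : ℝ) (x : ℍ[ℝ]) : tauQ (r • x) = (r : ℂ) • tauQ x := by
  ext i j
  fin_cases i <;> fin_cases j <;> simp [tauQ, Complex.ext_iff]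

lemma tauQ_sum {ι : Type*} (s : Finset ι) (f : ι → ℍ[ℝ]) :
    tauQ (∑ i ∈ s, f i) = ∑ i ∈ s, tauQ (f i) := map_sum tauQHom f s

lemma tauQ_inj {x y : ℍ[ℝ]} (h : tauQ x = tauQ y) : x = y := by
  have h0 := congr_fun (congr_fun h 1) 1
  have h1 := congr_fun (congr_fun h 1) 0
  simp only [tauQ, Matrix.of_apply, Matrix.cons_val_one, Matrix.cons_val_zero,
    Complex.ext_iff] at h0 h1
  ext
  · exact h0.1
  · exact h0.2
  · exact h1.1
  · exact h1.2

lemma norm_sq_eq (x : ℍ[ℝ]) : ‖x‖ ^ 2 = x.re ^ 2 + x.imI ^ 2 + x.imJ ^ 2 + x.imK ^ 2 := by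
  rw [sq, ← Quaternion.normSq_eq_norm_mul_self, Quaternion.normSq_def']

lemma det_tauQ (x : ℍ[ℝ]) : (tauQ x).det = ((‖x‖ ^ 2 : ℝ) : ℂ) := by
  rw [norm_sq_eq]
  simp only [tauQ, Matrix.det_fin_two, Matrix.of_apply, Matrix.cons_val_one, Matrix.cons_val_zero,
    Complex.ext_iff, Complex.sub_re, Complex.mul_re, Complex.ofReal_re, Complex.sub_im,
    Complex.mul_im, Complex.ofReal_im, Matrix.cons_val_fin_one]
  constructor <;> ring

lemma tau_apply {p m : ℕ} (a : Matrix (Fin p) (Fin m) ℍ[ℝ]) (i : Fin p × Fin 2)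
    (j : Fin m × Fin 2) :
    tau a (finProdFinEquiv i) (finProdFinEquiv j) = tauQ (a i.1 j.1) i.2 j.2 := by
  simp only [tau, Matrix.of_apply, Equiv.symm_apply_apply]

/-- The matrix `tau a` indexed by pairs. -/
def tauP {p m : ℕ} (a : Matrix (Fin p) (Fin m) ℍ[ℝ]) : Matrix (Fin p × Fin 2) (Fin m × Fin 2) ℂ :=
  Matrix.of fun i j => tauQ (a i.1 j.1) i.2 j.2

lemma tau_eq_submatrix {p m : ℕ} (a : Matrix (Fin p) (Fin m) ℍ[ℝ]) :
    tau a = (tauP a).submatrix finProdFinEquiv.symm finProdFinEquiv.symm := rfl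

lemma tauP_mul {p m k : ℕ} (a : Matrix (Fin p) (Fin m) ℍ[ℝ]) (b : Matrix (Fin m) (Fin k) ℍ[ℝ]) :
    tauP (a * b) = tauP a * tauP b := by
  ext i j
  simp only [tauP, Matrix.of_apply, Matrix.mul_apply, tauQ_sum, tauQ_mul, Matrix.sum_apply,
    Fintype.sum_prod_type]

lemma tau_mul {p m k : ℕ} (a : Matrix (Fin p) (Fin m) ℍ[ℝ]) (b : Matrix (Fin m) (Fin k) ℍ[ℝ]) :
    tau (a * b) = tau a * tau b := by
  simp only [tau_eq_submatrix, tauP_mul, Matrix.submatrix_mul_equiv]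

lemma tauP_one {p : ℕ} : tauP (1 : Matrix (Fin p) (Fin p) ℍ[ℝ]) = 1 := by
  ext ⟨i, a⟩ ⟨j, b⟩
  by_cases h : i = j
  · subst h
    simp [tauP, tauQ_one, Matrix.one_apply]
  · simp [tauP, h, tauQ_zero]

lemma tau_one {p : ℕ} : tau (1 : Matrix (Fin p) (Fin p) ℍ[ℝ]) = 1 := by
  rw [tau_eq_submatrix, tauP_one, Matrix.submatrix_one_equiv]

lemma tau_inj {p m : ℕ} {a b : Matrix (Fin p) (Fin m) ℍ[ℝ]} (h : tau a = tau b) : a = b := by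
  ext1 i j
  refine tauQ_inj ?_
  ext1 α β
  have := congr_fun (congr_fun h (finProdFinEquiv (i, α))) (finProdFinEquiv (j, β))
  simpa only [tau_apply] using this

lemma det_tau_eq {p : ℕ} (a : Matrix (Fin p) (Fin p) ℍ[ℝ]) : (tau a).det = (tauP a).det := by
  rw [tau_eq_submatrix, Matrix.det_submatrix_equiv_self]

lemma det_tau_smul_one {p : ℕ} (x : ℍ[ℝ]) :
    (tau (Matrix.diagonal fun _ : Fin p => x)).det = ((‖x‖ ^ (2 * p) : ℝ) : ℂ) := by
  -- `Matrix.blockDiagonal` keeps the block number in the second component of an index, `tauP` in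
  -- the first.
  have : tauP (Matrix.diagonal fun _ : Fin p => x) =
      (Matrix.blockDiagonal fun _ : Fin p => tauQ x).submatrix Prod.swap Prod.swap := by
    ext ⟨i, a⟩ ⟨j, b⟩
    by_cases h : i = j
    · subst h; simp [tauP]
    · simp [tauP, h, tauQ_zero, Matrix.blockDiagonal_apply]
  rw [det_tau_eq, this]
  have h2 := Matrix.det_submatrix_equiv_self (Equiv.prodComm (Fin p) (Fin 2))
    (Matrix.blockDiagonal fun _ : Fin p => tauQ x)
  refine h2.trans ?_
  rw [Matrix.det_blockDiagonal]
  simp [det_tauQ, pow_mul]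

/-! ### Determinants by Schur complements -/

/-- Splitting off the first index of a block matrix. -/
def blockEquiv (n : ℕ) : Fin 2 ⊕ (Fin n × Fin 2) ≃ Fin (n + 1) × Fin 2 where
  toFun := Sum.elim (fun a => (0, a)) (fun x => (x.1.succ, x.2))
  invFun x := Fin.cases (motive := fun _ => Fin 2 ⊕ (Fin n × Fin 2)) (Sum.inl x.2)
    (fun i => Sum.inr (i, x.2)) x.1
  left_inv := by rintro (a | x) <;> simp
  right_inv := by
    rintro ⟨i, a⟩
    refine Fin.cases ?_ (fun i => ?_) i <;> simp

lemma tauP_submatrix_blockEquiv {n : ℕ} (g : Matrix (Fin (n + 1)) (Fin (n + 1)) ℍ[ℝ]) :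
    (tauP g).submatrix (blockEquiv n) (blockEquiv n) =
      Matrix.fromBlocks (tauQ (g 0 0))
        (Matrix.of fun α j => tauQ (g 0 j.1.succ) α j.2)
        (Matrix.of fun i β => tauQ (g i.1.succ 0) i.2 β)
        (tauP (Matrix.of fun i j : Fin n => g i.succ j.succ)) := by
  ext (a | i) (b | j) <;> rfl

lemma det_tau_fromBlocks {n : ℕ} (g : Matrix (Fin (n + 1)) (Fin (n + 1)) ℍ[ℝ]) :
    (tau g).det = (Matrix.fromBlocks (tauQ (g 0 0))
        (Matrix.of fun α (j : Fin n × Fin 2) => tauQ (g 0 j.1.succ) α j.2)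
        (Matrix.of fun (i : Fin n × Fin 2) β => tauQ (g i.1.succ 0) i.2 β)
        (tauP (Matrix.of fun i j : Fin n => g i.succ j.succ))).det := by
  rw [← tauP_submatrix_blockEquiv, Matrix.det_submatrix_equiv_self, det_tau_eq]

/-- The Schur complement of the 2 × 2 block `tauQ (g 0 0)` is again the image of a quaternionic
matrix. This drives the induction in `det_tau_nonneg` and identifies J₂ in `det_tau_J2`. -/
lemma det_tau_schur {n : ℕ} (g : Matrix (Fin (n + 1)) (Fin (n + 1)) ℍ[ℝ]) (h : g 0 0 ≠ 0) :
    (tau g).det = ((‖g 0 0‖ ^ 2 : ℝ) : ℂ) *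
      (tau (Matrix.of fun i j : Fin n =>
        g i.succ j.succ - g i.succ 0 * (g 0 0)⁻¹ * g 0 j.succ)).det := by
  rw [det_tau_fromBlocks]
  let _ : Invertible (tauQ (g 0 0)) :=
    ⟨tauQ (g 0 0)⁻¹, by rw [← tauQ_mul, inv_mul_cancel₀ h, tauQ_one],
      by rw [← tauQ_mul, mul_inv_cancel₀ h, tauQ_one]⟩
  rw [Matrix.det_fromBlocks₁₁, det_tauQ, det_tau_eq]
  congr 2
  ext i j
  simp only [tauP, Matrix.sub_apply, Matrix.of_apply, Matrix.mul_apply]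
  have h1 : tauQ (g i.1.succ j.1.succ - g i.1.succ 0 * (g 0 0)⁻¹ * g 0 j.1.succ) =
      tauQ (g i.1.succ j.1.succ) -
        tauQ (g i.1.succ 0) * tauQ (g 0 0)⁻¹ * tauQ (g 0 j.1.succ) := by
    rw [← tauQ_mul, ← tauQ_mul]
    exact map_sub tauQHom _ _
  rw [h1]
  rfl

/-- Schur complement of the identity block in the lower right corner; here the corner entry may
vanish. -/
lemma det_tau_of_lower_one {n : ℕ} (g : Matrix (Fin (n + 1)) (Fin (n + 1)) ℍ[ℝ])
    (h : ∀ i j : Fin n, g i.succ j.succ = (1 : Matrix (Fin n) (Fin n) ℍ[ℝ]) i j) :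
    (tau g).det = ((‖g 0 0 - ∑ j : Fin n, g 0 j.succ * g j.succ 0‖ ^ 2 : ℝ) : ℂ) := by
  rw [det_tau_fromBlocks]
  have h1 : (Matrix.of fun i j : Fin n => g i.succ j.succ) = 1 := by
    ext1 i j; exact h i j
  rw [h1, tauP_one, Matrix.det_fromBlocks_one₂₂, ← det_tauQ]
  congr 1
  have h2 : tauQ (g 0 0 - ∑ j : Fin n, g 0 j.succ * g j.succ 0) =
      tauQ (g 0 0) - ∑ j : Fin n, tauQ (g 0 j.succ) * tauQ (g j.succ 0) := by
    simp only [← tauQ_mul, ← tauQ_sum]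
    exact map_sub tauQHom _ _
  rw [h2]
  ext a b
  simp [Matrix.mul_apply, Fintype.sum_prod_type, Matrix.sum_apply]

/-- The entries of `tauQ` as continuous real linear maps. -/
def tauQEntry (α β : Fin 2) : ℍ[ℝ] →L[ℝ] ℂ :=
  LinearMap.toContinuousLinearMap
    { toFun := fun x => tauQ x α β
      map_add' := fun x y => by rw [tauQ_add]; rfl
      map_smul' := fun r x => by rw [tauQ_smul]; simp }

@[simp] lemma tauQEntry_apply (α β : Fin 2) (x : ℍ[ℝ]) : tauQEntry α β x = tauQ x α β := rfl

lemma continuous_tau {p m : ℕ} :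
    Continuous (tau : Matrix (Fin p) (Fin m) ℍ[ℝ] → Matrix (Fin (p * 2)) (Fin (m * 2)) ℂ) := by
  refine continuous_matrix fun i j => ?_
  exact (tauQEntry _ _).continuous.comp (continuous_id.matrix_elem _ _)

/-- The complex determinant of a quaternionic matrix is a nonnegative real number. -/
lemma det_tau_nonneg {n : ℕ} (g : Matrix (Fin n) (Fin n) ℍ[ℝ]) : 0 ≤ (tau g).det := by
  induction n with
  | zero => simp [Matrix.det_isEmpty]
  | succ n ih =>
    have hne : ∀ g : Matrix (Fin (n + 1)) (Fin (n + 1)) ℍ[ℝ], g 0 0 ≠ 0 → 0 ≤ (tau g).det := by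
      intro g hg
      rw [det_tau_schur g hg]
      exact mul_nonneg (Complex.zero_le_real.2 (sq_nonneg _)) (ih _)
    -- A vanishing corner is perturbed to `t`. The determinant is continuous and nonnegative for `t
    -- ≠ 0`, so its limit at 0 is nonnegative.
    by_cases hg : g 0 0 = 0
    · have hc : Continuous fun t : ℝ => (tau (g + t • 1)).det :=
        (continuous_tau.comp (by fun_prop)).matrix_det
      have hlim := (hc.tendsto 0).mono_left (nhdsWithin_le_nhds (s := {0}ᶜ))
      simp only [zero_smul, add_zero] at hlim
      refine ge_of_tendsto hlim ?_
      filter_upwards [self_mem_nhdsWithin] with t ht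
      refine hne _ ?_
      simpa [hg] using ht
    · exact hne g hg

end Tau

/-! ### Elementary forms and the top coefficient -/

section Forms

variable {n : ℕ}

/-- The coefficient vector of `pullForm η β`. -/
def rowVec (η : Fin n → ℍ[ℝ]) (β : Fin 2) : Fin (n * 2) → ℂ :=
  fun A => tauQ (η (finProdFinEquiv.symm A).1) β (finProdFinEquiv.symm A).2

lemma pullForm_eq_ι (η : Fin n → ℍ[ℝ]) (β : Fin 2) :
    pullForm η β = ExteriorAlgebra.ι ℂ (rowVec η β) := by
  have h : rowVec η β = ∑ A, rowVec η β A • (Pi.single A (1 : ℂ) : Fin (n * 2) → ℂ) :=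
    pi_eq_sum_univ' _
  rw [h, map_sum]
  simp only [map_smul]
  rfl

lemma pullForm_add (η ξ : Fin n → ℍ[ℝ]) (β : Fin 2) :
    pullForm (η + ξ) β = pullForm η β + pullForm ξ β := by
  simp only [pullForm_eq_ι, ← map_add]
  congr 1
  ext A
  simp [rowVec, tauQ_add]

lemma pullForm_smul (r : ℝ) (η : Fin n → ℍ[ℝ]) (β : Fin 2) :
    pullForm (r • η) β = (r : ℂ) • pullForm η β := by
  simp only [pullForm_eq_ι, ← map_smul]
  congr 1
  ext A
  simp [rowVec, tauQ_smul]

lemma pullForm_sum {ι : Type*} (s : Finset ι) (f : ι → Fin n → ℍ[ℝ]) (β : Fin 2) :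
    pullForm (∑ i ∈ s, f i) β = ∑ i ∈ s, pullForm (f i) β := by
  simp only [pullForm_eq_ι, ← map_sum]
  congr 1
  ext A
  simp [rowVec, tauQ_sum, Matrix.sum_apply]

/-- Multiplicativity of `tauQ` in coordinates. Combined with antisymmetry it produces the factor det
(tauQ c) = ‖c‖² in `Lam_comp_transCLM`. -/
lemma pullForm_mul_left (c : ℍ[ℝ]) (η : Fin n → ℍ[ℝ]) (β : Fin 2) :
    pullForm (fun l => c * η l) β = ∑ γ, tauQ c β γ • pullForm η γ := by
  simp only [pullForm_eq_ι, ← map_smul, ← map_sum]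
  congr 1
  ext A
  simp only [rowVec, tauQ_mul, Matrix.mul_apply, Finset.sum_apply, Pi.smul_apply, smul_eq_mul]

lemma pullForm_anticomm (η ξ : Fin n → ℍ[ℝ]) (β γ : Fin 2) :
    pullForm η β * pullForm ξ γ = -(pullForm ξ γ * pullForm η β) := by
  simp only [pullForm_eq_ι]
  exact eq_neg_of_add_eq_zero_left (ExteriorAlgebra.ι_add_mul_swap _ _)

/-- The algebra homomorphism `grAct M`. -/
def grActHom (M : Matrix (Fin (n * 2)) (Fin (n * 2)) ℂ) : Gr n →ₐ[ℂ] Gr n :=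
  ExteriorAlgebra.map (Matrix.toLin' M)

lemma grAct_eq (M : Matrix (Fin (n * 2)) (Fin (n * 2)) ℂ) (w : Gr n) :
    grAct M w = grActHom M w := rfl

lemma grActHom_pullForm (A : Matrix (Fin n) (Fin n) ℍ[ℝ]) (η : Fin n → ℍ[ℝ]) (β : Fin 2) :
    grActHom (tau A).transpose (pullForm η β) = pullForm (Matrix.vecMul η A) β := by
  rw [pullForm_eq_ι, pullForm_eq_ι, grActHom, ExteriorAlgebra.map_apply_ι]
  congr 1
  ext B
  rw [Matrix.toLin'_apply, Matrix.mulVec_transpose]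
  simp only [Matrix.vecMul, dotProduct, rowVec, tauQ_sum, tauQ_mul, Matrix.sum_apply,
    Matrix.mul_apply]
  rw [← finProdFinEquiv.sum_comp, Fintype.sum_prod_type]
  refine Finset.sum_congr rfl fun i _ => Finset.sum_congr rfl fun α _ => ?_
  simp only [Equiv.symm_apply_apply]
  rw [← finProdFinEquiv.apply_symm_apply B, tau_apply, finProdFinEquiv.apply_symm_apply B]

/-- The elementary strongly positive `2`-element of a row vector. -/
def elemForm (η : Fin n → ℍ[ℝ]) : Gr n := pullForm η 0 * pullForm η 1

lemma elemForm_smul (r : ℝ) (η : Fin n → ℍ[ℝ]) :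
    elemForm (r • η) = ((r ^ 2 : ℝ) : ℂ) • elemForm η := by
  simp only [elemForm, pullForm_smul, smul_mul_smul_comm]
  push_cast
  ring_nf

lemma grActHom_elemForm (A : Matrix (Fin n) (Fin n) ℍ[ℝ]) (η : Fin n → ℍ[ℝ]) :
    grActHom (tau A).transpose (elemForm η) = elemForm (Matrix.vecMul η A) := by
  rw [elemForm, map_mul, grActHom_pullForm, grActHom_pullForm, elemForm]

lemma pullForm_mem (η : Fin n → ℍ[ℝ]) (β : Fin 2) :
    pullForm η β ∈ ⋀[ℂ]^1 (Fin (n * 2) → ℂ) := by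
  rw [pullForm_eq_ι, ExteriorAlgebra.exteriorPower, pow_one]
  exact LinearMap.mem_range_self _ _

lemma elemForm_mem (η : Fin n → ℍ[ℝ]) : elemForm η ∈ ⋀[ℂ]^2 (Fin (n * 2) → ℂ) :=
  SetLike.mul_mem_graded (A := fun i : ℕ => ⋀[ℂ]^i (Fin (n * 2) → ℂ))
    (pullForm_mem η 0) (pullForm_mem η 1)

lemma list_prod_mem {p : ℕ} (f : Fin p → Gr n)
    (hf : ∀ i, f i ∈ ⋀[ℂ]^2 (Fin (n * 2) → ℂ)) :
    (List.ofFn f).prod ∈ ⋀[ℂ]^(2 * p) (Fin (n * 2) → ℂ) := by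
  have := SetLike.list_prod_ofFn_mem_graded (A := fun i : ℕ => ⋀[ℂ]^i (Fin (n * 2) → ℂ))
    (fun _ => 2) f hf
  convert this using 2
  simp [mul_comm]

/-- Moving a generator past two others changes the sign twice. -/
lemma ι_mul_ι_mem_center (v w : Fin (n * 2) → ℂ) :
    ExteriorAlgebra.ι ℂ v * ExteriorAlgebra.ι ℂ w ∈ Subalgebra.center ℂ (Gr n) := by
  rw [Subalgebra.mem_center_iff]
  intro x
  induction x using ExteriorAlgebra.induction with
  | algebraMap r => exact Algebra.commutes _ _
  | ι u =>
    have h1 := eq_neg_of_add_eq_zero_left (ExteriorAlgebra.ι_add_mul_swap (R := ℂ) u v)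
    have h2 := eq_neg_of_add_eq_zero_left (ExteriorAlgebra.ι_add_mul_swap (R := ℂ) u w)
    rw [← mul_assoc, h1, neg_mul, mul_assoc, h2, mul_neg, neg_neg, mul_assoc]
  | mul a b ha hb => rw [mul_assoc, hb, ← mul_assoc, ha, mul_assoc]
  | add a b ha hb => rw [add_mul, mul_add, ha, hb]

lemma pullForm_mul_mem_center (η ξ : Fin n → ℍ[ℝ]) (β γ : Fin 2) :
    pullForm η β * pullForm ξ γ ∈ Subalgebra.center ℂ (Gr n) := by
  simp only [pullForm_eq_ι]
  exact ι_mul_ι_mem_center _ _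

/-- The top coefficient as a linear functional. -/
def topL (n : ℕ) : Gr n →ₗ[ℂ] ℂ := (monoBasis n).coord Finset.univ

lemma topL_apply (w : Gr n) : topL n w = topCoeff w := rfl

/-- An alternating map in as many vectors as the dimension is a multiple of the determinant; the
multiple is its value on the standard basis. -/
lemma topCoeff_ιMulti (v : Fin (n * 2) → Fin (n * 2) → ℂ) :
    topCoeff (ExteriorAlgebra.ιMulti ℂ (n * 2) v) = (Matrix.of v).det := by
  have h := ((topL n).compAlternatingMap (ExteriorAlgebra.ιMulti ℂ (n * 2))).eq_smul_basis_det
    (Pi.basisFun ℂ (Fin (n * 2)))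
  have h1 : topL n (ExteriorAlgebra.ιMulti ℂ (n * 2) (Pi.basisFun ℂ (Fin (n * 2)))) = 1 := by
    have hc : (Finset.univ : Finset (Fin (n * 2))).card = n * 2 := by simp
    have h2 := ExteriorAlgebra.basis_apply_ofCard (Pi.basisFun ℂ (Fin (n * 2))) hc
    have h3 : (Set.powersetCard.ofFinEmbEquiv.symm (Set.powersetCard.ofCard hc) :
        Fin (n * 2) → Fin (n * 2)) = id := by
      rw [Set.powersetCard.ofFinEmbEquiv_symm_apply]
      exact (Finset.orderEmbOfFin_unique _ (by simp) strictMono_id).symm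
    rw [ExteriorAlgebra.ιMulti_family, h3, Function.comp_id] at h2
    rw [← h2]
    change (monoBasis n).repr (monoBasis n Finset.univ) Finset.univ = 1
    rw [Module.Basis.repr_self, Finsupp.single_eq_same]
  have h4 := congr_arg (fun f => f v) h
  simp only [LinearMap.compAlternatingMap_apply, h1, one_smul,
    Pi.basisFun_det_apply] at h4
  exact h4

/-- The top degree is spanned by decomposable products, on which acting by M multiplies the matrix
of rows by the transpose of M on the right. -/
lemma topCoeff_grActHom (M : Matrix (Fin (n * 2)) (Fin (n * 2)) ℂ) {w : Gr n}
    (hw : w ∈ ⋀[ℂ]^(2 * n) (Fin (n * 2) → ℂ)) :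
    topCoeff (grActHom M w) = M.det * topCoeff w := by
  rw [mul_comm 2 n, ← ExteriorAlgebra.ιMulti_span_fixedDegree] at hw
  simp only [← topL_apply]
  induction hw using Submodule.span_induction with
  | mem x hx =>
    obtain ⟨v, rfl⟩ := hx
    rw [grActHom, ExteriorAlgebra.map_apply_ιMulti, topL_apply, topL_apply, topCoeff_ιMulti,
      topCoeff_ιMulti]
    have : Matrix.of (⇑(Matrix.toLin' M) ∘ v) = Matrix.of v * M.transpose := by
      ext i j
      simp [Matrix.mul_apply, Matrix.mulVec, dotProduct, mul_comm]
    rw [this, Matrix.det_mul, Matrix.det_transpose, mul_comm]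
  | zero => simp
  | add x y _ _ hx hy => rw [map_add, map_add, map_add, hx, hy, mul_add]
  | smul a x _ hx => rw [map_smul, map_smul, map_smul, hx]; simp only [smul_eq_mul]; ring

/-- The factors of the product, read in order, are the rows of `tau (Matrix.of η)`, since row 2l + α
comes from the form α of the row vector l. -/
lemma topCoeff_elemForms (η : Fin n → Fin n → ℍ[ℝ]) :
    topCoeff (List.ofFn fun j => elemForm (η j)).prod = (tau (Matrix.of η)).det := by
  have h : (List.ofFn fun j => elemForm (η j)).prod =
      ExteriorAlgebra.ιMulti ℂ (n * 2) (fun A =>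
        rowVec (η (finProdFinEquiv.symm A).1) (finProdFinEquiv.symm A).2) := by
    rw [ExteriorAlgebra.ιMulti_apply, List.ofFn_mul, List.prod_flatten, List.map_ofFn]
    congr 2
    funext j
    simp only [Function.comp_apply, List.ofFn_succ, List.ofFn_zero, List.prod_cons,
      List.prod_nil, mul_one, elemForm, pullForm_eq_ι]
    have e0 : ∀ (α : Fin 2) (h : (j : ℕ) * 2 + α < n * 2),
        finProdFinEquiv.symm (⟨(j : ℕ) * 2 + α, h⟩ : Fin (n * 2)) = (j, α) := by
      intro α h
      rw [Equiv.symm_apply_eq]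
      ext
      simp [finProdFinEquiv]
      ring
    congr 3
    · rw [e0]
    · rw [e0]
    · rw [e0 (Fin.succ 0)]
    · rw [e0 (Fin.succ 0)]; rfl
  rw [h, topCoeff_ιMulti]
  congr 1

end Forms

/-! ### Real bilinear forms and the associated `2`-forms -/

section Bilinear

variable {n : ℕ}

/-- Indices of the real coordinates. -/
abbrev RIdx (n : ℕ) : Type := Fin n × Fin 4

/-- The real basis of the quaternionic space. -/
def basisVec (j : RIdx n) : Hn n := Pi.single j.1 (unitQ j.2)

/-- The row vector whose real part is the real coordinate `j`. -/
def coordRow (j : RIdx n) : Fin n → ℍ[ℝ] := Pi.single j.1 (star (unitQ j.2))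

/-- The real functional of a row vector. -/
def rowFun (ξ : Fin n → ℍ[ℝ]) (v : Hn n) : ℝ := (∑ l, ξ l * v l).re

lemma quaternion_expand (x : ℍ[ℝ]) : ∑ m, (star (unitQ m) * x).re • unitQ m = x := by
  ext <;> simp [Fin.sum_univ_four] <;> simp [unitQ]

lemma quaternion_expand_star (x : ℍ[ℝ]) : ∑ m, (x * unitQ m).re • star (unitQ m) = x := by
  ext <;> simp [Fin.sum_univ_four] <;> simp [unitQ]

lemma norm_unitQ (m : Fin 4) : ‖unitQ m‖ = 1 := by
  have : ‖unitQ m‖ ^ 2 = 1 := by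
    rw [norm_sq_eq]
    fin_cases m <;> simp [unitQ]
  nlinarith [norm_nonneg (unitQ m)]

lemma rowFun_basisVec (ξ : Fin n → ℍ[ℝ]) (j : RIdx n) :
    rowFun ξ (basisVec j) = (ξ j.1 * unitQ j.2).re := by
  rw [rowFun, Finset.sum_eq_single j.1]
  · simp [basisVec]
  · intro b _ hb; simp [basisVec, hb]
  · simp

lemma rowFun_coordRow (j : RIdx n) (v : Hn n) :
    rowFun (coordRow j) v = (star (unitQ j.2) * v j.1).re := by
  rw [rowFun, Finset.sum_eq_single j.1]
  · simp [coordRow]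
  · intro b _ hb; simp [coordRow, hb]
  · simp

lemma sum_basisVec (v : Hn n) : ∑ j, rowFun (coordRow j) v • basisVec j = v := by
  rw [Fintype.sum_prod_type]
  conv_rhs => rw [← Finset.univ_sum_single v]
  refine Finset.sum_congr rfl fun l _ => ?_
  conv_rhs => rw [← quaternion_expand (v l)]
  ext1 k
  by_cases hk : k = l
  · subst hk; simp [rowFun_coordRow, basisVec, Finset.sum_apply]
  · simp [basisVec, Finset.sum_apply, hk]

lemma sum_coordRow (ξ : Fin n → ℍ[ℝ]) : ∑ j, rowFun ξ (basisVec j) • coordRow j = ξ := by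
  rw [Fintype.sum_prod_type]
  conv_rhs => rw [← Finset.univ_sum_single ξ]
  refine Finset.sum_congr rfl fun l _ => ?_
  conv_rhs => rw [← quaternion_expand_star (ξ l)]
  ext1 k
  by_cases hk : k = l
  · subst hk; simp [rowFun_basisVec, coordRow, Finset.sum_apply]
  · simp [coordRow, Finset.sum_apply, hk]

/-- The `1`-form `d_β x_j`. -/
def theta (β : Fin 2) (j : RIdx n) : Gr n := (1 / 2 : ℂ) • pullForm (coordRow j) β

/-- The left side is d_β of the real linear function `rowFun ξ`, expanded in coordinates. It turns
substitutions in linear functions into substitutions in row vectors. -/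
lemma sum_theta (ξ : Fin n → ℍ[ℝ]) (β : Fin 2) :
    ∑ j, (rowFun ξ (basisVec j) : ℂ) • theta β j = (1 / 2 : ℂ) • pullForm ξ β := by
  conv_rhs => rw [← sum_coordRow ξ, pullForm_sum, Finset.smul_sum]
  refine Finset.sum_congr rfl fun j _ => ?_
  rw [pullForm_smul, theta, smul_comm]

lemma theta_anticomm (β γ : Fin 2) (j k : RIdx n) :
    theta β j * theta γ k = -(theta γ k * theta β j) := by
  simp only [theta, smul_mul_smul_comm]
  rw [pullForm_anticomm, smul_neg]

/-- The `2`-form of a real bilinear form. -/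
def Lam (B : Hn n →L[ℝ] Hn n →L[ℝ] ℝ) : Gr n :=
  ∑ j, ∑ k, (B (basisVec j) (basisVec k) : ℂ) • (theta 0 j * theta 1 k)

lemma Lam_add (B B' : Hn n →L[ℝ] Hn n →L[ℝ] ℝ) : Lam (B + B') = Lam B + Lam B' := by
  simp [Lam, add_smul, Finset.sum_add_distrib]

lemma Lam_smul (r : ℝ) (B : Hn n →L[ℝ] Hn n →L[ℝ] ℝ) : Lam (r • B) = (r : ℂ) • Lam B := by
  simp [Lam, mul_smul, Finset.smul_sum]

lemma Lam_sum {ι : Type*} (s : Finset ι) (B : ι → Hn n →L[ℝ] Hn n →L[ℝ] ℝ) :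
    Lam (∑ i ∈ s, B i) = ∑ i ∈ s, Lam (B i) := by
  classical
  induction s using Finset.induction_on with
  | empty => simp [Lam]
  | insert a s ha ih => rw [Finset.sum_insert ha, Finset.sum_insert ha, Lam_add, ih]

/-- The `2`-form of a bilinear form is central. -/
lemma Lam_mem_center (B : Hn n →L[ℝ] Hn n →L[ℝ] ℝ) : Lam B ∈ Subalgebra.center ℂ (Gr n) := by
  refine sum_mem fun j _ => sum_mem fun k _ => Subalgebra.smul_mem _ ?_ _
  simp only [theta, smul_mul_smul_comm]
  exact Subalgebra.smul_mem _ (pullForm_mul_mem_center _ _ _ _) _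

lemma Lam_mem (B : Hn n →L[ℝ] Hn n →L[ℝ] ℝ) : Lam B ∈ ⋀[ℂ]^2 (Fin (n * 2) → ℂ) := by
  refine sum_mem fun j _ => sum_mem fun k _ => Submodule.smul_mem _ _ ?_
  simp only [theta, smul_mul_smul_comm]
  exact Submodule.smul_mem _ _ (SetLike.mul_mem_graded
    (A := fun i : ℕ => ⋀[ℂ]^i (Fin (n * 2) → ℂ)) (pullForm_mem _ 0) (pullForm_mem _ 1))

/-- The map `v ↦ A v c`. -/
def transCLM (A : Matrix (Fin n) (Fin n) ℍ[ℝ]) (c : ℍ[ℝ]) : Hn n →L[ℝ] Hn n :=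
  LinearMap.toContinuousLinearMap
    { toFun := fun v i => A.mulVec v i * c
      map_add' := fun v w => by ext1 i; simp [Matrix.mulVec_add, add_mul]
      map_smul' := fun r v => by ext1 i; simp [Matrix.mulVec_smul] }

@[simp] lemma transCLM_apply (A : Matrix (Fin n) (Fin n) ℍ[ℝ]) (c : ℍ[ℝ]) (v : Hn n) (i : Fin n) :
    transCLM A c v i = A.mulVec v i * c := rfl

lemma re_mul_comm (x y : ℍ[ℝ]) : (x * y).re = (y * x).re := by
  simp; ring

lemma rowFun_transCLM (ξ : Fin n → ℍ[ℝ]) (A : Matrix (Fin n) (Fin n) ℍ[ℝ]) (c : ℍ[ℝ]) (v : Hn n) :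
    rowFun ξ (transCLM A c v) = rowFun (fun l => c * Matrix.vecMul ξ A l) v := by
  have h : ∑ l, ξ l * (A.mulVec v l * c) = (∑ l, Matrix.vecMul ξ A l * v l) * c := by
    simp only [← mul_assoc, ← Finset.sum_mul]
    congr 1
    exact Matrix.dotProduct_mulVec ξ A v
  simp only [rowFun, transCLM_apply]
  rw [h, re_mul_comm, Finset.mul_sum]
  simp only [mul_assoc]

lemma bilin_expand (B : Hn n →L[ℝ] Hn n →L[ℝ] ℝ) (v w : Hn n) :
    B v w = ∑ a, ∑ b, rowFun (coordRow a) v * rowFun (coordRow b) w *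
      B (basisVec a) (basisVec b) := by
  conv_lhs => rw [← sum_basisVec v, ← sum_basisVec w]
  simp only [map_sum, map_smul, sum_apply, smul_apply,
    smul_eq_mul, Finset.mul_sum]
  rw [Finset.sum_comm]
  refine Finset.sum_congr rfl fun a _ => Finset.sum_congr rfl fun b _ => by ring

/-- Transformation of the `2`-form of a symmetric bilinear form. -/
lemma Lam_comp_transCLM {B : Hn n →L[ℝ] Hn n →L[ℝ] ℝ} (hB : ∀ v w, B v w = B w v)
    (A : Matrix (Fin n) (Fin n) ℍ[ℝ]) (c : ℍ[ℝ]) :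
    Lam (B.bilinearComp (transCLM A c) (transCLM A c)) =
      ((‖c‖ ^ 2 : ℝ) : ℂ) • grActHom (tau A).transpose (Lam B) := by
  set ζ : RIdx n → Fin n → ℍ[ℝ] := fun a => Matrix.vecMul (coordRow a) A
  -- For symmetric B and anticommuting 1-forms, S is antisymmetric in its two indices, so only S 0 1
  -- and S 1 0 = -S 0 1 survive.
  set S : Fin 2 → Fin 2 → Gr n := fun γ δ =>
    ∑ a, ∑ b, (B (basisVec a) (basisVec b) : ℂ) • (pullForm (ζ a) γ * pullForm (ζ b) δ) with hS
  have hanti : ∀ γ δ, S γ δ = -S δ γ := by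
    intro γ δ
    simp only [hS]
    rw [Finset.sum_comm, ← Finset.sum_neg_distrib]
    refine Finset.sum_congr rfl fun a _ => ?_
    rw [← Finset.sum_neg_distrib]
    refine Finset.sum_congr rfl fun b _ => ?_
    rw [hB, pullForm_anticomm, smul_neg]
  have hself : ∀ γ, S γ γ = 0 := fun γ => by
    have h := hanti γ γ
    have h2 : (2 : ℂ) • S γ γ = 0 := by rw [two_smul]; nth_rw 1 [h]; simp
    exact (smul_eq_zero.1 h2).resolve_left two_ne_zero
  have hr : grActHom (tau A).transpose (Lam B) = (1 / 4 : ℂ) • S 0 1 := by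
    simp only [Lam, map_sum, map_smul, theta, smul_mul_smul_comm, map_mul, grActHom_pullForm, hS,
      Finset.smul_sum]
    refine Finset.sum_congr rfl fun a _ => Finset.sum_congr rfl fun b _ => ?_
    rw [smul_comm]
    norm_num [ζ]
  -- Pulling back replaces the coordinate row a by c ζ_a: the right factor c moves to the left
  -- because re(xy) = re(yx).
  have hl : Lam (B.bilinearComp (transCLM A c) (transCLM A c)) =
      ∑ a, ∑ b, (B (basisVec a) (basisVec b) : ℂ) •
        (((1 / 2 : ℂ) • pullForm (fun l => c * ζ a l) 0) *
          ((1 / 2 : ℂ) • pullForm (fun l => c * ζ b l) 1)) := by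
    simp only [← sum_theta, Finset.sum_mul_sum, Finset.smul_sum]
    simp only [Lam, ContinuousLinearMap.bilinearComp_apply]
    have : ∀ j k : RIdx n, ((B (transCLM A c (basisVec j)) (transCLM A c (basisVec k)) : ℝ) : ℂ) •
        (theta 0 j * theta 1 k) = ∑ a, ∑ b, (B (basisVec a) (basisVec b) : ℂ) •
        ((rowFun (fun l => c * ζ a l) (basisVec j) : ℂ) • theta 0 j *
          (rowFun (fun l => c * ζ b l) (basisVec k) : ℂ) • theta 1 k) := by
      intro j k
      rw [bilin_expand B]
      push_cast
      simp only [Finset.sum_smul, rowFun_transCLM, smul_mul_smul_comm, smul_smul]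
      refine Finset.sum_congr rfl fun a _ => Finset.sum_congr rfl fun b _ => ?_
      congr 1
      ring
    simp only [this]
    calc _ = ∑ j, ∑ a, ∑ k, ∑ b, (B (basisVec a) (basisVec b) : ℂ) •
        ((rowFun (fun l => c * ζ a l) (basisVec j) : ℂ) • theta 0 j *
          (rowFun (fun l => c * ζ b l) (basisVec k) : ℂ) • theta 1 k) :=
          Finset.sum_congr rfl fun j _ => Finset.sum_comm
      _ = ∑ a, ∑ j, ∑ b, ∑ k, _ := by
          rw [Finset.sum_comm]
          exact Finset.sum_congr rfl fun j _ => Finset.sum_congr rfl fun j _ => Finset.sum_comm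
      _ = _ := Finset.sum_congr rfl fun j _ => Finset.sum_comm
  -- After the diagonal terms drop out, the coefficient of S 0 1 in this sum is the determinant of
  -- `tauQ c`.
  have h4 : Lam (B.bilinearComp (transCLM A c) (transCLM A c)) =
      (1 / 4 : ℂ) • ∑ γ, ∑ δ, (tauQ c 0 γ * tauQ c 1 δ) • S γ δ := by
    rw [hl]
    simp only [pullForm_mul_left, Fin.sum_univ_two, hS, Finset.smul_sum, ← Finset.sum_add_distrib]
    refine Finset.sum_congr rfl fun a _ => Finset.sum_congr rfl fun b _ => ?_
    simp only [smul_add, mul_add, add_mul, smul_mul_smul_comm, smul_smul]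
    have e : ∀ x y : ℂ, ∀ w : Gr n, ∀ r : ℂ,
        (r * (1 / 2 * x * (1 / 2 * y))) • w = (1 / 4 * (x * y * r)) • w := by
      intro x y w r; congr 1; ring
    simp only [e]
    abel
  rw [h4, hr, ← det_tauQ, Matrix.det_fin_two]
  simp only [Fin.sum_univ_two, hself, hanti 1 0, smul_zero, zero_add, add_zero, smul_neg]
  rw [← sub_eq_add_neg, ← sub_smul, smul_comm]

lemma transCLM_unit (v : Hn n) (c : ℍ[ℝ]) : transCLM 1 c v = fun l => v l * c := by
  ext1 l; simp

/-- The sum of `B` over the right translates by the quaternion units. -/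
def lineAvg (B : Hn n →L[ℝ] Hn n →L[ℝ] ℝ) : Hn n →L[ℝ] Hn n →L[ℝ] ℝ :=
  ∑ m, B.bilinearComp (transCLM 1 (unitQ m)) (transCLM 1 (unitQ m))

lemma lineAvg_apply (B : Hn n →L[ℝ] Hn n →L[ℝ] ℝ) (v w : Hn n) :
    lineAvg B v w = ∑ m, B (fun l => v l * unitQ m) (fun l => w l * unitQ m) := by
  simp [lineAvg, ContinuousLinearMap.bilinearComp_apply,
    transCLM_unit]

/-- Each of the four unit translates contributes `Lam B`, by `Lam_comp_transCLM` with A = 1 and |c|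
= 1. Therefore `Lam` depends only on the part of B invariant under right multiplication by the
units. -/
lemma Lam_lineAvg {B : Hn n →L[ℝ] Hn n →L[ℝ] ℝ} (hB : ∀ v w, B v w = B w v) :
    Lam (lineAvg B) = (4 : ℂ) • Lam B := by
  rw [lineAvg, Lam_sum]
  simp only [Lam_comp_transCLM hB, norm_unitQ, tau_one, Matrix.transpose_one]
  have : grActHom (1 : Matrix (Fin (n * 2)) (Fin (n * 2)) ℂ) = AlgHom.id ℂ _ := by
    rw [grActHom, Matrix.toLin'_one]
    exact ExteriorAlgebra.map_id
  simp [this, ← Nat.cast_smul_eq_nsmul ℂ]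

lemma lineAvg_symm {B : Hn n →L[ℝ] Hn n →L[ℝ] ℝ} (hB : ∀ v w, B v w = B w v) (v w : Hn n) :
    lineAvg B v w = lineAvg B w v := by
  simp only [lineAvg_apply]
  exact Finset.sum_congr rfl fun m _ => hB _ _

lemma bilin_ext_of_symm {B B' : Hn n →L[ℝ] Hn n →L[ℝ] ℝ} (hB : ∀ v w, B v w = B w v)
    (hB' : ∀ v w, B' v w = B' w v) (h : ∀ v, B v v = B' v v) : B = B' := by
  ext v w
  have h1 := h (v + w)
  simp only [map_add, add_apply] at h1
  rw [h v, h w, hB w v, hB' w v] at h1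
  linarith

/-- Polarization together with `Lam_lineAvg`. It allows discarding every error term in a Hessian
that averages to zero over the quaternion units. -/
lemma Lam_congr {B B' : Hn n →L[ℝ] Hn n →L[ℝ] ℝ} (hB : ∀ v w, B v w = B w v)
    (hB' : ∀ v w, B' v w = B' w v) (h : ∀ v, lineAvg B v v = lineAvg B' v v) :
    Lam B = Lam B' := by
  have h1 := bilin_ext_of_symm (lineAvg_symm hB) (lineAvg_symm hB') h
  have h2 := Lam_lineAvg hB
  rw [h1, Lam_lineAvg hB'] at h2
  exact (smul_right_injective _ (four_ne_zero : (4 : ℂ) ≠ 0) h2).symm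

/-- Nonnegativity of the trace on quaternionic lines. -/
def LinePSD (B : Hn n →L[ℝ] Hn n →L[ℝ] ℝ) : Prop := ∀ v, 0 ≤ lineAvg B v v

/-- The `2`-form of a line-positive form is a sum of elementary strongly positive elements. -/
lemma exists_Lam_eq_sum_elemForm {B : Hn n →L[ℝ] Hn n →L[ℝ] ℝ} (hB : ∀ v w, B v w = B w v)
    (h : LinePSD B) : ∃ ξ : RIdx n → Fin n → ℍ[ℝ], Lam B = ∑ i, elemForm (ξ i) := by
  -- The matrix of the averaged form is positive semidefinite, hence Q = D*D; each row of D is a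
  -- real linear function, and the form is the sum of their squares.
  set Q : Matrix (RIdx n) (RIdx n) ℝ :=
    Matrix.of fun j k => lineAvg B (basisVec j) (basisVec k) with hQ
  have hpos : Q.PosSemidef := by
    refine Matrix.PosSemidef.of_dotProduct_mulVec_nonneg ?_ fun x => ?_
    · ext j k
      simp [hQ, lineAvg_symm hB (basisVec k)]
    · have h1 := h (∑ j, x j • basisVec j)
      simp only [map_sum, map_smul, sum_apply,
        smul_apply, smul_eq_mul] at h1
      simpa [dotProduct, Matrix.mulVec, hQ, mul_comm, Finset.mul_sum, Finset.sum_mul,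
        lineAvg_symm hB, mul_assoc, mul_left_comm] using h1
  obtain ⟨D, hD⟩ : ∃ D : Matrix (RIdx n) (RIdx n) ℝ, Q = D.conjTranspose * D := by
    open scoped MatrixOrder Matrix.Norms.L2Operator in
    exact CStarAlgebra.nonneg_iff_eq_star_mul_self.mp hpos.nonneg
  -- The scalar enters squared: 1/16 = 1/4 · 1/4, one factor from `Lam_lineAvg`, the other from the
  -- halves in `theta 0` and `theta 1`.
  refine ⟨fun i => (1 / 4 : ℝ) • ∑ j, D i j • coordRow j, ?_⟩
  have h1 : Lam (lineAvg B) = ∑ i, (1 / 4 : ℂ) • elemForm (∑ j, D i j • coordRow j) := by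
    have e : ∀ i : RIdx n, (1 / 4 : ℂ) • elemForm (∑ j, D i j • coordRow j) =
        (∑ j, (D i j : ℂ) • theta 0 j) * (∑ k, (D i k : ℂ) • theta 1 k) := by
      intro i
      have : ∀ β, ∑ j, (D i j : ℂ) • theta β j =
          (1 / 2 : ℂ) • pullForm (∑ j, D i j • coordRow j) β := by
        intro β
        rw [pullForm_sum, Finset.smul_sum]
        refine Finset.sum_congr rfl fun j _ => ?_
        rw [pullForm_smul, theta, smul_comm]
      rw [this, this, smul_mul_smul_comm, elemForm]
      norm_num
    simp only [e, Finset.sum_mul_sum]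
    rw [Lam]
    have e2 : ∀ j k : RIdx n, lineAvg B (basisVec j) (basisVec k) = ∑ i, D i j * D i k := by
      intro j k
      have := congr_fun (congr_fun hD j) k
      simpa [hQ, Matrix.mul_apply] using this
    simp only [e2]
    push_cast
    simp only [Finset.sum_smul, smul_mul_smul_comm]
    calc _ = ∑ j, ∑ i, ∑ k, ((D i j : ℂ) * (D i k : ℂ)) • (theta 0 j * theta 1 k) :=
          Finset.sum_congr rfl fun j _ => Finset.sum_comm
      _ = _ := Finset.sum_comm
  have h2 := Lam_lineAvg hB
  rw [h1] at h2
  have h3 : Lam B = (1 / 4 : ℂ) • ∑ i, (1 / 4 : ℂ) • elemForm (∑ j, D i j • coordRow j) := by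
    rw [h2, smul_smul]; norm_num
  rw [h3, Finset.smul_sum]
  refine Finset.sum_congr rfl fun i _ => ?_
  rw [elemForm_smul, smul_smul]
  norm_num

/-! ### Detecting the trace on a quaternionic line -/

/-- The row vectors annihilating a vector whose first entry is not zero. -/
def annihRow {p : ℕ} (v : Hn (p + 1)) (j : Fin p) : Fin (p + 1) → ℍ[ℝ] :=
  Fin.cons (-(v j.succ * (v 0)⁻¹)) (Pi.single j 1)

lemma linearIndependent_annihRow {p : ℕ} (v : Hn (p + 1)) :
    LinearIndependent ℍ[ℝ] (annihRow v) := by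
  rw [Fintype.linearIndependent_iff]
  intro g hg i
  have := congr_fun hg i.succ
  simpa [annihRow, Finset.sum_apply, Pi.single_apply] using this

/-- The matrix with rows ξ and `annihRow v` has an identity lower block, so its determinant is |s|²
for the Schur complement s of the corner. As the other rows annihilate v, ξ v = s v₀. -/
lemma topCoeff_elemForm_mul_annihRow {p : ℕ} (v : Hn (p + 1)) (h : v 0 ≠ 0)
    (ξ : Fin (p + 1) → ℍ[ℝ]) :
    topCoeff (elemForm ξ * (List.ofFn fun j => elemForm (annihRow v j)).prod) =
      (((‖v 0‖ ^ 2)⁻¹ * ‖∑ l, ξ l * v l‖ ^ 2 : ℝ) : ℂ) := by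
  have h1 := topCoeff_elemForms (Fin.cons ξ (annihRow v) : Fin (p + 1) → Fin (p + 1) → ℍ[ℝ])
  rw [List.ofFn_succ, List.prod_cons] at h1
  simp only [Fin.cons_zero, Fin.cons_succ] at h1
  rw [h1, det_tau_of_lower_one]
  · congr 1
    have : ∑ l, ξ l * v l =
        (ξ 0 - ∑ j : Fin p, ξ j.succ * annihRow v j 0) * v 0 := by
      rw [Fin.sum_univ_succ]
      simp [annihRow, add_mul, Finset.sum_mul, mul_assoc, h]
    simp only [Matrix.of_apply, Fin.cons_zero, Fin.cons_succ]
    rw [this, norm_mul, mul_pow]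
    have : ‖v 0‖ ^ 2 ≠ 0 := pow_ne_zero _ (norm_ne_zero_iff.2 h)
    field_simp
  · intro i j
    simp [annihRow, Matrix.one_apply, Pi.single_apply, eq_comm]

lemma sum_re_mul_unitQ_sq (x : ℍ[ℝ]) : ∑ m, (x * unitQ m).re ^ 2 = ‖x‖ ^ 2 := by
  rw [norm_sq_eq]
  simp [Fin.sum_univ_four]
  simp [unitQ]

/-- `elemForm` is quadratic, so polarization reduces `Lam` to elementary elements, whose top
coefficients are computable. In 1/8, a factor 4 compensates `pullForm` = 2 `theta` in both slots and
a factor 2 the symmetrization. -/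
lemma Lam_eq_polar {B : Hn n →L[ℝ] Hn n →L[ℝ] ℝ} (hB : ∀ v w, B v w = B w v) :
    Lam B = ∑ a, ∑ b, ((1 / 8 * B (basisVec a) (basisVec b) : ℝ) : ℂ) •
      (elemForm (coordRow a + coordRow b) - elemForm (coordRow a) - elemForm (coordRow b)) := by
  have h1 : ∀ a b : RIdx n,
      elemForm (coordRow a + coordRow b) - elemForm (coordRow a) - elemForm (coordRow b) =
        (4 : ℂ) • (theta 0 a * theta 1 b) + (4 : ℂ) • (theta 0 b * theta 1 a) := by
    intro a b
    simp only [elemForm, pullForm_add, theta, smul_mul_smul_comm, smul_smul, mul_add, add_mul]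
    norm_num
    abel
  simp only [h1, smul_add, smul_smul, Finset.sum_add_distrib]
  have h2 : ∑ a : RIdx n, ∑ b : RIdx n,
      (((1 / 8 * B (basisVec a) (basisVec b) : ℝ) : ℂ) * 4) • (theta 0 b * theta 1 a) =
      ∑ a : RIdx n, ∑ b : RIdx n,
      (((1 / 8 * B (basisVec a) (basisVec b) : ℝ) : ℂ) * 4) • (theta 0 a * theta 1 b) := by
    rw [Finset.sum_comm]
    simp only [hB]
  rw [h2, ← Finset.sum_add_distrib, Lam]
  refine Finset.sum_congr rfl fun a _ => ?_
  rw [← Finset.sum_add_distrib]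
  refine Finset.sum_congr rfl fun b _ => ?_
  rw [← add_smul]
  congr 1
  push_cast
  ring

/-- The same polarization as in `Lam_eq_polar`, based on ‖x‖² = ∑ re(x u)² over the four units u. -/
lemma lineAvg_eq_polar (B : Hn n →L[ℝ] Hn n →L[ℝ] ℝ) (v : Hn n) :
    lineAvg B v v = ∑ a, ∑ b, 1 / 2 * B (basisVec a) (basisVec b) *
      (‖∑ l, (coordRow a + coordRow b) l * v l‖ ^ 2 - ‖∑ l, coordRow a l * v l‖ ^ 2 -
        ‖∑ l, coordRow b l * v l‖ ^ 2) := by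
  have hr : ∀ (ξ : Fin n → ℍ[ℝ]) (c : ℍ[ℝ]),
      rowFun ξ (fun l => v l * c) = ((∑ l, ξ l * v l) * c).re := by
    intro ξ c
    simp only [rowFun, Finset.sum_mul, mul_assoc]
  rw [lineAvg_apply]
  simp only [bilin_expand B (fun l => v l * unitQ _), hr, ← sum_re_mul_unitQ_sq]
  rw [Finset.sum_comm]
  refine Finset.sum_congr rfl fun a _ => ?_
  rw [Finset.sum_comm]
  refine Finset.sum_congr rfl fun b _ => ?_
  rw [← Finset.sum_sub_distrib, ← Finset.sum_sub_distrib, Finset.mul_sum]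
  refine Finset.sum_congr rfl fun m _ => ?_
  have : (∑ l, (coordRow a + coordRow b) l * v l) =
      (∑ l, coordRow a l * v l) + (∑ l, coordRow b l * v l) := by
    simp only [Pi.add_apply, add_mul, Finset.sum_add_distrib]
  rw [this, add_mul, Quaternion.re_add]
  ring

/-- The trace on a quaternionic line is detected by elementary strongly positive elements. -/
lemma topCoeff_Lam_mul_annihRow {p : ℕ} (v : Hn (p + 1)) (h : v 0 ≠ 0)
    {B : Hn (p + 1) →L[ℝ] Hn (p + 1) →L[ℝ] ℝ} (hB : ∀ v w, B v w = B w v) :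
    topCoeff (Lam B * (List.ofFn fun j => elemForm (annihRow v j)).prod) =
      ((1 / 4 * (‖v 0‖ ^ 2)⁻¹ * lineAvg B v v : ℝ) : ℂ) := by
  -- Both polar expansions have the same shape, with coefficients 1/8 and 1/2; their ratio is the
  -- 1/4 of the claim.
  rw [Lam_eq_polar hB, lineAvg_eq_polar]
  simp only [Finset.sum_mul, smul_mul_assoc, sub_mul, ← topL_apply, map_sum, map_smul, map_sub]
  simp only [topL_apply, topCoeff_elemForm_mul_annihRow v h]
  push_cast
  simp only [Finset.mul_sum, smul_eq_mul]
  refine Finset.sum_congr rfl fun a _ => Finset.sum_congr rfl fun b _ => ?_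
  ring

/-! ### Positivity of products -/

/-- Finite sums of elementary strongly positive `2`-elements. -/
def IsPos2 (w : Gr n) : Prop := ∃ ξ : RIdx n → Fin n → ℍ[ℝ], w = ∑ i, elemForm (ξ i)

/-- The factors of `l` are expanded one by one into elementary elements, which are collected in
`l'`. Once `l` is exhausted, the top coefficient is a determinant of the form det τ ≥ 0. -/
lemma topCoeff_mul_list_nonneg (l : List (Gr n)) (hl : ∀ w ∈ l, IsPos2 w)
    (l' : List (Fin n → ℍ[ℝ])) (hlen : l'.length + l.length = n) :
    0 ≤ topCoeff ((l'.map elemForm).prod * l.prod) := by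
  induction l generalizing l' with
  | nil =>
    simp only [List.length_nil, add_zero] at hlen
    have h2 : l' = List.ofFn fun j : Fin n => l'.get (Fin.cast hlen.symm j) :=
      List.ext_get (by simpa using hlen) fun i h1 h2 => by simp
    have h := topCoeff_elemForms fun j : Fin n => l'.get (Fin.cast hlen.symm j)
    rw [h2, List.map_ofFn]
    change topCoeff ((List.ofFn fun j : Fin n =>
      elemForm (l'.get (Fin.cast hlen.symm j))).prod * _) ≥ 0
    rw [List.prod_nil, mul_one, h]
    exact det_tau_nonneg _
  | cons w l ih =>
    obtain ⟨ξ, rfl⟩ := hl w (by simp)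
    rw [List.prod_cons, Finset.sum_mul, Finset.mul_sum, ← topL_apply, map_sum]
    refine Finset.sum_nonneg fun i _ => ?_
    have := ih (fun w hw => hl w (by simp [hw])) (l' ++ [ξ i]) (by simp at hlen ⊢; omega)
    simpa [mul_assoc, topL_apply] using this

lemma topCoeff_list_prod_nonneg (l : List (Gr n)) (hl : ∀ w ∈ l, IsPos2 w)
    (hlen : l.length = n) : 0 ≤ topCoeff l.prod := by
  simpa using topCoeff_mul_list_nonneg l hl [] (by simpa using hlen)

end Bilinear

/-! ### The Grassmann algebra as a normed algebra, and first order calculus -/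

section Calculus

variable {n : ℕ}

/-- The left regular representation in coordinates. -/
def leftReg (n : ℕ) : Gr n →ₐ[ℂ]
    ((Finset (Fin (n * 2)) → ℂ) →L[ℂ] (Finset (Fin (n * 2)) → ℂ)) :=
  ((Module.End.toContinuousLinearMap (Finset (Fin (n * 2)) → ℂ) :
    _ ≃ₐ[ℂ] _).toAlgHom.comp
    ((monoBasis n).equivFun.conjAlgEquiv ℂ).toAlgHom).comp (Algebra.lmul ℂ (Gr n))

lemma leftReg_injective (n : ℕ) : Function.Injective (leftReg n) :=
  ((Module.End.toContinuousLinearMap (Finset (Fin (n * 2)) → ℂ) : _ ≃ₐ[ℂ] _).injective.comp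
    (((monoBasis n).equivFun.conjAlgEquiv ℂ).injective)).comp
      (Algebra.lmul_injective (R := ℂ) (A := Gr n))

/-- The operator norm of left multiplication is submultiplicative, so calculus with Grassmann valued
functions can use the product rule of normed algebras. -/
instance instNormedRingGr : NormedRing (Gr n) := NormedRing.induced _ _ (leftReg n)
  (leftReg_injective n)

instance instNormedAlgebraGr : NormedAlgebra ℂ (Gr n) := NormedAlgebra.induced ℂ _ _ (leftReg n)

instance instFiniteDimensionalGr : FiniteDimensional ℂ (Gr n) :=
  (monoBasis n).finiteDimensional_of_finite

instance instFiniteDimensionalRealGr : FiniteDimensional ℝ (Gr n) :=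
  FiniteDimensional.complexToReal _

instance instCompleteSpaceGr : CompleteSpace (Gr n) := FiniteDimensional.complete ℂ _

instance instNormedAlgebraRealGr : NormedAlgebra ℝ (Gr n) := NormedAlgebra.complexToReal

instance instNormedSpaceRealGr : NormedSpace ℝ (Gr n) := NormedAlgebra.toNormedSpace (Gr n)

instance instModuleRealGr : Module ℝ (Gr n) := instNormedSpaceRealGr.toModule

instance instSMulRealGr : SMul ℝ (Gr n) := instModuleRealGr.toSMul

lemma real_smul_eq (r : ℝ) (w : Gr n) : r • w = (r : ℂ) • w := rfl

/-- The coefficients of the monomial basis as continuous linear functionals. -/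
def coeffL (s : Finset (Fin (n * 2))) : Gr n →L[ℂ] ℂ :=
  LinearMap.toContinuousLinearMap ((monoBasis n).coord s)

@[simp] lemma coeffL_apply (s : Finset (Fin (n * 2))) (w : Gr n) :
    coeffL s w = (monoBasis n).repr w s := rfl

/-- The real linear coefficient functional. -/
def coeffLR (s : Finset (Fin (n * 2))) : Gr n →L[ℝ] ℂ := (coeffL s).restrictScalars ℝ

@[simp] lemma coeffLR_apply (s : Finset (Fin (n * 2))) (w : Gr n) :
    coeffLR s w = (monoBasis n).repr w s := rfl

lemma eq_sum_coeff (w : Gr n) : w = ∑ s, coeffLR s w • monoBasis n s := by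
  conv_lhs => rw [← (monoBasis n).sum_repr w]
  rfl

/-- Connects the coefficientwise smoothness used for test sections with calculus in the normed
algebra. -/
lemma contDiffOn_gr_iff {k : WithTop ℕ∞} {F : Hn n → Gr n} {U : Set (Hn n)} :
    ContDiffOn ℝ k F U ↔ ∀ s, ContDiffOn ℝ k (fun q => (monoBasis n).repr (F q) s) U := by
  constructor
  · intro h s
    exact (coeffLR s).contDiff.comp_contDiffOn h
  · intro h
    have : F = fun q => ∑ s, algebraMap ℂ (Gr n) ((monoBasis n).repr (F q) s) * monoBasis n s := by
      funext q
      conv_lhs => rw [eq_sum_coeff (F q)]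
      simp [Algebra.smul_def]
    rw [this]
    refine ContDiffOn.sum fun s _ => ContDiffOn.mul ?_ contDiffOn_const
    exact ((algebraMapCLM ℂ (Gr n)).restrictScalars ℝ).contDiff.comp_contDiffOn (h s)

lemma partialD_eq {F : Hn n → Gr n} {q : Hn n} (hF : DifferentiableAt ℝ F q) (l : Fin n)
    (m : Fin 4) : partialD l m F q = fderiv ℝ F q (basisVec (l, m)) := by
  rw [eq_sum_coeff (fderiv ℝ F q (basisVec (l, m))), partialD]
  refine Finset.sum_congr rfl fun s _ => ?_
  have h := (coeffLR s).hasFDerivAt.comp q hF.hasFDerivAt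
  have h2 : fderiv ℝ (fun p => (monoBasis n).repr (F p) s) q =
      (coeffLR s).comp (fderiv ℝ F q) := h.fderiv
  rw [h2]
  rfl

lemma pullForm_single (l : Fin n) (x : ℍ[ℝ]) (β : Fin 2) :
    pullForm (Pi.single l x) β =
      ∑ α, tauQ x β α • (omega (finProdFinEquiv (l, α)) : Gr n) := by
  rw [pullForm, ← finProdFinEquiv.sum_comp, Fintype.sum_prod_type, Finset.sum_eq_single l]
  · simp only [Equiv.symm_apply_apply, Pi.single_eq_same]
  · intro b _ hb
    simp [Equiv.symm_apply_apply, hb, tauQ_zero]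
  · simp

lemma hasFDerivAt_fderiv_apply {E : Type*} [NormedAddCommGroup E] [NormedSpace ℝ E]
    {F : Hn n → E} {q : Hn n} (hF : ContDiffAt ℝ 2 F q) (v : Hn n) :
    HasFDerivAt (fun p => fderiv ℝ F p v) ((fderiv ℝ (fderiv ℝ F) q).flip v) q := by
  have h1 : ContDiffAt ℝ 1 (fderiv ℝ F) q := hF.fderiv_right (by norm_num)
  have hd : DifferentiableAt ℝ (fderiv ℝ F) q := h1.differentiableAt (by simp)
  have h := hd.hasFDerivAt.clm_apply (hasFDerivAt_const v q)
  rwa [ContinuousLinearMap.comp_zero, zero_add] at h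

lemma contDiffAt_fderiv_apply {E : Type*} [NormedAddCommGroup E] [NormedSpace ℝ E]
    {F : Hn n → E} {q : Hn n} {k : ℕ} (hF : ContDiffAt ℝ (k + 1 : ℕ) F q) (v : Hn n) :
    ContDiffAt ℝ k (fun p => fderiv ℝ F p v) q :=
  (hF.fderiv_right (m := k) (by push_cast; rfl)).clm_apply contDiffAt_const

/-- The entries of the matrix of vector fields are half the entries of `tauQ (star (unitQ m))`, that
is, the coefficients of the forms `theta`. This reduces d_{A'} to a constant coefficient combination
of partial derivatives. -/
lemma dOp_eq {F : Hn n → Gr n} {q : Hn n} (hF : DifferentiableAt ℝ F q) (A' : Fin 2) :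
    dOp A' F q = ∑ j, theta A' j * fderiv ℝ F q (basisVec j) := by
  rw [dOp, ← finProdFinEquiv.sum_comp, Fintype.sum_prod_type, Fintype.sum_prod_type]
  refine Finset.sum_congr rfl fun l _ => ?_
  simp only [nabla, Equiv.symm_apply_apply, partialD_eq hF, theta, coordRow, pullForm_single,
    Fin.sum_univ_four, Fin.sum_univ_two]
  generalize fderiv ℝ F q (basisVec (l, 0)) = t0
  generalize fderiv ℝ F q (basisVec (l, 1)) = t1
  generalize fderiv ℝ F q (basisVec (l, 2)) = t2
  generalize fderiv ℝ F q (basisVec (l, 3)) = t3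
  generalize (omega (finProdFinEquiv (l, (0 : Fin 2))) : Gr n) = w0
  generalize (omega (finProdFinEquiv (l, (1 : Fin 2))) : Gr n) = w1
  have e : ∀ m, star (unitQ m) = (![⟨1, 0, 0, 0⟩, ⟨0, -1, 0, 0⟩, ⟨0, 0, -1, 0⟩, ⟨0, 0, 0, -1⟩] :
      Fin 4 → ℍ[ℝ]) m := by
    intro m
    fin_cases m <;> ext <;> simp <;> simp [unitQ]
  simp only [e]
  have i1 : (⟨0, 1⟩ : ℂ) = Complex.I := rfl
  have i2 : (⟨0, -1⟩ : ℂ) = -Complex.I := by apply Complex.ext <;> simp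
  have i3 : (⟨1, 0⟩ : ℂ) = 1 := rfl
  have i4 : (⟨-1, 0⟩ : ℂ) = -1 := by apply Complex.ext <;> simp
  have i5 : (⟨0, 0⟩ : ℂ) = 0 := rfl
  fin_cases A' <;>
    simp [tauQ, i1, i2, i3, i4, i5, mul_add, mul_sub, smul_add, smul_sub,
      neg_mul, mul_neg, smul_smul] <;> module

lemma dOp_eventuallyEq {F : Hn n → Gr n} {q : Hn n} (hF : ContDiffAt ℝ 1 F q) (A' : Fin 2) :
    dOp A' F =ᶠ[nhds q] fun p => ∑ j, theta A' j * fderiv ℝ F p (basisVec j) := by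
  filter_upwards [hF.eventually (by simp)] with p hp
  exact dOp_eq (hp.differentiableAt (by simp)) A'

lemma dOp_congr {F G : Hn n → Gr n} {q : Hn n} (h : F =ᶠ[nhds q] G) (A' : Fin 2) :
    dOp A' F q = dOp A' G q := by
  have : ∀ l m, partialD l m F q = partialD l m G q := by
    intro l m
    refine Finset.sum_congr rfl fun s _ => ?_
    have h2 : (fun p => (monoBasis n).repr (F p) s) =ᶠ[nhds q]
        fun p => (monoBasis n).repr (G p) s := h.mono fun p hp => by simp only [hp]
    rw [h2.fderiv_eq]
  simp only [dOp, nabla, this]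

lemma contDiffAt_dOp {F : Hn n → Gr n} {q : Hn n} {k : ℕ} (hF : ContDiffAt ℝ (k + 1 : ℕ) F q)
    (A' : Fin 2) : ContDiffAt ℝ k (dOp A' F) q := by
  refine ContDiffAt.congr_of_eventuallyEq ?_ (dOp_eventuallyEq (hF.of_le (by simp)) A')
  exact ContDiffAt.sum fun j _ => contDiffAt_const.mul (contDiffAt_fderiv_apply hF _)

lemma dOp_algebraMap_mul {f : Hn n → ℂ} {F : Hn n → Gr n} {q : Hn n}
    (hf : DifferentiableAt ℝ f q) (hF : DifferentiableAt ℝ F q) (A' : Fin 2) :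
    dOp A' (fun p => algebraMap ℂ (Gr n) (f p) * F p) q =
      dOp A' (fun p => algebraMap ℂ (Gr n) (f p)) q * F q +
        algebraMap ℂ (Gr n) (f q) * dOp A' F q := by
  have hf' : DifferentiableAt ℝ (fun p => algebraMap ℂ (Gr n) (f p)) q :=
    ((algebraMapCLM ℂ (Gr n)).restrictScalars ℝ).differentiableAt.comp q hf
  change dOp A' ((fun p => algebraMap ℂ (Gr n) (f p)) * F) q = _
  rw [dOp_eq (hf'.mul hF), dOp_eq hf', dOp_eq hF, fderiv_mul' hf' hF]
  simp only [add_apply, smul_apply, mul_add, Finset.sum_add_distrib, Finset.sum_mul,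
    Finset.mul_sum, smul_eq_mul, op_smul_eq_mul]
  rw [add_comm]
  congr 1
  · exact Finset.sum_congr rfl fun j _ => by rw [mul_assoc]
  · exact Finset.sum_congr rfl fun j _ => by rw [← mul_assoc, ← Algebra.commutes, mul_assoc]

/-- Leibniz rule for the product of a `1`-form and a form. -/
lemma dOp_oneForm_mul {ψ F : Hn n → Gr n} {q : Hn n} (hψ : DifferentiableAt ℝ ψ q)
    (hF : DifferentiableAt ℝ F q) (A' : Fin 2)
    (hanti : ∀ j, theta A' j * ψ q = -(ψ q * theta A' j)) :
    dOp A' (fun p => ψ p * F p) q = dOp A' ψ q * F q - ψ q * dOp A' F q := by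
  change dOp A' (ψ * F) q = _
  rw [dOp_eq (hψ.mul hF), dOp_eq hψ, dOp_eq hF, fderiv_mul' hψ hF]
  simp only [add_apply, smul_apply, mul_add, Finset.sum_add_distrib, Finset.sum_mul,
    Finset.mul_sum, smul_eq_mul, op_smul_eq_mul]
  rw [add_comm, sub_eq_add_neg, ← Finset.sum_neg_distrib]
  congr 1
  · exact Finset.sum_congr rfl fun j _ => by rw [mul_assoc]
  · exact Finset.sum_congr rfl fun j _ => by rw [← mul_assoc, hanti, neg_mul, mul_assoc]

lemma dOp_dOp {F : Hn n → Gr n} {q : Hn n} (hF : ContDiffAt ℝ 2 F q) (A' B' : Fin 2) :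
    dOp A' (dOp B' F) q = ∑ j, ∑ k, theta A' j * theta B' k *
      fderiv ℝ (fderiv ℝ F) q (basisVec j) (basisVec k) := by
  have h1 : HasFDerivAt (fun p => ∑ k, theta B' k * fderiv ℝ F p (basisVec k))
      (∑ k, theta B' k • (fderiv ℝ (fderiv ℝ F) q).flip (basisVec k)) q :=
    HasFDerivAt.fun_sum fun k _ => (hasFDerivAt_fderiv_apply hF _).const_mul _
  rw [dOp_congr (dOp_eventuallyEq (hF.of_le (by norm_num)) B') A', dOp_eq h1.differentiableAt,
    h1.fderiv]
  simp [Finset.mul_sum, mul_assoc]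

lemma fderiv_fderiv_symm {E : Type*} [NormedAddCommGroup E] [NormedSpace ℝ E] {F : Hn n → E}
    {q : Hn n} (hF : ContDiffAt ℝ 2 F q) (v w : Hn n) :
    fderiv ℝ (fderiv ℝ F) q v w = fderiv ℝ (fderiv ℝ F) q w v :=
  (hF.isSymmSndFDerivAt (by simp)).eq v w

/-- The forms `theta` anticommute while second derivatives commute. -/
lemma dOp_dOp_anticomm {F : Hn n → Gr n} {q : Hn n} (hF : ContDiffAt ℝ 2 F q) (A' B' : Fin 2) :
    dOp A' (dOp B' F) q = -dOp B' (dOp A' F) q := by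
  rw [dOp_dOp hF, dOp_dOp hF, Finset.sum_comm, ← Finset.sum_neg_distrib]
  refine Finset.sum_congr rfl fun j _ => ?_
  rw [← Finset.sum_neg_distrib]
  refine Finset.sum_congr rfl fun k _ => ?_
  rw [theta_anticomm, fderiv_fderiv_symm hF, neg_mul]

lemma dOp_dOp_self {F : Hn n → Gr n} {q : Hn n} (hF : ContDiffAt ℝ 2 F q) (A' : Fin 2) :
    dOp A' (dOp A' F) q = 0 := by
  have h := dOp_dOp_anticomm hF A' A'
  have h2 : (2 : ℂ) • dOp A' (dOp A' F) q = 0 := by rw [two_smul]; nth_rw 1 [h]; simp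
  exact (smul_eq_zero.1 h2).resolve_left two_ne_zero

/-- A real function as a Grassmann algebra valued function. -/
def scal (u : Hn n → ℝ) : Hn n → Gr n := fun p => algebraMap ℂ (Gr n) (u p : ℂ)

/-- The embedding of the reals in the Grassmann algebra. -/
def ofRealGr (n : ℕ) : ℝ →L[ℝ] Gr n :=
  ((algebraMapCLM ℂ (Gr n)).restrictScalars ℝ).comp Complex.ofRealCLM

lemma mul_ofRealGr (r : ℝ) (w : Gr n) : w * ofRealGr n r = (r : ℂ) • w := by
  rw [Algebra.smul_def, Algebra.commutes]; rfl

lemma contDiffAt_scal {u : Hn n → ℝ} {q : Hn n} {k : WithTop ℕ∞} (hu : ContDiffAt ℝ k u q) :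
    ContDiffAt ℝ k (scal u) q :=
  (ofRealGr n).contDiff.contDiffAt.comp q hu

lemma dOp_scal {u : Hn n → ℝ} {q : Hn n} (hu : DifferentiableAt ℝ u q) (A' : Fin 2) :
    dOp A' (scal u) q = ∑ j, (fderiv ℝ u q (basisVec j) : ℂ) • theta A' j := by
  have h1 : DifferentiableAt ℝ (scal u) q := (ofRealGr n).differentiableAt.comp q hu
  rw [dOp_eq h1]
  have h2 : fderiv ℝ (scal u) q = (ofRealGr n).comp (fderiv ℝ u q) :=
    ((ofRealGr n).hasFDerivAt.comp q hu.hasFDerivAt).fderiv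
  simp only [h2, ContinuousLinearMap.comp_apply, mul_ofRealGr]

/-- Reduces every pointwise question about △ to the algebra of real bilinear forms. -/
lemma baston_eq_Lam {u : Hn n → ℝ} {q : Hn n} (hu : ContDiffAt ℝ 2 u q) :
    baston u q = Lam (fderiv ℝ (fderiv ℝ u) q) := by
  change dOp 0 (dOp 1 (scal u)) q = _
  rw [dOp_dOp (contDiffAt_scal hu), Lam]
  have h4 : ∀ v w, fderiv ℝ (fderiv ℝ (scal u)) q v w =
      ofRealGr n (fderiv ℝ (fderiv ℝ u) q v w) := by
    intro v w
    have h3 : (fun p => fderiv ℝ (scal u) p w) =ᶠ[nhds q]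
        fun p => ofRealGr n (fderiv ℝ u p w) := by
      filter_upwards [hu.eventually (by simp)] with p hp
      have := ((ofRealGr n).hasFDerivAt.comp p
        (hp.differentiableAt (by simp)).hasFDerivAt).fderiv
      exact congr_fun (congr_arg DFunLike.coe this) w
    have h5 := (hasFDerivAt_fderiv_apply (contDiffAt_scal hu) w).congr_of_eventuallyEq h3.symm
    have h6 := (ofRealGr n).hasFDerivAt.comp q (hasFDerivAt_fderiv_apply hu w)
    exact congr_fun (congr_arg DFunLike.coe (h5.unique h6)) v
  simp only [h4, mul_ofRealGr]

end Calculus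

/-! ### Covariance of the Baston operator -/

section Covariance

variable {n : ℕ}

lemma sum_re_smul_unitQ (c : ℍ[ℝ]) : ∑ m, (c * unitQ m).re • unitQ m = star c := by
  ext <;> simp [Fin.sum_univ_four] <;> simp [unitQ]

/-- Together with `sum_re_smul_unitQ` this makes the first order terms cancel in `baston_transform`.
-/
lemma sum_unitQ_mul_unitQ (c : ℍ[ℝ]) : ∑ m, unitQ m * c * unitQ m = (-2 : ℝ) • star c := by
  ext <;> simp [Fin.sum_univ_four] <;> simp [unitQ] <;> ring

/-! ### Derivatives of fractional linear maps along lines -/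

variable (g : Matrix (Fin (n + 1)) (Fin (n + 1)) ℍ[ℝ])

/-- The linear part of `J₁`. -/
def J1lin (w : Hn n) : ℍ[ℝ] := ∑ j : Fin n, g 0 j.succ * w j

/-- The linear part of the numerator. -/
def numerLin (w : Hn n) : Hn n := fun i => ∑ j : Fin n, g i.succ j.succ * w j

lemma J1_line (q w : Hn n) (t : ℝ) : J1 g (q + t • w) = J1 g q + t • J1lin g w := by
  simp [J1, J1lin, mul_add, Finset.sum_add_distrib, add_assoc, Finset.smul_sum]

lemma numer_line (q w : Hn n) (t : ℝ) (i : Fin n) :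
    numer g (q + t • w) i = numer g q i + t • numerLin g w i := by
  simp [numer, numerLin, mul_add, Finset.sum_add_distrib, add_assoc, Finset.smul_sum]

lemma J2_mulVec (q w : Hn n) (i : Fin n) :
    (J2 g q).mulVec w i = numerLin g w i - frac g q i * J1lin g w := by
  simp only [J2, Matrix.mulVec, dotProduct, Matrix.of_apply, sub_mul, Finset.sum_sub_distrib,
    numerLin, J1lin, frac, Finset.mul_sum, mul_assoc]

lemma J1lin_mul (w : Hn n) (c : ℍ[ℝ]) : J1lin g (fun l => w l * c) = J1lin g w * c := by
  simp only [J1lin, Finset.sum_mul, mul_assoc]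

variable {g}

/-- The velocity of a line under a fractional linear map. -/
def lineVel (g : Matrix (Fin (n + 1)) (Fin (n + 1)) ℍ[ℝ]) (q w : Hn n) : Hn n :=
  transCLM (J2 g q) (J1 g q)⁻¹ w

lemma hasDerivAt_J1_inv (q w : Hn n) (t : ℝ) (h : J1 g (q + t • w) ≠ 0) :
    HasDerivAt (fun t : ℝ => (J1 g (q + t • w))⁻¹)
      (-((J1 g (q + t • w))⁻¹ * J1lin g w * (J1 g (q + t • w))⁻¹)) t := by
  have h1 : HasDerivAt (fun t : ℝ => J1 g (q + t • w)) (J1lin g w) t := by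
    simp only [J1_line]
    simpa using ((hasDerivAt_id t).smul_const (J1lin g w)).const_add (J1 g q)
  refine ((hasFDerivAt_inv' (𝕜 := ℝ) h).comp_hasDerivAt t h1).congr_deriv ?_
  simp

/-- The derivatives of the numerator and of J₁⁻¹ combine into J₂ w J₁⁻¹, which is where J₂ comes
from. -/
lemma hasDerivAt_frac (q w : Hn n) (t : ℝ) (h : J1 g (q + t • w) ≠ 0) :
    HasDerivAt (fun t : ℝ => frac g (q + t • w)) (lineVel g (q + t • w) w) t := by
  rw [hasDerivAt_pi]
  intro i
  have h1 : HasDerivAt (fun t : ℝ => numer g (q + t • w) i) (numerLin g w i) t := by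
    simp only [numer_line]
    simpa using ((hasDerivAt_id t).smul_const (numerLin g w i)).const_add (numer g q i)
  refine (h1.mul (hasDerivAt_J1_inv q w t h)).congr_deriv ?_
  simp only [lineVel, transCLM_apply, J2_mulVec, frac]
  noncomm_ring

/-- The velocity is (numerLin w - frac · J1lin w) J₁⁻¹. Differentiating `frac` and differentiating
J₁⁻¹ yield the same term, hence the factor -2. -/
lemma hasDerivAt_lineVel (q w : Hn n) (h : J1 g q ≠ 0) :
    HasDerivAt (fun t : ℝ => lineVel g (q + t • w) w)
      (fun i => (-2 : ℝ) • (lineVel g q w i * J1lin g w * (J1 g q)⁻¹)) 0 := by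
  rw [hasDerivAt_pi]
  intro i
  have h0 : J1 g (q + (0 : ℝ) • w) ≠ 0 := by simpa using h
  have h1 := (hasDerivAt_pi.1 (hasDerivAt_frac q w 0 h0)) i
  have h2 := ((h1.mul_const (J1lin g w)).const_sub (numerLin g w i)).mul
    (hasDerivAt_J1_inv q w 0 h0)
  simp only [zero_smul, add_zero] at h2
  have e : (fun t : ℝ => lineVel g (q + t • w) w i) =
      (fun t => numerLin g w i - frac g (q + t • w) i * J1lin g w) *
        fun t => (J1 g (q + t • w))⁻¹ := by
    funext t
    simp [lineVel, J2_mulVec]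
  rw [e]
  refine h2.congr_deriv ?_
  rw [← J2_mulVec]
  have e2 : lineVel g q w i = (J2 g q).mulVec w i * (J1 g q)⁻¹ := rfl
  rw [e2, neg_smul, two_smul]
  noncomm_ring

lemma hasDerivAt_normSq_J1 (q w : Hn n) (t : ℝ) :
    HasDerivAt (fun t : ℝ => ‖J1 g (q + t • w)‖ ^ 2)
      (2 * (star (J1 g (q + t • w)) * J1lin g w).re) t := by
  have h1 : HasDerivAt (fun t : ℝ => J1 g (q + t • w)) (J1lin g w) t := by
    simp only [J1_line]
    simpa using ((hasDerivAt_id t).smul_const (J1lin g w)).const_add (J1 g q)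
  refine h1.norm_sq.congr_deriv ?_
  rw [Quaternion.inner_def]
  simp

lemma inv_mul_re (s κ : ℍ[ℝ]) : (s⁻¹ * κ).re = (‖s‖ ^ 2)⁻¹ * (star s * κ).re := by
  rw [Quaternion.inv_def, Quaternion.normSq_eq_norm_mul_self, ← sq, smul_mul_assoc,
    Quaternion.re_smul, smul_eq_mul]

lemma hasDerivAt_rho (q w : Hn n) (t : ℝ) (h : J1 g (q + t • w) ≠ 0) :
    HasDerivAt (fun t : ℝ => (‖J1 g (q + t • w)‖ ^ 2)⁻¹)
      (-2 * ((‖J1 g (q + t • w)‖ ^ 2)⁻¹ * ((J1 g (q + t • w))⁻¹ * J1lin g w).re)) t := by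
  have h0 : ‖J1 g (q + t • w)‖ ^ 2 ≠ 0 := pow_ne_zero _ (norm_ne_zero_iff.2 h)
  refine ((hasDerivAt_normSq_J1 q w t).inv h0).congr_deriv ?_
  rw [inv_mul_re]
  field_simp

lemma re_mul_self (c : ℍ[ℝ]) : (c * c).re = 2 * c.re ^ 2 - ‖c‖ ^ 2 := by
  rw [norm_sq_eq]
  simp
  ring

/-- The real part as a continuous linear functional. -/
def reL : ℍ[ℝ] →L[ℝ] ℝ := LinearMap.toContinuousLinearMap
  { toFun := fun x => x.re, map_add' := fun _ _ => rfl, map_smul' := fun _ _ => rfl }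

lemma reL_apply (x : ℍ[ℝ]) : reL x = x.re := rfl

lemma hasDerivAt_rho_deriv (q w : Hn n) (h : J1 g q ≠ 0) :
    HasDerivAt (fun t : ℝ =>
        -2 * ((‖J1 g (q + t • w)‖ ^ 2)⁻¹ * ((J1 g (q + t • w))⁻¹ * J1lin g w).re))
      ((‖J1 g q‖ ^ 2)⁻¹ * (8 * ((J1 g q)⁻¹ * J1lin g w).re ^ 2 - 2 * ‖(J1 g q)⁻¹ * J1lin g w‖ ^ 2))
      0 := by
  have h0 : J1 g (q + (0 : ℝ) • w) ≠ 0 := by simpa using h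
  have h1 := (hasDerivAt_J1_inv q w 0 h0).mul_const (J1lin g w)
  have h2 := ((hasDerivAt_rho q w 0 h0).mul
    (reL.hasFDerivAt.comp_hasDerivAt 0 h1)).const_mul (-2)
  simp only [zero_smul, add_zero] at h2
  refine h2.congr_deriv ?_
  have e : (-((J1 g q)⁻¹ * J1lin g w * (J1 g q)⁻¹) * J1lin g w).re =
      -(2 * ((J1 g q)⁻¹ * J1lin g w).re ^ 2 - ‖(J1 g q)⁻¹ * J1lin g w‖ ^ 2) := by
    rw [← re_mul_self, neg_mul, mul_assoc, Quaternion.re_neg]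
  simp only [Function.comp_apply, zero_smul, add_zero, reL_apply]
  rw [e]
  ring

lemma hasDerivAt_line {E : Type*} [NormedAddCommGroup E] [NormedSpace ℝ E] {F : Hn n → E}
    {q w : Hn n} {t : ℝ} (hF : DifferentiableAt ℝ F (q + t • w)) :
    HasDerivAt (fun t : ℝ => F (q + t • w)) (fderiv ℝ F (q + t • w) w) t := by
  have h1 : HasDerivAt (fun t : ℝ => q + t • w) w t := by
    simpa using ((hasDerivAt_id t).smul_const w).const_add q
  exact hF.hasFDerivAt.comp_hasDerivAt t h1

lemma hasDerivAt_fderiv_line {F : Hn n → ℝ}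
    {q w : Hn n} (hF : ContDiffAt ℝ 2 F q) :
    HasDerivAt (fun t : ℝ => fderiv ℝ F (q + t • w) w) (fderiv ℝ (fderiv ℝ F) q w w) 0 := by
  have h0 : HasFDerivAt (fun p => fderiv ℝ F p w) ((fderiv ℝ (fderiv ℝ F) q).flip w)
    (q + (0 : ℝ) • w) := by simpa using hasFDerivAt_fderiv_apply hF w
  have h1 : HasDerivAt (fun t : ℝ => q + t • w) w 0 := by
    simpa using ((hasDerivAt_id (0 : ℝ)).smul_const w).const_add q
  have h2 := h0.comp_hasDerivAt 0 h1
  exact h2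

lemma hasDerivAt_fderiv_curve {E : Type*} [NormedAddCommGroup E] [NormedSpace ℝ E] {u : E → ℝ}
    {γ γ₁ : ℝ → E} {x v a : E} (hx : γ 0 = x) (hv : γ₁ 0 = v) (hu : ContDiffAt ℝ 2 u x)
    (h : HasDerivAt γ v 0) (h₁ : HasDerivAt γ₁ a 0) :
    HasDerivAt (fun t => fderiv ℝ u (γ t) (γ₁ t)) (fderiv ℝ (fderiv ℝ u) x v v + fderiv ℝ u x a)
      0 := by
  subst hx hv
  have h2 : HasFDerivAt (fderiv ℝ u) (fderiv ℝ (fderiv ℝ u) (γ 0)) (γ 0) :=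
    ((hu.fderiv_right (m := 1) (by norm_num)).differentiableAt (by simp)).hasFDerivAt
  exact (h2.comp_hasDerivAt 0 h).clm_apply h₁

lemma tendsto_line (q w : Hn n) : Filter.Tendsto (fun t : ℝ => q + t • w) (nhds 0) (nhds q) := by
  have : Continuous fun t : ℝ => q + t • w := by fun_prop
  simpa using this.tendsto 0

lemma continuous_J1 (g : Matrix (Fin (n + 1)) (Fin (n + 1)) ℍ[ℝ]) : Continuous (J1 g) := by
  unfold J1
  fun_prop

lemma contDiff_J1 (g : Matrix (Fin (n + 1)) (Fin (n + 1)) ℍ[ℝ]) : ContDiff ℝ ω (J1 g) := by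
  unfold J1
  fun_prop

lemma contDiff_numer (g : Matrix (Fin (n + 1)) (Fin (n + 1)) ℍ[ℝ]) (i : Fin n) :
    ContDiff ℝ ω (fun q => numer g q i) := by
  unfold numer
  fun_prop

lemma contDiffAt_J1_inv {q : Hn n} (h : J1 g q ≠ 0) :
    ContDiffAt ℝ ω (fun p => (J1 g p)⁻¹) q := by
  have h1 := contDiffAt_ringInverse ℝ (n := ω) (Units.mk0 _ h)
  rw [Ring.inverse_eq_inv'] at h1
  exact h1.comp q (contDiff_J1 g).contDiffAt

lemma contDiffAt_frac {q : Hn n} (h : J1 g q ≠ 0) : ContDiffAt ℝ ω (frac g) q := by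
  rw [contDiffAt_pi]
  exact fun i => (contDiff_numer g i).contDiffAt.mul (contDiffAt_J1_inv h)

lemma hasFDerivAt_frac {q : Hn n} (h : J1 g q ≠ 0) :
    HasFDerivAt (frac g) (transCLM (J2 g q) (J1 g q)⁻¹) q := by
  have hd : DifferentiableAt ℝ (frac g) q := (contDiffAt_frac h).differentiableAt (by simp)
  refine hd.hasFDerivAt.congr_fderiv ?_
  refine ContinuousLinearMap.ext fun w => ?_
  have h0 : J1 g (q + (0 : ℝ) • w) ≠ 0 := by simpa using h
  have h1 := hasDerivAt_frac q w 0 h0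
  have h2 := hasDerivAt_line (F := frac g) (q := q) (w := w) (t := 0) (by simpa using hd)
  have h3 := h2.unique h1
  simpa [lineVel] using h3

/-- The second derivative of `ρ · (u ∘ φ)` along a line. -/
lemma second_deriv_transform {u f : Hn n → ℝ} {q : Hn n} (h : J1 g q ≠ 0)
    (hu : ContDiffAt ℝ 2 u (frac g q)) (hf : ContDiffAt ℝ 2 f q)
    (hfu : ∀ᶠ p in nhds q, f p = (‖J1 g p‖ ^ 2)⁻¹ * u (frac g p)) (w : Hn n) :
    fderiv ℝ (fderiv ℝ f) q w w =
      (‖J1 g q‖ ^ 2)⁻¹ * ((8 * ((J1 g q)⁻¹ * J1lin g w).re ^ 2 -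
        2 * ‖(J1 g q)⁻¹ * J1lin g w‖ ^ 2) * u (frac g q) +
        fderiv ℝ u (frac g q) (fun i => (-4 * ((J1 g q)⁻¹ * J1lin g w).re) • lineVel g q w i
          + (-2 : ℝ) • (lineVel g q w i * J1lin g w * (J1 g q)⁻¹)) +
        fderiv ℝ (fderiv ℝ u) (frac g q) (lineVel g q w) (lineVel g q w)) := by
  have hcfrac : ContinuousAt (frac g) q := (hasFDerivAt_frac h).continuousAt
  have hJ : ∀ᶠ p in nhds q, J1 g p ≠ 0 := (continuous_J1 g).continuousAt.eventually_ne h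
  have hud : ∀ᶠ p in nhds q, DifferentiableAt ℝ u (frac g p) := by
    refine hcfrac.eventually ?_
    filter_upwards [hu.eventually (by simp)] with p hp using hp.differentiableAt (by simp)
  have hfd : ∀ᶠ p in nhds q, DifferentiableAt ℝ f p := by
    filter_upwards [hf.eventually (by simp)] with p hp using hp.differentiableAt (by simp)
  -- The first derivative is needed for all small `t`, not only at 0, since it is differentiated
  -- once more.
  have h1 : ∀ᶠ t : ℝ in nhds 0, fderiv ℝ f (q + t • w) w =
      -2 * ((‖J1 g (q + t • w)‖ ^ 2)⁻¹ * ((J1 g (q + t • w))⁻¹ * J1lin g w).re) *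
        u (frac g (q + t • w)) + (‖J1 g (q + t • w)‖ ^ 2)⁻¹ *
        fderiv ℝ u (frac g (q + t • w)) (lineVel g (q + t • w) w) := by
    filter_upwards [(tendsto_line q w).eventually hJ, (tendsto_line q w).eventually hud,
      (tendsto_line q w).eventually hfd,
      ((tendsto_line q w).eventually hfu).eventually_nhds] with t ht1 ht2 ht3 ht4
    have e1 := hasDerivAt_line ht3
    have e2 := (hasDerivAt_rho q w t ht1).mul
      (ht2.hasFDerivAt.comp_hasDerivAt t (hasDerivAt_frac q w t ht1))
    exact e1.unique (e2.congr_of_eventuallyEq ht4)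
  have h0 : J1 g (q + (0 : ℝ) • w) ≠ 0 := by simpa using h
  have hfr := hasDerivAt_frac q w 0 h0
  have hrho := hasDerivAt_rho q w 0 h0
  simp only [zero_smul, add_zero] at hfr hrho
  have hA : HasDerivAt (fun t : ℝ => u (frac g (q + t • w)))
      (fderiv ℝ u (frac g q) (lineVel g q w)) 0 := by
    have hd : HasFDerivAt u (fderiv ℝ u (frac g q)) (frac g (q + (0 : ℝ) • w)) := by
      simpa using (hu.differentiableAt (by simp)).hasFDerivAt
    exact hd.comp_hasDerivAt 0 hfr
  have hB := hasDerivAt_fderiv_curve (γ := fun t : ℝ => frac g (q + t • w))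
    (γ₁ := fun t : ℝ => lineVel g (q + t • w) w) (by simp) (by simp) hu hfr
    (hasDerivAt_lineVel q w h)
  have h2 := ((hasDerivAt_rho_deriv q w h).mul hA).add (hrho.mul hB)
  have h3 := (hasDerivAt_fderiv_line hf (w := w)).unique (h2.congr_of_eventuallyEq h1)
  rw [h3]
  have e3 : (fun i => (-4 * ((J1 g q)⁻¹ * J1lin g w).re) • lineVel g q w i
          + (-2 : ℝ) • (lineVel g q w i * J1lin g w * (J1 g q)⁻¹)) =
      (-4 * ((J1 g q)⁻¹ * J1lin g w).re) • lineVel g q w +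
        fun i => (-2 : ℝ) • (lineVel g q w i * J1lin g w * (J1 g q)⁻¹) := rfl
  rw [e3, map_add, map_smul]
  simp only [zero_smul, add_zero, smul_eq_mul]
  ring

lemma lineVel_mul (q v : Hn n) (c : ℍ[ℝ]) (i : Fin n) :
    lineVel g q (fun l => v l * c) i = (J2 g q).mulVec v i * c * (J1 g q)⁻¹ := by
  simp only [lineVel, transCLM_apply]
  congr 1
  simp only [Matrix.mulVec, dotProduct, Finset.sum_mul, mul_assoc]

/-- Covariance of the Baston operator under fractional linear maps. -/
lemma baston_transform {u f : Hn n → ℝ} {q : Hn n} (h : J1 g q ≠ 0)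
    (hu : ContDiffAt ℝ 2 u (frac g q)) (hf : ContDiffAt ℝ 2 f q)
    (hfu : ∀ᶠ p in nhds q, f p = (‖J1 g p‖ ^ 2)⁻¹ * u (frac g p)) :
    baston f q = (((‖J1 g q‖ ^ 4)⁻¹ : ℝ) : ℂ) •
      grActHom (tau (J2 g q)).transpose (baston u (frac g q)) := by
  rw [baston_eq_Lam hu, baston_eq_Lam hf]
  set T := transCLM (J2 g q) (J1 g q)⁻¹ with hT
  -- The two bilinear forms differ by terms of order zero and one in `u`, and these vanish after
  -- summation over the quaternion units. The weight -1 is what makes this happen.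
  have key : Lam (fderiv ℝ (fderiv ℝ f) q) =
      Lam ((‖J1 g q‖ ^ 2)⁻¹ • (fderiv ℝ (fderiv ℝ u) (frac g q)).bilinearComp T T) := by
    refine Lam_congr (fderiv_fderiv_symm hf) (fun v w => ?_) fun v => ?_
    · simp [fderiv_fderiv_symm hu (T v)]
    · simp only [lineAvg_apply, second_deriv_transform h hu hf hfu, smul_apply,
        ContinuousLinearMap.bilinearComp_apply, smul_eq_mul, ← Finset.mul_sum]
      congr 1
      rw [Finset.sum_add_distrib, Finset.sum_add_distrib]
      set c := (J1 g q)⁻¹ * J1lin g v with hc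
      have ec : ∀ m, (J1 g q)⁻¹ * J1lin g (fun l => v l * unitQ m) = c * unitQ m := by
        intro m; rw [J1lin_mul, hc, mul_assoc]
      -- Order zero: 8 ∑ re(c u)² = 8‖c‖² against 4 · 2‖c‖².
      have e1 : ∑ m, (8 * ((J1 g q)⁻¹ * J1lin g (fun l => v l * unitQ m)).re ^ 2 -
          2 * ‖(J1 g q)⁻¹ * J1lin g (fun l => v l * unitQ m)‖ ^ 2) * u (frac g q) = 0 := by
        rw [← Finset.sum_mul]
        simp only [ec, norm_mul, norm_unitQ, mul_one]
        rw [Finset.sum_sub_distrib, ← Finset.mul_sum, sum_re_mul_unitQ_sq]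
        simp
        left
        ring
      -- Order one: -4 ∑ re(c u) u = -4 c̄ against -2 ∑ u c u = 4 c̄.
      have e2 : ∑ m, fderiv ℝ u (frac g q) (fun i =>
          (-4 * ((J1 g q)⁻¹ * J1lin g (fun l => v l * unitQ m)).re) •
            lineVel g q (fun l => v l * unitQ m) i + (-2 : ℝ) •
            (lineVel g q (fun l => v l * unitQ m) i * J1lin g (fun l => v l * unitQ m) *
              (J1 g q)⁻¹)) = 0 := by
        rw [← map_sum]
        refine (congr_arg _ (funext fun i => ?_)).trans (map_zero (fderiv ℝ u (frac g q)))
        simp only [Finset.sum_apply, Pi.zero_apply, ec, lineVel_mul]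
        have e3 : ∀ m, (-4 * (c * unitQ m).re) •
            ((J2 g q).mulVec v i * unitQ m * (J1 g q)⁻¹) + (-2 : ℝ) •
            ((J2 g q).mulVec v i * unitQ m * (J1 g q)⁻¹ * J1lin g (fun l => v l * unitQ m) *
              (J1 g q)⁻¹) =
            (J2 g q).mulVec v i * ((-4 : ℝ) • ((c * unitQ m).re • unitQ m) +
              (-2 : ℝ) • (unitQ m * c * unitQ m)) * (J1 g q)⁻¹ := by
          intro m
          rw [J1lin_mul, hc]
          simp only [mul_add, add_mul, mul_smul_comm, smul_mul_assoc, mul_smul, mul_assoc]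
        rw [Finset.sum_congr rfl fun m _ => e3 m, ← Finset.sum_mul, ← Finset.mul_sum,
          Finset.sum_add_distrib, ← Finset.smul_sum, ← Finset.smul_sum, sum_re_smul_unitQ,
          sum_unitQ_mul_unitQ, smul_smul, ← add_smul]
        norm_num
      rw [e1, e2, zero_add, zero_add]
      rfl
  rw [key, Lam_smul, Lam_comp_transCLM (fderiv_fderiv_symm hu), smul_smul]
  congr 1
  rw [norm_inv]
  push_cast
  field_simp

/-- Multiplying g on the right by the unipotent matrix with first column (1, q) turns its first
column into (J₁, c + d q). The Schur complement of the corner is then J₂, and |J₁|² det τ(J₂) = det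
τ(g) = 1. -/
lemma det_tau_J2 {q : Hn n} (hg : IsSL g) (h : J1 g q ≠ 0) :
    (tau (J2 g q)).det = (((‖J1 g q‖ ^ 2)⁻¹ : ℝ) : ℂ) := by
  set P : Matrix (Fin (n + 1)) (Fin (n + 1)) ℍ[ℝ] := Matrix.of
    (Fin.cons (Fin.cons 1 0) fun i => Fin.cons (q i) (Pi.single i 1)) with hP
  have hPdet : (tau P).det = 1 := by
    rw [det_tau_of_lower_one]
    · simp [hP]
    · intro i j
      simp [hP, Matrix.one_apply, Pi.single_apply, eq_comm]
  have h1 : (tau (g * P)).det = 1 := by rw [tau_mul, Matrix.det_mul, hPdet, mul_one, hg]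
  have e00 : (g * P) 0 0 = J1 g q := by
    simp [Matrix.mul_apply, Fin.sum_univ_succ, hP, J1]
  have e0 : ∀ j : Fin n, (g * P) 0 j.succ = g 0 j.succ := by
    intro j
    simp [Matrix.mul_apply, Fin.sum_univ_succ, hP, Pi.single_apply]
  have e1 : ∀ i : Fin n, (g * P) i.succ 0 = numer g q i := by
    intro i
    simp [Matrix.mul_apply, Fin.sum_univ_succ, hP, numer]
  have e2 : ∀ i j : Fin n, (g * P) i.succ j.succ = g i.succ j.succ := by
    intro i j
    simp [Matrix.mul_apply, Fin.sum_univ_succ, hP, Pi.single_apply]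
  rw [det_tau_schur _ (by rwa [e00])] at h1
  simp only [e00, e0, e1, e2] at h1
  have h2 : (‖J1 g q‖ ^ 2 : ℝ) ≠ 0 := pow_ne_zero _ (norm_ne_zero_iff.2 h)
  rw [Complex.ofReal_inv]
  exact eq_inv_of_mul_eq_one_right h1

/-! ### Real determinants of the maps v ↦ A v c -/

/-- Complex coordinates on the quaternionic space. -/
def complexCoord (n : ℕ) : Hn n ≃ₗ[ℝ] (Fin (n * 2) → ℂ) where
  toFun v A := tauQ (v (finProdFinEquiv.symm A).1) (finProdFinEquiv.symm A).2 0
  map_add' v w := by ext1 A; simp [tauQ_add]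
  map_smul' r v := by ext1 A; simp [tauQ_smul]
  invFun z l := ⟨(z (finProdFinEquiv (l, 0))).re, -(z (finProdFinEquiv (l, 0))).im,
    (z (finProdFinEquiv (l, 1))).re, (z (finProdFinEquiv (l, 1))).im⟩
  left_inv v := by
    ext1 l
    simp only [Equiv.symm_apply_apply]
    ext <;> simp [tauQ]
  right_inv z := by
    ext1 A
    obtain ⟨⟨l, α⟩, rfl⟩ := finProdFinEquiv.surjective A
    simp only [Equiv.symm_apply_apply]
    fin_cases α <;> simp [tauQ]

lemma complexCoord_apply (v : Hn n) (B : Fin (n * 2)) : complexCoord n v B =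
    tauQ (v (finProdFinEquiv.symm B).1) (finProdFinEquiv.symm B).2 0 := rfl

lemma complexCoord_mulVec (A : Matrix (Fin n) (Fin n) ℍ[ℝ]) (v : Hn n) :
    complexCoord n (A.mulVec v) = (tau A).mulVec (complexCoord n v) := by
  ext1 B
  obtain ⟨⟨l, α⟩, rfl⟩ := finProdFinEquiv.surjective B
  simp only [complexCoord_apply, Equiv.symm_apply_apply, Matrix.mulVec, dotProduct, tauQ_sum,
    tauQ_mul, Matrix.sum_apply,
    Matrix.mul_apply]
  rw [← finProdFinEquiv.sum_comp, Fintype.sum_prod_type]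
  refine Finset.sum_congr rfl fun i _ => Finset.sum_congr rfl fun β _ => ?_
  rw [tau_apply, Equiv.symm_apply_apply]

/-- In the coordinates given by the first column of `tauQ`, left multiplication by A is the complex
linear map `tau A`. The real determinant of a complex linear map is the squared modulus of the
complex one. -/
lemma det_transCLM_left (A : Matrix (Fin n) (Fin n) ℍ[ℝ]) :
    LinearMap.det (transCLM A 1 : Hn n →ₗ[ℝ] Hn n) = Complex.normSq (tau A).det := by
  rw [← LinearMap.det_conj _ (complexCoord n)]
  have : ((complexCoord n : Hn n →ₗ[ℝ] (Fin (n * 2) → ℂ)) ∘ₗ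
      (transCLM A 1 : Hn n →ₗ[ℝ] Hn n)) ∘ₗ
      ((complexCoord n).symm : (Fin (n * 2) → ℂ) →ₗ[ℝ] Hn n) =
      (Matrix.toLin' (tau A)).restrictScalars ℝ := by
    refine LinearMap.ext fun z => ?_
    have h1 : transCLM A 1 ((complexCoord n).symm z) = A.mulVec ((complexCoord n).symm z) := by
      ext1 i; simp
    simp only [LinearMap.comp_apply, LinearEquiv.coe_coe, ContinuousLinearMap.coe_coe, h1,
      complexCoord_mulVec, LinearEquiv.apply_symm_apply, LinearMap.restrictScalars_apply,
      Matrix.toLin'_apply]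
  rw [← LinearMap.comp_assoc, this, LinearMap.det_restrictScalars, LinearMap.det_toLin',
    Algebra.norm_complex_apply]

/-- Conjugation of the quaternionic coordinates. -/
def starEquiv (n : ℕ) : Hn n ≃ₗ[ℝ] Hn n where
  toFun v l := star (v l)
  map_add' v w := by ext1 l; simp
  map_smul' r v := by ext1 l; simp
  invFun v l := star (v l)
  left_inv v := by ext1 l; simp
  right_inv v := by ext1 l; simp

lemma starEquiv_apply (v : Hn n) (l : Fin n) : starEquiv n v l = star (v l) := rfl

lemma starEquiv_symm_apply (v : Hn n) (l : Fin n) : (starEquiv n).symm v l = star (v l) := rfl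

/-- Conjugating coordinates turns right multiplication by c into left multiplication by the scalar
matrix c̄. -/
lemma det_transCLM_right (c : ℍ[ℝ]) :
    LinearMap.det (transCLM (1 : Matrix (Fin n) (Fin n) ℍ[ℝ]) c : Hn n →ₗ[ℝ] Hn n) =
      ‖c‖ ^ (4 * n) := by
  rw [← LinearMap.det_conj _ (starEquiv n)]
  have : ((starEquiv n : Hn n →ₗ[ℝ] Hn n) ∘ₗ
      (transCLM (1 : Matrix (Fin n) (Fin n) ℍ[ℝ]) c : Hn n →ₗ[ℝ] Hn n)) ∘ₗ
      ((starEquiv n).symm : Hn n →ₗ[ℝ] Hn n) =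
      (transCLM (Matrix.diagonal fun _ : Fin n => star c) 1 : Hn n →ₗ[ℝ] Hn n) := by
    refine LinearMap.ext fun z => ?_
    ext1 l
    simp [starEquiv_apply, starEquiv_symm_apply, Matrix.mulVec_diagonal]
  rw [← LinearMap.comp_assoc, this, det_transCLM_left, det_tau_smul_one,
    Complex.normSq_ofReal, norm_star, ← pow_add]
  ring_nf

lemma det_transCLM (A : Matrix (Fin n) (Fin n) ℍ[ℝ]) (c : ℍ[ℝ]) :
    (transCLM A c).det = ‖c‖ ^ (4 * n) * Complex.normSq (tau A).det := by
  have : (transCLM A c : Hn n →ₗ[ℝ] Hn n) =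
      (transCLM (1 : Matrix (Fin n) (Fin n) ℍ[ℝ]) c : Hn n →ₗ[ℝ] Hn n) ∘ₗ
        (transCLM A 1 : Hn n →ₗ[ℝ] Hn n) := by
    refine LinearMap.ext fun z => ?_
    ext1 l
    simp
  rw [ContinuousLinearMap.det, this, LinearMap.det_comp, det_transCLM_left, det_transCLM_right]

/-- Right multiplication by J₁⁻¹ contributes |J₁|^(-4n), and J₂ contributes (|J₁|^(-2))². -/
lemma det_fderiv_frac {q : Hn n} (hg : IsSL g) (h : J1 g q ≠ 0) :
    (transCLM (J2 g q) (J1 g q)⁻¹).det = (‖J1 g q‖ ^ (4 * n + 4))⁻¹ := by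
  rw [det_transCLM, det_tau_J2 hg h, Complex.normSq_ofReal, norm_inv]
  have := norm_ne_zero_iff.2 h
  rw [inv_pow, pow_add]
  field_simp

end Covariance

/-! ### Smooth approximation and cut-off functions -/

section Approximation

open MeasureTheory Metric Filter
open scoped Convolution Topology Manifold

variable {n : ℕ}

instance instIsAddHaarMeasureQuaternion : (volume : Measure ℍ[ℝ]).IsAddHaarMeasure :=
  inferInstanceAs (@volume ℍ[ℝ] measureSpaceOfInnerProductSpace).IsAddHaarMeasure

lemma exists_cutoff {U K : Set (Hn n)} (hU : IsOpen U) (hK : IsCompact K) (hKU : K ⊆ U) :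
    ∃ χ : Hn n → ℝ, ContDiff ℝ ∞ χ ∧ HasCompactSupport χ ∧ tsupport χ ⊆ U ∧ (∀ q, 0 ≤ χ q) ∧
      (∀ q ∈ K, χ q = 1) := by
  obtain ⟨δ, hδ, hδU⟩ := hK.exists_cthickening_subset_open hU hKU
  obtain ⟨f, hf, hr, hs, h1⟩ := exists_contMDiff_support_eq_eq_one_iff (𝓘(ℝ, Hn n))
    (isOpen_thickening (δ := δ) (E := K)) hK.isClosed (self_subset_thickening hδ K)
  have hts : tsupport f ⊆ cthickening δ K := by
    rw [tsupport, hs]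
    exact closure_thickening_subset_cthickening _ _
  refine ⟨f, hf.contDiff, ?_, hts.trans hδU, fun q => (hr ⟨q, rfl⟩).1, fun q hq => (h1 q).1 hq⟩
  exact (hK.cthickening (r := δ)).of_isClosed_subset (isClosed_tsupport _) hts

lemma precompR_lsmul {E : Type*} [NormedAddCommGroup E] [NormedSpace ℝ E] :
    (ContinuousLinearMap.lsmul ℝ ℝ : ℝ →L[ℝ] E →L[ℝ] E).precompR (Hn n) =
      ContinuousLinearMap.lsmul ℝ ℝ := by
  refine ContinuousLinearMap.ext fun r => ContinuousLinearMap.ext fun T =>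
    ContinuousLinearMap.ext fun v => ?_
  simp [ContinuousLinearMap.precompR_apply]

lemma norm_normed_convolution_sub_le {E : Type*} [NormedAddCommGroup E] [NormedSpace ℝ E]
    [CompleteSpace E] (b : ContDiffBump (0 : Hn n)) {g : Hn n → E} (hg : Continuous g)
    {q : Hn n} {ε : ℝ} (h : ∀ x, dist x q < b.rOut → dist (g x) (g q) ≤ ε) :
    ‖(b.normed volume ⋆[ContinuousLinearMap.lsmul ℝ ℝ, volume] g) q - g q‖ ≤ ε := by
  rw [← dist_eq_norm]
  exact ContDiffBump.dist_normed_convolution_le hg.aestronglyMeasurable fun x hx =>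
    h x (mem_ball.1 hx)

/-- Mollification: the derivative of the convolution is the convolution of the uniformly continuous
derivative. The compact set is a thickening of the support fixed before ε, so errors are integrated
over a set independent of ε. -/
lemma exists_smooth_approx {E : Type*} [NormedAddCommGroup E] [NormedSpace ℝ E] [CompleteSpace E]
    {U : Set (Hn n)} (hU : IsOpen U) {φ : Hn n → E} (hφ : ContDiff ℝ 1 φ)
    (hc : HasCompactSupport φ) (hs : tsupport φ ⊆ U) :
    ∃ K : Set (Hn n), IsCompact K ∧ K ⊆ U ∧ tsupport φ ⊆ K ∧ ∀ ε > 0, ∃ ψ : Hn n → E,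
      ContDiff ℝ 2 ψ ∧ tsupport ψ ⊆ K ∧ ∀ q, ‖fderiv ℝ ψ q - fderiv ℝ φ q‖ ≤ ε := by
  obtain ⟨δ, hδ, hδU⟩ := hc.isCompact.exists_cthickening_subset_open hU hs
  refine ⟨cthickening δ (tsupport φ), hc.isCompact.cthickening, hδU,
    self_subset_cthickening _, fun ε hε => ?_⟩
  have huc : UniformContinuous (fderiv ℝ φ) :=
    (hc.fderiv ℝ).uniformContinuous_of_continuous (hφ.continuous_fderiv one_ne_zero)
  obtain ⟨r, hr, hruc⟩ := (Metric.uniformContinuous_iff (f := fderiv ℝ φ)).1 huc ε hε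
  set b : ContDiffBump (0 : Hn n) :=
    { rIn := min r δ / 2, rOut := min r δ, rIn_pos := by positivity,
      rIn_lt_rOut := half_lt_self (by positivity) } with hb
  have hloc : LocallyIntegrable (b.normed volume) (volume : Measure (Hn n)) :=
    b.continuous_normed.locallyIntegrable
  refine ⟨(b.normed volume ⋆[ContinuousLinearMap.lsmul ℝ ℝ, volume] φ : Hn n → E), ?_, ?_, ?_⟩
  · exact b.hasCompactSupport_normed.contDiff_convolution_left (n := 2) _ b.contDiff_normed
      hφ.continuous.locallyIntegrable
  · refine closure_minimal ?_ isClosed_cthickening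
    refine (support_convolution_subset _).trans ?_
    rintro _ ⟨x, hx, y, hy, rfl⟩
    rw [b.support_normed_eq, mem_ball_zero_iff] at hx
    refine mem_cthickening_of_dist_le _ y _ _ (subset_tsupport _ hy) ?_
    simp only [dist_eq_norm, add_sub_cancel_right]
    exact hx.le.trans (min_le_right _ _)
  · intro q
    rw [(hc.hasFDerivAt_convolution_right _ hloc hφ q).fderiv, precompR_lsmul]
    exact norm_normed_convolution_sub_le b (hφ.continuous_fderiv one_ne_zero) fun x hx =>
      (hruc (hx.trans_le (min_le_left _ _))).le

end Approximation

/-! ### Weakly closed forms -/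

section Closed

open MeasureTheory Metric Filter
open scoped Topology

variable {n : ℕ}

/-- The real part of the top coefficient. -/
def topRe (n : ℕ) : Gr n →L[ℝ] ℝ := Complex.reCLM.comp (coeffLR Finset.univ)

lemma contDiff_of_zero_off {E : Type*} [NormedAddCommGroup E] [NormedSpace ℝ E]
    {k : WithTop ℕ∞} {f : Hn n → E} {U S : Set (Hn n)} (hS : IsClosed S) (hSU : S ⊆ U)
    (hf : ∀ q ∈ U, ContDiffAt ℝ k f q) (h0 : ∀ q ∉ S, f q = 0) : ContDiff ℝ k f := by
  refine contDiff_iff_contDiffAt.2 fun q => ?_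
  by_cases hq : q ∈ S
  · exact hf q (hSU hq)
  · refine (contDiffAt_const (c := (0 : E))).congr_of_eventuallyEq ?_
    filter_upwards [hS.isOpen_compl.mem_nhds hq] with p hp using h0 p hp

lemma continuous_of_zero_off {E : Type*} [NormedAddCommGroup E] [NormedSpace ℝ E]
    {f : Hn n → E} {U S : Set (Hn n)} (hU : IsOpen U) (hS : IsClosed S) (hSU : S ⊆ U)
    (hf : ContinuousOn f U) (h0 : ∀ q ∉ S, f q = 0) : Continuous f := by
  refine continuous_iff_continuousAt.2 fun q => ?_
  by_cases hq : q ∈ S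
  · exact hf.continuousAt (hU.mem_nhds (hSU hq))
  · refine (continuousAt_const (y := (0 : E))).congr ?_
    filter_upwards [hS.isOpen_compl.mem_nhds hq] with p hp using (h0 p hp).symm

lemma integrable_of_zero_off {E : Type*} [NormedAddCommGroup E] [NormedSpace ℝ E]
    {f : Hn n → E} {U S : Set (Hn n)} (hU : IsOpen U) (hS : IsCompact S) (hSU : S ⊆ U)
    (hf : ContinuousOn f U) (h0 : ∀ q ∉ S, f q = 0) : Integrable f :=
  (continuous_of_zero_off hU hS.isClosed hSU hf h0).integrable_of_hasCompactSupport
    (HasCompactSupport.intro hS h0)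

lemma dOp_zero_off {φ : Hn n → Gr n} {S : Set (Hn n)} (hS : IsClosed S)
    (h0 : ∀ q ∉ S, φ q = 0) (A' : Fin 2) : ∀ q ∉ S, dOp A' φ q = 0 := by
  intro q hq
  rw [dOp_congr (G := fun _ => (0 : Gr n)) (by
    filter_upwards [hS.isOpen_compl.mem_nhds hq] with p hp using h0 p hp) A',
    dOp_eq (differentiableAt_const _)]
  simp

lemma continuous_dOp {φ : Hn n → Gr n} (hφ : ContDiff ℝ 1 φ) (A' : Fin 2) :
    Continuous (dOp A' φ) :=
  continuous_iff_continuousAt.2 fun _ =>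
    (contDiffAt_dOp (k := 0) (by simpa using hφ.contDiffAt) A').continuousAt

/-- Closedness against compactly supported test forms of class `C¹`. -/
def WeaklyClosedOn (U : Set (Hn n)) (w : Hn n → Gr n) : Prop :=
  ∀ (A' : Fin 2) (φ : Hn n → Gr n) (S : Set (Hn n)), ContDiff ℝ 1 φ → IsCompact S → S ⊆ U →
    (∀ q ∉ S, φ q = 0) → ∫ q, topRe n (dOp A' φ q * w q) = 0

lemma integral_fderiv_apply_eq_zero {f : Hn n → ℝ} (hf : ContDiff ℝ 1 f)
    (hc : HasCompactSupport f) (v : Hn n) : ∫ q, fderiv ℝ f q v = 0 := by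
  have hi : Integrable (fun q => fderiv ℝ f q v) :=
    ((hf.continuous_fderiv one_ne_zero).clm_apply continuous_const).integrable_of_hasCompactSupport
      (hc.fderiv_apply ℝ v)
  have h := integral_smul_fderiv_eq_neg_fderiv_smul_of_integrable (μ := (volume : Measure (Hn n)))
    (f := fun _ => (1 : ℝ)) (g := f) (v := v) (by simp) (by simpa using hi)
    (by simpa using hf.continuous.integrable_of_hasCompactSupport hc)
    (fun x _ => differentiableAt_const _) (fun x _ => hf.differentiable one_ne_zero x)
  simpa using h

/-- The integrand is a sum of directional derivatives of compactly supported functions. -/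
lemma weaklyClosedOn_const (U : Set (Hn n)) (c : Gr n) : WeaklyClosedOn U fun _ => c := by
  intro A' φ S hφ hS _ h0
  have hc : HasCompactSupport φ := HasCompactSupport.intro hS h0
  set L : RIdx n → Gr n →L[ℝ] ℝ := fun j => (topRe n).comp
    ((ContinuousLinearMap.mul ℝ (Gr n) (theta A' j)).comp
      ((ContinuousLinearMap.mul ℝ (Gr n)).flip c)) with hL
  have hd : ∀ q j, fderiv ℝ (fun p => L j (φ p)) q (basisVec j) =
      topRe n (theta A' j * (fderiv ℝ φ q (basisVec j) * c)) := by
    intro q j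
    have h1 : fderiv ℝ (fun p => L j (φ p)) q = (L j).comp (fderiv ℝ φ q) :=
      ((L j).hasFDerivAt.comp q (hφ.differentiable one_ne_zero q).hasFDerivAt).fderiv
    rw [h1]
    rfl
  have hL1 : ∀ j, ContDiff ℝ 1 fun p => L j (φ p) := fun j => (L j).contDiff.comp hφ
  have hLc : ∀ j, HasCompactSupport fun p => L j (φ p) := fun j =>
    hc.comp_left (g := L j) (map_zero _)
  have e : ∀ q, topRe n (dOp A' φ q * c) =
      ∑ j, fderiv ℝ (fun p => L j (φ p)) q (basisVec j) := by
    intro q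
    rw [dOp_eq (hφ.differentiable one_ne_zero q), Finset.sum_mul, map_sum]
    exact Finset.sum_congr rfl fun j _ => by rw [hd, mul_assoc]
  simp only [e]
  rw [integral_finsetSum]
  · exact Finset.sum_eq_zero fun j _ => integral_fderiv_apply_eq_zero (hL1 j) (hLc j) _
  · intro j _
    exact (((hL1 j).continuous_fderiv one_ne_zero).clm_apply
      continuous_const).integrable_of_hasCompactSupport ((hLc j).fderiv_apply ℝ _)

lemma exists_norm_dOp_sub_le (n : ℕ) : ∃ C : ℝ, ∀ (A' : Fin 2) (φ ψ : Hn n → Gr n) (q : Hn n)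
    (ε : ℝ), DifferentiableAt ℝ φ q → DifferentiableAt ℝ ψ q →
    ‖fderiv ℝ ψ q - fderiv ℝ φ q‖ ≤ ε → ‖dOp A' ψ q - dOp A' φ q‖ ≤ C * ε := by
  refine ⟨∑ B : Fin 2, ∑ j : RIdx n, ‖(theta B j : Gr n)‖ * ‖(basisVec j : Hn n)‖,
    fun A' φ ψ q ε hφ hψ hε => ?_⟩
  rw [dOp_eq hφ, dOp_eq hψ, ← Finset.sum_sub_distrib]
  have h0 : 0 ≤ ε := (ContinuousLinearMap.opNorm_nonneg _).trans hε
  calc ‖∑ j, (theta A' j * fderiv ℝ ψ q (basisVec j) - theta A' j * fderiv ℝ φ q (basisVec j))‖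
      ≤ ∑ j : RIdx n, ‖(theta A' j : Gr n)‖ * ‖(basisVec j : Hn n)‖ * ε := by
        refine norm_sum_le_of_le _ fun j _ => ?_
        rw [← mul_sub, mul_assoc]
        refine (norm_mul_le _ _).trans (mul_le_mul_of_nonneg_left ?_ (norm_nonneg _))
        have := (fderiv ℝ ψ q - fderiv ℝ φ q).le_of_opNorm_le hε (basisVec j)
        exact this.trans_eq (mul_comm _ _)
    _ = (∑ j : RIdx n, ‖(theta A' j : Gr n)‖ * ‖(basisVec j : Hn n)‖) * ε := by
        rw [Finset.sum_mul]
    _ ≤ _ := by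
        refine mul_le_mul_of_nonneg_right ?_ h0
        exact Finset.single_le_sum (f := fun B : Fin 2 => ∑ j : RIdx n,
          ‖(theta B j : Gr n)‖ * ‖(basisVec j : Hn n)‖)
          (fun B _ => Finset.sum_nonneg fun j _ => by positivity) (Finset.mem_univ A')

/-- Test forms of class `C²` suffice. -/
lemma weaklyClosedOn_of_contDiff_two {U : Set (Hn n)} (hU : IsOpen U) {w : Hn n → Gr n}
    (hw : ContinuousOn w U)
    (h : ∀ (A' : Fin 2) (φ : Hn n → Gr n) (S : Set (Hn n)), ContDiff ℝ 2 φ → IsCompact S →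
      S ⊆ U → (∀ q ∉ S, φ q = 0) → ∫ q, topRe n (dOp A' φ q * w q) = 0) :
    WeaklyClosedOn U w := by
  intro A' φ S hφ hS hSU h0
  obtain ⟨K, hK, hKU, hφK, happ⟩ := exists_smooth_approx hU hφ (HasCompactSupport.intro hS h0)
    ((closure_minimal (fun q (hq : φ q ≠ 0) => by_contra fun hn => hq (h0 q hn))
      hS.isClosed).trans hSU)
  obtain ⟨C, hC⟩ := exists_norm_dOp_sub_le n
  obtain ⟨B, hB⟩ := hK.exists_bound_of_continuousOn (hw.mono hKU)
  have hφ0 : ∀ q ∉ K, φ q = 0 := fun q hq => by_contra fun hn => hq (hφK (subset_tsupport _ hn))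
  have hint : ∀ ψ : Hn n → Gr n, ContDiff ℝ 1 ψ → (∀ q ∉ K, ψ q = 0) →
      Integrable fun q => topRe n (dOp A' ψ q * w q) := fun ψ hψ hψ0 =>
    integrable_of_zero_off hU hK hKU
      ((topRe n).continuous.comp_continuousOn ((continuous_dOp hψ A').continuousOn.mul hw))
      fun q hq => by rw [dOp_zero_off hK.isClosed hψ0 A' q hq, zero_mul, map_zero]
  -- The integral for the mollified form vanishes, so the integral for φ is that of a difference
  -- supported in K and of size O(ε).
  have key : ∀ ε > 0, |∫ q, topRe n (dOp A' φ q * w q)| ≤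
      ‖topRe n‖ * (C * ε * |B|) * volume.real K := by
    intro ε hε
    obtain ⟨ψ, hψ, hψK, hd⟩ := happ ε hε
    have hψ0 : ∀ q ∉ K, ψ q = 0 := fun q hq =>
      by_contra fun hn => hq (hψK (subset_tsupport _ hn))
    have hψ1 : ContDiff ℝ 1 ψ := hψ.of_le (by norm_num)
    have e1 : ∫ q, topRe n (dOp A' φ q * w q) =
        -∫ q, (topRe n (dOp A' ψ q * w q) - topRe n (dOp A' φ q * w q)) := by
      rw [integral_sub (hint ψ hψ1 hψ0) (hint φ hφ hφ0), h A' ψ K hψ hK hKU hψ0]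
      ring
    have e2 : ∫ q, (topRe n (dOp A' ψ q * w q) - topRe n (dOp A' φ q * w q)) =
        ∫ q in K, (topRe n (dOp A' ψ q * w q) - topRe n (dOp A' φ q * w q)) := by
      refine (setIntegral_eq_integral_of_forall_compl_eq_zero fun q hq => ?_).symm
      rw [dOp_zero_off hK.isClosed hψ0 A' q hq, dOp_zero_off hK.isClosed hφ0 A' q hq, sub_self]
    rw [e1, abs_neg, e2, ← Real.norm_eq_abs]
    refine norm_setIntegral_le_of_norm_le_const hK.measure_lt_top fun q hq => ?_
    rw [← map_sub, ← sub_mul]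
    refine (topRe n).le_of_opNorm_le_of_le le_rfl ((norm_mul_le _ _).trans ?_)
    have h1 := hC A' φ ψ q ε (hφ.differentiable one_ne_zero q)
      (hψ1.differentiable one_ne_zero q) (hd q)
    exact mul_le_mul h1 ((hB q hq).trans (le_abs_self _)) (norm_nonneg _)
      ((norm_nonneg _).trans h1)
  have hlim : Tendsto (fun ε : ℝ => ‖topRe n‖ * (C * ε * |B|) * volume.real K) (𝓝[>] 0) (𝓝 0) := by
    refine tendsto_nhdsWithin_of_tendsto_nhds ?_
    have hc : Continuous fun ε : ℝ => ‖topRe n‖ * (C * ε * |B|) * volume.real K := by fun_prop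
    simpa using hc.tendsto 0
  have := ge_of_tendsto hlim (by filter_upwards [self_mem_nhdsWithin] with ε hε using key ε hε)
  exact abs_nonpos_iff.1 this

end Closed

/-! ### Products with Baston forms and integration by parts -/

section ByParts

open MeasureTheory Metric Filter
open scoped Topology

variable {n : ℕ}

lemma contDiffAt_dOp_scal {u : Hn n → ℝ} {q : Hn n} (hu : ContDiffAt ℝ 2 u q) (B : Fin 2) :
    ContDiffAt ℝ 1 (dOp B (scal u)) q :=
  contDiffAt_dOp (k := 1) (by simpa using contDiffAt_scal hu) B

lemma theta_mul_dOp_scal {u : Hn n → ℝ} {q : Hn n} (hu : DifferentiableAt ℝ u q) (A' B : Fin 2)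
    (j : RIdx n) : theta A' j * dOp B (scal u) q = -(dOp B (scal u) q * theta A' j) := by
  simp only [dOp_scal hu, Finset.mul_sum, Finset.sum_mul, ← Finset.sum_neg_distrib,
    mul_smul_comm, smul_mul_assoc, theta_anticomm A' B j, smul_neg]

lemma dOp_scal_mul_dOp_scal {u v : Hn n → ℝ} {q : Hn n} (hu : DifferentiableAt ℝ u q)
    (hv : DifferentiableAt ℝ v q) (A' B : Fin 2) :
    dOp A' (scal u) q * dOp B (scal v) q = -(dOp B (scal v) q * dOp A' (scal u) q) := by
  rw [dOp_scal hu]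
  simp only [Finset.mul_sum, Finset.sum_mul, ← Finset.sum_neg_distrib,
    mul_smul_comm, smul_mul_assoc, theta_mul_dOp_scal hv, smul_neg]

lemma continuousOn_baston {u : Hn n → ℝ} {U : Set (Hn n)} (hU : IsOpen U)
    (hu : ContDiffOn ℝ 2 u U) : ContinuousOn (baston u) U := fun _ hq =>
  (contDiffAt_dOp (k := 0) (contDiffAt_dOp_scal (hu.contDiffAt (hU.mem_nhds hq)) 1)
    0).continuousAt.continuousWithinAt

lemma baston_mem_center {u : Hn n → ℝ} {q : Hn n} (hu : ContDiffAt ℝ 2 u q) :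
    baston u q ∈ Subalgebra.center ℂ (Gr n) := by
  rw [baston_eq_Lam hu]; exact Lam_mem_center _

lemma baston_comm {u : Hn n → ℝ} {q : Hn n} (hu : ContDiffAt ℝ 2 u q) (w : Gr n) :
    baston u q * w = w * baston u q :=
  (Subalgebra.mem_center_iff.1 (baston_mem_center hu) w).symm

/-- △u is only continuous and cannot be differentiated again. But d_{A'}(d_B u ∧ d_{A'}φ) =
d_{A'}d_B u ∧ d_{A'}φ, since d_{A'}² φ = 0 for φ of class C². With B ≠ A' the right side is ±△u ∧
d_{A'}φ, and d_B u ∧ d_{A'}φ is a C¹ test form for w. -/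
lemma weaklyClosedOn_baston_mul {U : Set (Hn n)} (hU : IsOpen U) {u : Hn n → ℝ}
    (hu : ContDiffOn ℝ 2 u U) {w : Hn n → Gr n} (hw : ContinuousOn w U)
    (hcl : WeaklyClosedOn U w) : WeaklyClosedOn U fun q => baston u q * w q := by
  have huat : ∀ q ∈ U, ContDiffAt ℝ 2 u q := fun q hq => hu.contDiffAt (hU.mem_nhds hq)
  refine weaklyClosedOn_of_contDiff_two hU ((continuousOn_baston hU hu).mul hw)
    fun A' φ S hφ hS hSU h0 => ?_
  have key : ∀ B : Fin 2,
      ∫ q, topRe n (dOp A' (dOp B (scal u)) q * dOp A' φ q * w q) = 0 := by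
    intro B
    have hz := dOp_zero_off hS.isClosed h0 A'
    have hΨ0 : ∀ q ∉ S, dOp B (scal u) q * dOp A' φ q = 0 := fun q hq => by
      rw [hz q hq, mul_zero]
    have hΨ : ContDiff ℝ 1 fun q => dOp B (scal u) q * dOp A' φ q :=
      contDiff_of_zero_off hS.isClosed hSU (fun q hq =>
        (contDiffAt_dOp_scal (huat q hq) B).mul
          (contDiffAt_dOp (k := 1) (by simpa using hφ.contDiffAt) A')) hΨ0
    rw [← hcl A' _ S hΨ hS hSU hΨ0]
    refine integral_congr_ae (Eventually.of_forall fun q => ?_)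
    by_cases hq : q ∈ S
    · have h1 := contDiffAt_dOp_scal (huat q (hSU hq)) B
      have h2 : ContDiffAt ℝ 1 (dOp A' φ) q :=
        contDiffAt_dOp (k := 1) (by simpa using hφ.contDiffAt) A'
      simp only
      rw [dOp_oneForm_mul (h1.differentiableAt one_ne_zero) (h2.differentiableAt one_ne_zero) A'
        (theta_mul_dOp_scal ((huat q (hSU hq)).differentiableAt two_ne_zero) A' B),
        dOp_dOp_self hφ.contDiffAt, mul_zero, sub_zero]
    · simp only [hz q hq, dOp_zero_off hS.isClosed hΨ0 A' q hq, mul_zero, zero_mul]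
  have hpt : ∀ (s : ℝ) (B : Fin 2), (∀ q ∈ U, dOp A' (dOp B (scal u)) q = s • baston u q) →
      ∀ q, topRe n (dOp A' (dOp B (scal u)) q * dOp A' φ q * w q) =
        s * topRe n (dOp A' φ q * (baston u q * w q)) := by
    intro s B hs q
    by_cases hq : q ∈ S
    · rw [hs q (hSU hq), smul_mul_assoc, smul_mul_assoc, map_smul, smul_eq_mul,
        baston_comm (huat q (hSU hq)), mul_assoc]
    · simp [dOp_zero_off hS.isClosed h0 A' q hq]
  have hfin : ∀ (s : ℝ) (B : Fin 2), s ≠ 0 →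
      (∀ q ∈ U, dOp A' (dOp B (scal u)) q = s • baston u q) →
      ∫ q, topRe n (dOp A' φ q * (baston u q * w q)) = 0 := by
    intro s B hs0 hs
    have := key B
    simp only [hpt s B hs] at this
    rw [integral_const_mul] at this
    exact (mul_eq_zero.1 this).resolve_left hs0
  -- B is the index different from A': d₀d₁u = △u and d₁d₀u = -△u.
  fin_cases A'
  · exact hfin 1 1 one_ne_zero fun q _ => (one_smul _ _).symm
  · refine hfin (-1) 0 (by norm_num) fun q hq => ?_
    rw [neg_smul, one_smul]
    exact dOp_dOp_anticomm (contDiffAt_scal (huat q hq)) 1 0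

lemma continuousOn_prod_baston {U : Set (Hn n)} (hU : IsOpen U) (c : Gr n) {k : ℕ}
    (u : Fin k → Hn n → ℝ) (hu : ∀ i, ContDiffOn ℝ 2 (u i) U) :
    ContinuousOn (fun q => (List.ofFn fun i => baston (u i) q).prod * c) U := by
  induction k with
  | zero => simpa using continuousOn_const
  | succ k ih =>
    simp only [List.ofFn_succ, List.prod_cons, mul_assoc]
    exact (continuousOn_baston hU (hu 0)).mul (ih (fun i => u i.succ) fun i => hu i.succ)

lemma weaklyClosedOn_prod_baston {U : Set (Hn n)} (hU : IsOpen U) (c : Gr n) {k : ℕ}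
    (u : Fin k → Hn n → ℝ) (hu : ∀ i, ContDiffOn ℝ 2 (u i) U) :
    WeaklyClosedOn U fun q => (List.ofFn fun i => baston (u i) q).prod * c := by
  induction k with
  | zero => simpa using weaklyClosedOn_const U c
  | succ k ih =>
    simp only [List.ofFn_succ, List.prod_cons, mul_assoc]
    exact weaklyClosedOn_baston_mul hU (hu 0)
      (continuousOn_prod_baston hU c (fun i => u i.succ) fun i => hu i.succ)
      (ih (fun i => u i.succ) fun i => hu i.succ)

/-- Green's formula from χ △u - u △χ = d₀(χ d₁u) + d₁(u d₀χ): the terms d₀χ ∧ d₁u and d₁u ∧ d₀χ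
cancel, and d₁d₀χ = -△χ. Both primitives are C¹ test forms, so they integrate to zero against the
weakly closed w. -/
lemma integral_mul_baston_comm {U S : Set (Hn n)} (hU : IsOpen U) (hS : IsCompact S)
    (hSU : S ⊆ U) {u χ : Hn n → ℝ} (hu : ContDiffOn ℝ 2 u U) (hχ : ContDiff ℝ 2 χ)
    (hχ0 : ∀ q ∉ S, χ q = 0) {w : Hn n → Gr n} (hw : ContinuousOn w U)
    (hcl : WeaklyClosedOn U w) :
    ∫ q, χ q * topRe n (baston u q * w q) = ∫ q, u q * topRe n (baston χ q * w q) := by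
  have huat : ∀ q ∈ U, ContDiffAt ℝ 2 u q := fun q hq => hu.contDiffAt (hU.mem_nhds hq)
  have hs0 : ∀ q ∉ S, scal χ q = 0 := fun q hq => by simp [scal, hχ0 q hq]
  have hz : ∀ A', ∀ q ∉ S, dOp A' (scal χ) q = 0 := dOp_zero_off hS.isClosed hs0
  have hzz : ∀ q ∉ S, baston χ q = 0 := dOp_zero_off hS.isClosed (hz 1) 0
  set φ : Hn n → Gr n := fun q => algebraMap ℂ (Gr n) (χ q : ℂ) * dOp 1 (scal u) q with hφ
  set ψ : Hn n → Gr n := fun q => algebraMap ℂ (Gr n) (u q : ℂ) * dOp 0 (scal χ) q with hψ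
  have hφ0 : ∀ q ∉ S, φ q = 0 := fun q hq => by simp [hφ, hχ0 q hq]
  have hψ0 : ∀ q ∉ S, ψ q = 0 := fun q hq => by simp [hψ, hz 0 q hq]
  have hφ1 : ContDiff ℝ 1 φ := contDiff_of_zero_off hS.isClosed hSU (fun q hq =>
    ((contDiffAt_scal hχ.contDiffAt).of_le (by norm_num)).mul
      (contDiffAt_dOp_scal (huat q hq) 1)) hφ0
  have hψ1 : ContDiff ℝ 1 ψ := contDiff_of_zero_off hS.isClosed hSU (fun q hq =>
    ((contDiffAt_scal (huat q hq)).of_le (by norm_num)).mul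
      (contDiffAt_dOp_scal hχ.contDiffAt 0)) hψ0
  have hint : ∀ (A' : Fin 2) (F : Hn n → Gr n), ContDiff ℝ 1 F → (∀ q ∉ S, F q = 0) →
      Integrable fun q => topRe n (dOp A' F q * w q) := fun A' F hF hF0 =>
    integrable_of_zero_off hU hS hSU
      ((topRe n).continuous.comp_continuousOn ((continuous_dOp hF A').continuousOn.mul hw))
      fun q hq => by rw [dOp_zero_off hS.isClosed hF0 A' q hq, zero_mul, map_zero]
  have hint2 : Integrable fun q => u q * topRe n (baston χ q * w q) :=
    integrable_of_zero_off hU hS hSU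
      (hu.continuousOn.mul ((topRe n).continuous.comp_continuousOn
        ((continuousOn_baston hU hχ.contDiffOn).mul hw)))
      fun q hq => by rw [hzz q hq, zero_mul, map_zero, mul_zero]
  have hpt : ∀ q, χ q * topRe n (baston u q * w q) =
      topRe n (dOp 0 φ q * w q) + topRe n (dOp 1 ψ q * w q) +
        u q * topRe n (baston χ q * w q) := by
    intro q
    by_cases hq : q ∈ S
    · have hu2 := huat q (hSU hq)
      have hud := hu2.differentiableAt two_ne_zero
      have hχd : DifferentiableAt ℝ χ q := hχ.contDiffAt.differentiableAt two_ne_zero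
      have e1 : dOp 0 φ q = dOp 0 (scal χ) q * dOp 1 (scal u) q +
          algebraMap ℂ (Gr n) (χ q : ℂ) * baston u q :=
        dOp_algebraMap_mul (f := fun p => (χ p : ℂ))
          (Complex.ofRealCLM.differentiableAt.comp q hχd)
          ((contDiffAt_dOp_scal hu2 1).differentiableAt one_ne_zero) 0
      have e2 : dOp 1 ψ q = dOp 1 (scal u) q * dOp 0 (scal χ) q +
          algebraMap ℂ (Gr n) (u q : ℂ) * dOp 1 (dOp 0 (scal χ)) q :=
        dOp_algebraMap_mul (f := fun p => (u p : ℂ))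
          (Complex.ofRealCLM.differentiableAt.comp q hud)
          ((contDiffAt_dOp_scal hχ.contDiffAt 0).differentiableAt one_ne_zero) 1
      have e3 : dOp 1 (dOp 0 (scal χ)) q = -baston χ q :=
        dOp_dOp_anticomm (contDiffAt_scal hχ.contDiffAt) 1 0
      have e4 := dOp_scal_mul_dOp_scal hχd hud 0 1
      have e5 : χ q • baston u q = dOp 0 φ q + dOp 1 ψ q + u q • baston χ q := by
        rw [e1, e2, e3, e4, real_smul_eq, real_smul_eq, Algebra.smul_def, Algebra.smul_def]
        noncomm_ring
      have e6 := congrArg (fun z => topRe n (z * w q)) e5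
      simpa only [add_mul, map_add, smul_mul_assoc, map_smul, smul_eq_mul] using e6
    · rw [hχ0 q hq, hzz q hq, dOp_zero_off hS.isClosed hφ0 0 q hq,
        dOp_zero_off hS.isClosed hψ0 1 q hq]
      simp
  simp only [hpt]
  rw [integral_add (f := fun q => topRe n (dOp 0 φ q * w q) + topRe n (dOp 1 ψ q * w q))
      ((hint 0 φ hφ1 hφ0).add (hint 1 ψ hψ1 hψ0)) hint2,
    integral_add (hint 0 φ hφ1 hφ0) (hint 1 ψ hψ1 hψ0), hcl 0 φ S hφ1 hS hSU hφ0,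
    hcl 1 ψ S hψ1 hS hSU hψ0]
  ring

end ByParts

/-! ### The local Chern–Levine–Nirenberg estimate -/

section Estimate

open MeasureTheory Metric Filter
open scoped Topology

variable {n : ℕ}

/-- The standard inner product. -/
def idForm (n : ℕ) : Hn n →L[ℝ] Hn n →L[ℝ] ℝ :=
  ∑ l : Fin n, (innerSL ℝ (E := ℍ[ℝ])).bilinearComp (ContinuousLinearMap.proj l)
    (ContinuousLinearMap.proj l)

lemma idForm_apply (v w : Hn n) : idForm n v w = ∑ l, inner ℝ (v l) (w l) := by
  simp [idForm, ContinuousLinearMap.bilinearComp_apply]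

lemma idForm_symm (v w : Hn n) : idForm n v w = idForm n w v := by
  simp only [idForm_apply, real_inner_comm]

/-- The norm of `Hn n` is the maximum over the quaternionic entries, hence at most the Euclidean
norm. -/
lemma norm_sq_le_idForm (v : Hn n) : ‖v‖ ^ 2 ≤ idForm n v v := by
  simp only [idForm_apply, real_inner_self_eq_norm_sq]
  have h0 : 0 ≤ ∑ l, ‖v l‖ ^ 2 := Finset.sum_nonneg fun l _ => sq_nonneg _
  rw [← Real.le_sqrt (norm_nonneg _) h0]
  refine (pi_norm_le_iff_of_nonneg (Real.sqrt_nonneg _)).2 fun l => Real.le_sqrt_of_sq_le ?_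
  exact Finset.single_le_sum (f := fun l => ‖v l‖ ^ 2) (fun l _ => sq_nonneg _)
    (Finset.mem_univ l)

lemma linePSD_of_nonneg {B : Hn n →L[ℝ] Hn n →L[ℝ] ℝ} (h : ∀ v, 0 ≤ B v v) : LinePSD B :=
  fun v => by
    rw [lineAvg_apply]
    exact Finset.sum_nonneg fun m _ => h _

lemma isPos2_Lam {B : Hn n →L[ℝ] Hn n →L[ℝ] ℝ} (hB : ∀ v w, B v w = B w v) (h : LinePSD B) :
    IsPos2 (Lam B) := exists_Lam_eq_sum_elemForm hB h

/-- The Baston form of half the squared norm. -/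
def kahler (n : ℕ) : Gr n := Lam (idForm n)

lemma isPos2_kahler : IsPos2 (kahler n) :=
  isPos2_Lam idForm_symm (linePSD_of_nonneg fun v => (sq_nonneg ‖v‖).trans (norm_sq_le_idForm v))

lemma isPos2_baston {u : Hn n → ℝ} {q : Hn n} (hu : ContDiffAt ℝ 2 u q)
    (h : LinePSD (fderiv ℝ (fderiv ℝ u) q)) : IsPos2 (baston u q) := by
  rw [baston_eq_Lam hu]
  exact isPos2_Lam (fderiv_fderiv_symm hu) h

lemma exists_bound_fderiv_fderiv {V : Type*} [NormedAddCommGroup V] [NormedSpace ℝ V]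
    {χ : V → ℝ} (hχ : ContDiff ℝ 2 χ) {S : Set V} (hS : IsCompact S) :
    ∃ C : ℝ, ∀ q ∈ S, ∀ v, |fderiv ℝ (fderiv ℝ χ) q v v| ≤ C * (‖v‖ * ‖v‖) := by
  have hc : Continuous fun q => fderiv ℝ (fderiv ℝ χ) q :=
    (hχ.fderiv_right (m := 1) (by norm_num)).continuous_fderiv one_ne_zero
  obtain ⟨C, hC⟩ := hS.exists_bound_of_continuousOn (E := V →L[ℝ] V →L[ℝ] ℝ) hc.continuousOn
  refine ⟨C, fun q hq v => ?_⟩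
  have := (fderiv ℝ (fderiv ℝ χ) q).le_of_opNorm₂_le_of_le (hC q hq) le_rfl le_rfl
    (x := v) (y := v)
  rwa [Real.norm_eq_abs, mul_assoc] at this

/-- A large multiple of the inner product dominates the Hessian of χ on a compact set. The cases s =
1 and s = -1 give a two-sided bound of △χ by the form `kahler n`. -/
lemma exists_isPos2_kahler_add {χ : Hn n → ℝ} (hχ : ContDiff ℝ 2 χ) {S : Set (Hn n)}
    (hS : IsCompact S) : ∃ C : ℝ, 0 ≤ C ∧ ∀ q ∈ S, ∀ s : ℝ, |s| ≤ 1 →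
      IsPos2 (C • kahler n + s • baston χ q) := by
  obtain ⟨C, hC⟩ := exists_bound_fderiv_fderiv hχ hS
  refine ⟨|C|, abs_nonneg _, fun q hq s hs => ?_⟩
  have e : |C| • kahler n + s • baston χ q =
      Lam (|C| • idForm n + s • fderiv ℝ (fderiv ℝ χ) q) := by
    rw [Lam_add, Lam_smul, Lam_smul, baston_eq_Lam hχ.contDiffAt]
    rfl
  rw [e]
  refine isPos2_Lam (fun v w => ?_) (linePSD_of_nonneg fun v => ?_)
  · simp only [add_apply, smul_apply, idForm_symm v w, fderiv_fderiv_symm hχ.contDiffAt v w]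
  · simp only [add_apply, smul_apply, smul_eq_mul]
    have h1 : |fderiv ℝ (fderiv ℝ χ) q v v| ≤ |C| * (‖v‖ * ‖v‖) :=
      (hC q hq v).trans (mul_le_mul_of_nonneg_right (le_abs_self C) (by positivity))
    have h2 : |s * fderiv ℝ (fderiv ℝ χ) q v v| ≤ |C| * (‖v‖ * ‖v‖) := by
      rw [abs_mul]
      exact (mul_le_of_le_one_left (abs_nonneg _) hs).trans h1
    have h3 := mul_le_mul_of_nonneg_left (norm_sq_le_idForm v) (abs_nonneg C)
    have h4 := (abs_le.1 h2).1
    nlinarith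

lemma topRe_mul_prod_nonneg {z : Gr n} (hz : IsPos2 z) {k r : ℕ} (hk : k + 1 + r = n)
    {f : Fin k → Gr n} (hf : ∀ i, IsPos2 (f i)) :
    0 ≤ topRe n (z * ((List.ofFn f).prod * kahler n ^ r)) := by
  have h := topCoeff_list_prod_nonneg (z :: (List.ofFn f ++ List.replicate r (kahler n)))
    (by
      intro w hw
      simp only [List.mem_cons, List.mem_append, List.mem_ofFn, List.mem_replicate] at hw
      rcases hw with rfl | ⟨i, rfl⟩ | ⟨_, rfl⟩
      exacts [hz, hf i, isPos2_kahler])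
    (by simp; omega)
  rw [List.prod_cons, List.prod_append, List.prod_replicate] at h
  exact (Complex.le_def.1 h).1

/-- The Chern–Levine–Nirenberg induction. Each step removes one factor △u and creates one factor
`kahler n`, so k + r = n is preserved; at k = 0 the integrand is a constant. `K'` collects the
supports of the cut-offs, where the sizes of the functions enter. -/
lemma local_estimate {U : Set (Hn n)} (hU : IsOpen U) (k r : ℕ) (hk : k + r = n)
    {K : Set (Hn n)} (hK : IsCompact K) (hKU : K ⊆ U) :
    ∃ C : ℝ, 0 ≤ C ∧ ∃ K' : Set (Hn n), IsCompact K' ∧ K' ⊆ U ∧ ∀ u : Fin k → Hn n → ℝ,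
      (∀ i, ContDiffOn ℝ 2 (u i) U) → (∀ i, ∀ q ∈ U, LinePSD (fderiv ℝ (fderiv ℝ (u i)) q)) →
      ∀ m : Fin k → ℝ, (∀ i, 0 ≤ m i) → (∀ i, ∀ q ∈ K', |u i q| ≤ m i) →
        ∫ q in K, topRe n ((List.ofFn fun i => baston (u i) q).prod * kahler n ^ r) ≤
          C * ∏ i, m i := by
  induction k generalizing r K with
  | zero =>
    refine ⟨|∫ _ in K, topRe n (kahler n ^ r)|, abs_nonneg _, K, hK, hKU,
      fun u _ _ m _ _ => ?_⟩
    simpa using le_abs_self (∫ _ in K, topRe n (kahler n ^ r))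
  | succ k ih =>
    obtain ⟨χ, hχ, hχc, hχU, hχ0, hχ1⟩ := exists_cutoff hU hK hKU
    have hχ2 : ContDiff ℝ 2 χ := hχ.of_le (by norm_cast)
    have hS : IsCompact (tsupport χ) := hχc
    have hz : ∀ q ∉ tsupport χ, χ q = 0 := fun q hq => image_eq_zero_of_notMem_tsupport hq
    obtain ⟨A, hA, hpos⟩ := exists_isPos2_kahler_add hχ2 hS
    -- The induction hypothesis is applied on the support of χ in place of K, with one more factor
    -- `kahler n`.
    obtain ⟨C, hC, K', hK', hKU', hest⟩ := ih (r + 1) (by omega) hS hχU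
    refine ⟨A * C, mul_nonneg hA hC, tsupport χ ∪ K', hS.union hK', Set.union_subset hχU hKU',
      fun u hu hpsd m hm0 hm => ?_⟩
    set w : Hn n → Gr n := fun q =>
      (List.ofFn fun i : Fin k => baston (u i.succ) q).prod * kahler n ^ r with hw
    have huat : ∀ i, ∀ q ∈ U, ContDiffAt ℝ 2 (u i) q := fun i q hq =>
      (hu i).contDiffAt (hU.mem_nhds hq)
    have hwc : ContinuousOn w U := continuousOn_prod_baston hU _ _ fun i => hu i.succ
    have hwcl : WeaklyClosedOn U w := weaklyClosedOn_prod_baston hU _ _ fun i => hu i.succ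
    have hnn : ∀ q ∈ U, ∀ z, IsPos2 z → 0 ≤ topRe n (z * w q) := fun q hq z hz =>
      topRe_mul_prod_nonneg hz hk fun i => isPos2_baston (huat _ q hq) (hpsd _ q hq)
    have hcont : ∀ v : Hn n → ℝ, ContDiffOn ℝ 2 v U →
        ContinuousOn (fun q => topRe n (baston v q * w q)) U := fun v hv =>
      (topRe n).continuous.comp_continuousOn ((continuousOn_baston hU hv).mul hwc)
    have hb0 : ∀ q ∉ tsupport χ, baston χ q = 0 :=
      dOp_zero_off hS.isClosed (dOp_zero_off hS.isClosed (fun q hq => by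
        simp only [hz q hq, Complex.ofReal_zero, map_zero]) 1) 0
    calc ∫ q in K, topRe n ((List.ofFn fun i => baston (u i) q).prod * kahler n ^ r)
        = ∫ q in K, χ q * topRe n (baston (u 0) q * w q) := by
          refine setIntegral_congr_fun hK.measurableSet fun q hq => ?_
          simp only [hχ1 q hq, one_mul, List.ofFn_succ, List.prod_cons, mul_assoc, hw]
      -- Positivity of the product of all Baston forms allows the enlargement of the domain beyond
      -- K.
      _ ≤ ∫ q, χ q * topRe n (baston (u 0) q * w q) := by
          refine setIntegral_le_integral (integrable_of_zero_off hU hS hχU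
            (hχ.continuous.continuousOn.mul (hcont _ (hu 0))) fun q hq => by
              rw [hz q hq, zero_mul]) (Eventually.of_forall fun q => ?_)
          by_cases hq : q ∈ tsupport χ
          · exact mul_nonneg (hχ0 q) (hnn q (hχU hq) _
              (isPos2_baston (huat 0 q (hχU hq)) (hpsd 0 q (hχU hq))))
          · simp [hz q hq]
      _ = ∫ q, u 0 q * topRe n (baston χ q * w q) :=
          integral_mul_baston_comm hU hS hχU (hu 0) hχ2 hz hwc hwcl
      _ = ∫ q in tsupport χ, u 0 q * topRe n (baston χ q * w q) :=
          (setIntegral_eq_integral_of_forall_compl_eq_zero fun q hq => by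
            rw [hb0 q hq, zero_mul, map_zero, mul_zero]).symm
      _ ≤ ∫ q in tsupport χ, m 0 * (A * topRe n (kahler n * w q)) := by
          refine setIntegral_mono_on ?_ ?_ hS.measurableSet fun q hq => ?_
          · exact (((hu 0).continuousOn.mul (hcont χ hχ2.contDiffOn)).mono
              hχU).integrableOn_compact hS
          · exact ((continuousOn_const.mul (continuousOn_const.mul
              ((topRe n).continuous.comp_continuousOn
                (continuousOn_const.mul hwc)))).mono hχU).integrableOn_compact hS
          -- A `kahler n` ± △χ is positive, and its product with w has nonnegative top coefficient
          -- for both signs.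
          · have h1 : |topRe n (baston χ q * w q)| ≤ A * topRe n (kahler n * w q) := by
              have hp := hnn q (hχU hq) _ (hpos q hq 1 (by norm_num))
              have hm := hnn q (hχU hq) _ (hpos q hq (-1) (by norm_num))
              simp only [add_mul, map_add, smul_mul_assoc, map_smul, smul_eq_mul] at hp hm
              exact abs_le.2 ⟨by linarith, by linarith⟩
            have h2 := hm 0 q (Or.inl hq)
            refine (le_abs_self _).trans ?_
            rw [abs_mul]
            exact mul_le_mul h2 h1 (abs_nonneg _) (hm0 0)
      _ = m 0 * (A * ∫ q in tsupport χ, topRe n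
            ((List.ofFn fun i : Fin k => baston (u i.succ) q).prod * kahler n ^ (r + 1))) := by
          rw [integral_const_mul, integral_const_mul]
          refine congrArg (fun t => m 0 * (A * t)) (integral_congr_ae (Eventually.of_forall
            fun q => congrArg (topRe n) ?_))
          have := Subalgebra.mem_center_iff.1 (Lam_mem_center (idForm n)) (w q)
          rw [pow_succ, ← mul_assoc (List.prod _)]
          exact this.symm
      _ ≤ m 0 * (A * (C * ∏ i : Fin k, m i.succ)) := by
          have := hest (fun i => u i.succ) (fun i => hu i.succ) (fun i => hpsd i.succ)
            (fun i => m i.succ) (fun i => hm0 i.succ) fun i q hq => hm i.succ q (Or.inr hq)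
          gcongr
          exact hm0 0
      _ = _ := by rw [Fin.prod_univ_succ]; ring

end Estimate

/-! ### Transition maps, densities and the measure of a volume form -/

section Measure

open MeasureTheory Filter
open scoped Topology

variable {n : ℕ} {M : Type*} [TopologicalSpace M]
  {e e' : OpenPartialHomeomorph M (Hn n)} {g : Matrix (Fin (n + 1)) (Fin (n + 1)) ℍ[ℝ]}

lemma IsTransition.eventually (hg : IsTransition g e e') {x : M} (hx : x ∈ e.source ∩ e'.source) :
    ∀ᶠ q in 𝓝 (e x), e.symm q ∈ e.source ∩ e'.source ∧ e (e.symm q) = q ∧ J1 g q ≠ 0 ∧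
      e' (e.symm q) = frac g q := by
  have h1 : ∀ᶠ q in 𝓝 (e x), e.symm q ∈ e.source ∩ e'.source :=
    (e.tendsto_symm hx.1).eventually ((e.open_source.inter e'.open_source).mem_nhds hx)
  filter_upwards [h1, e.open_target.mem_nhds (e.map_source hx.1)] with q hq hqt
  have h2 := hg.2 _ hq
  rw [e.right_inv hqt] at h2
  exact ⟨hq, e.right_inv hqt, h2⟩

lemma IsTransition.hasFDerivAt (hg : IsTransition g e e') {x : M}
    (hx : x ∈ e.source ∩ e'.source) :
    HasFDerivAt (fun q => e' (e.symm q)) (transCLM (J2 g (e x)) (J1 g (e x))⁻¹) (e x) :=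
  (hasFDerivAt_frac (hg.2 x hx).1).congr_of_eventuallyEq
    ((hg.eventually hx).mono fun _ hq => hq.2.2.2)

lemma aemeasurable_symm [MeasurableSpace M] [BorelSpace M]
    (e : OpenPartialHomeomorph M (Hn n)) (f : Hn n → ℝ≥0∞) :
    AEMeasurable e.symm ((volume.restrict e.target).withDensity f) :=
  (e.continuousOn_symm.aemeasurable e.open_target.measurableSet).mono_ac
    (withDensity_absolutelyContinuous _ _)

lemma measurableSet_image_source_inter [MeasurableSpace M] [BorelSpace M]
    (e : OpenPartialHomeomorph M (Hn n)) {A : Set M}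
    (hA : MeasurableSet A) : MeasurableSet (e '' (e.source ∩ A)) := by
  have h := e.open_target.measurableSet.subtype_image
    ((continuousOn_iff_continuous_domRestrict.1 e.continuousOn_symm).measurable hA)
  convert h using 1
  rw [e.image_source_inter_eq']
  ext q
  simp [and_comm]

variable [ChartedSpace (Hn n) M]

lemma VolumeForm.rep_transition (dV : VolumeForm n M) (he : e ∈ atlas (Hn n) M)
    (he' : e' ∈ atlas (Hn n) M) (hg : IsTransition g e e') {x : M}
    (hx : x ∈ e.source ∩ e'.source) :
    dV.rep e (e x) = (‖J1 g (e x)‖ ^ (4 * n + 4))⁻¹ * dV.rep e' (e' x) := by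
  rw [dV.glue e he e' he' x hx, (hg.hasFDerivAt hx).fderiv,
    det_fderiv_frac hg.1 (hg.2 x hx).1]

/-- Families of functions that transform like the coefficients of a volume form. -/
def IsDensity (F : OpenPartialHomeomorph M (Hn n) → Hn n → ℂ) : Prop :=
  ∀ e ∈ atlas (Hn n) M, ∀ e' ∈ atlas (Hn n) M, ∀ g, IsTransition g e e' →
    ∀ x ∈ e.source ∩ e'.source,
      F e (e x) = (((‖J1 g (e x)‖ ^ (4 * n + 4))⁻¹ : ℝ) : ℂ) * F e' (e' x)

/-- The exponent 4n + 2 and the |J₁|^(-2) from det τ(J₂) add up to the Jacobian weight 4n + 4. -/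
lemma isDensity_topCoeff {Φ : OpenPartialHomeomorph M (Hn n) → Hn n → Gr n}
    (hmem : ∀ e ∈ atlas (Hn n) M, ∀ x ∈ e.source,
      Φ e (e x) ∈ ⋀[ℂ]^(2 * n) (Fin (n * 2) → ℂ))
    (h : ∀ e ∈ atlas (Hn n) M, ∀ e' ∈ atlas (Hn n) M, ∀ g, IsTransition g e e' →
      ∀ x ∈ e.source ∩ e'.source, Φ e (e x) = (((‖J1 g (e x)‖ ^ (4 * n + 2))⁻¹ : ℝ) : ℂ) •
        grActHom (tau (J2 g (e x))).transpose (Φ e' (e' x))) :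
    IsDensity fun e q => topCoeff (Φ e q) := by
  intro e he e' he' g hg x hx
  have h1 := (hg.2 x hx).1
  simp only
  rw [h e he e' he' g hg x hx, ← topL_apply, map_smul, topL_apply,
    topCoeff_grActHom _ (hmem e' he' x hx.2), Matrix.det_transpose, det_tau_J2 hg.1 h1,
    smul_eq_mul, ← mul_assoc, ← Complex.ofReal_mul, ← mul_inv, ← pow_add]

/-- Coefficient and volume density acquire the same factor under a transition, so the quotient may
be computed in any chart. -/
lemma VolumeForm.ratio_eq (hM : IsLocallyProjectiveFlat n M) (dV : VolumeForm n M)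
    {Φ : OpenPartialHomeomorph M (Hn n) → Hn n → Gr n}
    (hΦ : IsDensity fun e q => topCoeff (Φ e q)) (he : e ∈ atlas (Hn n) M) {x : M}
    (hx : x ∈ e.source) : dV.ratio Φ x = topCoeff (Φ e (e x)) / (dV.rep e (e x) : ℂ) := by
  obtain ⟨g, hg⟩ := hM (chartAt (Hn n) x) (chart_mem_atlas _ x) e he
  have hx' : x ∈ (chartAt (Hn n) x).source ∩ e.source := ⟨mem_chart_source _ x, hx⟩
  have hJ : ‖J1 g (chartAt (Hn n) x x)‖ ≠ 0 := norm_ne_zero_iff.2 (hg.2 x hx').1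
  have h1 := hΦ _ (chart_mem_atlas _ x) e he g hg x hx'
  simp only at h1
  rw [VolumeForm.ratio, h1,
    dV.rep_transition (chart_mem_atlas _ x) he hg hx', Complex.ofReal_mul]
  refine mul_div_mul_left _ _ ?_
  rw [Complex.ofReal_ne_zero]
  positivity

variable [MeasurableSpace M] [BorelSpace M]

/-- The measure of a volume form in a chart. -/
def VolumeForm.chartMeasure (dV : VolumeForm n M) (e : OpenPartialHomeomorph M (Hn n)) :
    Measure M :=
  ((volume.restrict e.target).withDensity (fun q => ENNReal.ofReal (dV.rep e q))).map e.symm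

lemma VolumeForm.chartMeasure_restrict (dV : VolumeForm n M)
    (e : OpenPartialHomeomorph M (Hn n)) {A : Set M} (hA : MeasurableSet A) :
    (dV.chartMeasure e).restrict A = ((volume.restrict (e '' (e.source ∩ A))).withDensity
      (fun q => ENNReal.ofReal (dV.rep e q))).map e.symm := by
  rw [chartMeasure, Measure.restrict_map_of_aemeasurable (aemeasurable_symm e _) hA,
    restrict_withDensity', Measure.restrict_restrict' e.open_target.measurableSet, Set.inter_comm,
    e.image_source_inter_eq']

lemma VolumeForm.chartMeasure_apply (dV : VolumeForm n M)
    (e : OpenPartialHomeomorph M (Hn n)) {A : Set M} (hA : MeasurableSet A) :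
    dV.chartMeasure e A = ∫⁻ q in e '' (e.source ∩ A), ENNReal.ofReal (dV.rep e q) := by
  rw [chartMeasure, Measure.map_apply_of_aemeasurable (aemeasurable_symm e _) hA,
    withDensity_apply', Measure.restrict_restrict' e.open_target.measurableSet, Set.inter_comm,
    e.image_source_inter_eq']

/-- Change of variables on the overlap. There is only an inequality because A need not lie in the
domain of `e'`, where the measure of that chart lives. -/
lemma VolumeForm.chartMeasure_le (dV : VolumeForm n M) (he : e ∈ atlas (Hn n) M)
    (he' : e' ∈ atlas (Hn n) M) (hg : IsTransition g e e') {A : Set M} (hA : MeasurableSet A)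
    (hAe : A ⊆ e.source) : dV.chartMeasure e' A ≤ dV.chartMeasure e A := by
  rw [dV.chartMeasure_apply e' hA, dV.chartMeasure_apply e hA]
  set B := e '' (e.source ∩ (e'.source ∩ A)) with hB
  have hBm : MeasurableSet B :=
    measurableSet_image_source_inter e (e'.open_source.measurableSet.inter hA)
  have hfrac : ∀ x ∈ e'.source ∩ A, frac g (e x) = e' x := fun x hx =>
    (hg.2 x ⟨hAe hx.2, hx.1⟩).2.symm
  have himg : e' '' (e'.source ∩ A) = frac g '' B := by
    rw [hB, Set.inter_eq_right.2 (Set.inter_subset_right.trans hAe), Set.image_image]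
    exact Set.image_congr fun x hx => (hfrac x hx).symm
  have hinj : Set.InjOn (frac g) B := by
    rintro _ ⟨x, hx, rfl⟩ _ ⟨y, hy, rfl⟩ h
    rw [hfrac x hx.2, hfrac y hy.2] at h
    rw [e'.injOn hx.2.1 hy.2.1 h]
  rw [himg, lintegral_image_eq_lintegral_abs_det_fderiv_mul volume hBm
    (f' := fun q => transCLM (J2 g q) (J1 g q)⁻¹) (fun q hq => by
    obtain ⟨x, hx, rfl⟩ := hq
    exact (hasFDerivAt_frac (hg.2 x ⟨hx.1, hx.2.1⟩).1).hasFDerivWithinAt) hinj]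
  refine (setLIntegral_congr_fun hBm (g := fun q => ENNReal.ofReal (dV.rep e q)) ?_).trans_le
    (lintegral_mono_set (Set.image_mono fun x hx => ⟨hx.1, hx.2.2⟩))
  rintro _ ⟨x, hx, rfl⟩
  have hx' : x ∈ e.source ∩ e'.source := ⟨hx.1, hx.2.1⟩
  simp only
  rw [det_fderiv_frac hg.1 (hg.2 x hx').1, abs_of_nonneg (by positivity), hfrac x hx.2,
    ← ENNReal.ofReal_mul (by positivity), dV.rep_transition he he' hg hx']

/-- On the domain of a chart, no other chart measure exceeds that of the chart, so the supremum is
attained there. -/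
lemma VolumeForm.measure_restrict (hM : IsLocallyProjectiveFlat n M) (dV : VolumeForm n M)
    (he : e ∈ atlas (Hn n) M) {A : Set M} (hA : A ⊆ e.source) :
    dV.measure.restrict A = (dV.chartMeasure e).restrict A := by
  have hle : ∀ e ∈ atlas (Hn n) M, dV.chartMeasure e ≤ dV.measure := fun e he =>
    le_iSup₂_of_le e he le_rfl
  have hs := e.open_source.measurableSet
  have hsrc : dV.measure.restrict e.source = (dV.chartMeasure e).restrict e.source := by
    refine le_antisymm ?_ (Measure.restrict_mono le_rfl (hle e he))
    -- A supremum of measures is bounded through a majorant. Each chart measure is compared with it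
    -- after splitting a set along `e.source`.
    have h1 : dV.measure ≤ dV.chartMeasure e + dV.measure.restrict e.sourceᶜ := by
      refine iSup₂_le fun e' he' => ?_
      change dV.chartMeasure e' ≤ _
      obtain ⟨g, hg⟩ := hM e he e' he'
      refine Measure.le_iff.2 fun B hB => ?_
      rw [Measure.add_apply, Measure.restrict_apply hB, ← measure_inter_add_sdiff B hs]
      refine add_le_add ?_ (hle e' he' _)
      exact (dV.chartMeasure_le he he' hg (hB.inter hs) Set.inter_subset_right).trans
        (measure_mono Set.inter_subset_left)
    refine (Measure.restrict_mono le_rfl h1).trans ?_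
    rw [Measure.restrict_add, Measure.restrict_restrict hs]
    simp
  rw [← Measure.restrict_restrict_of_subset hA, hsrc, Measure.restrict_restrict_of_subset hA]

end Measure

/-! ### Integrals in a chart -/

section ChartIntegral

open MeasureTheory Filter
open scoped Topology

variable {n : ℕ} {M : Type*} [TopologicalSpace M] [ChartedSpace (Hn n) M]
  [MeasurableSpace M] [BorelSpace M] {e : OpenPartialHomeomorph M (Hn n)}

/-- The density of the measure cancels the denominator of `VolumeForm.ratio`, so the value does not
involve dV. -/
lemma VolumeForm.integrable_and_integral_chart (hM : IsLocallyProjectiveFlat n M)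
    (dV : VolumeForm n M) {Φ : OpenPartialHomeomorph M (Hn n) → Hn n → Gr n}
    (hΦ : IsDensity fun e q => topCoeff (Φ e q)) (he : e ∈ atlas (Hn n) M)
    (hF : ContinuousOn (fun q => topCoeff (Φ e q)) e.target) {K : Set M} (hK : MeasurableSet K)
    (hKe : K ⊆ e.source) :
    (IntegrableOn (fun q => topCoeff (Φ e q)) (e '' K) → dV.FormIntegrableOn Φ K) ∧
      dV.formIntegral Φ K = ∫ q in e '' K, topCoeff (Φ e q) := by
  have hsub : e '' K ⊆ e.target := by
    rintro _ ⟨x, hx, rfl⟩; exact e.map_source (hKe hx)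
  have himg : MeasurableSet (e '' K) := by
    have := measurableSet_image_source_inter e hK
    rwa [Set.inter_eq_right.2 hKe] at this
  have hμ : dV.measure.restrict K = ((volume.restrict (e '' K)).withDensity
      (fun q => ENNReal.ofReal (dV.rep e q))).map e.symm := by
    rw [dV.measure_restrict hM he hKe, dV.chartMeasure_restrict e hK, Set.inter_eq_right.2 hKe]
  set G : M → ℂ := fun x => topCoeff (Φ e (e x)) / (dV.rep e (e x) : ℂ) with hG
  have hGc : ContinuousOn G e.source := by
    refine (hF.comp e.continuousOn fun x hx => e.map_source hx).div
      (Complex.continuous_ofReal.comp_continuousOn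
        ((dV.cont e he).comp e.continuousOn fun x hx => e.map_source hx)) fun x hx => ?_
    exact Complex.ofReal_ne_zero.2 (dV.pos e he _ (e.map_source hx)).ne'
  have hae : dV.ratio Φ =ᵐ[dV.measure.restrict K] G := by
    filter_upwards [ae_restrict_mem hK] with x hx using dV.ratio_eq hM hΦ he (hKe hx)
  have hGm : AEStronglyMeasurable G (((volume.restrict (e '' K)).withDensity
      (fun q => ENNReal.ofReal (dV.rep e q))).map e.symm) := by
    rw [← hμ]
    exact (hGc.mono hKe).aestronglyMeasurable hK
  have hsm : AEMeasurable e.symm ((volume.restrict (e '' K)).withDensity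
      (fun q => ENNReal.ofReal (dV.rep e q))) :=
    ((e.continuousOn_symm.mono hsub).aemeasurable himg).mono_ac
      (withDensity_absolutelyContinuous _ _)
  have hρ : AEMeasurable (fun q => (dV.rep e q).toNNReal) (volume.restrict (e '' K)) :=
    (((dV.cont e he).mono hsub).aemeasurable himg).real_toNNReal
  have hpt : (fun q => (dV.rep e q).toNNReal • (G ∘ e.symm) q)
      =ᵐ[volume.restrict (e '' K)] fun q => topCoeff (Φ e q) := by
    filter_upwards [ae_restrict_mem himg] with q hq
    have hp := dV.pos e he q (hsub hq)
    simp only [hG, Function.comp_apply, e.right_inv (hsub hq), NNReal.smul_def,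
      Real.coe_toNNReal _ hp.le, Complex.real_smul]
    exact mul_div_cancel₀ _ (Complex.ofReal_ne_zero.2 hp.ne')
  constructor
  · intro hint
    refine Integrable.congr ?_ hae.symm
    rw [hμ, integrable_map_measure hGm hsm]
    exact (integrable_withDensity_iff_integrable_smul₀ hρ).2 (hint.congr hpt.symm)
  · rw [VolumeForm.formIntegral, integral_congr_ae hae, hμ, integral_map hsm hGm]
    exact (integral_withDensity_eq_integral_smul₀ hρ (G ∘ e.symm)).trans (integral_congr_ae hpt)

end ChartIntegral

/-! ### The cocycle of the automorphy factors -/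

section Cocycle

open Filter
open scoped Topology

variable {n : ℕ}

lemma transCLM_comp (A B : Matrix (Fin n) (Fin n) ℍ[ℝ]) (c d : ℍ[ℝ]) :
    (transCLM A c).comp (transCLM B d) = transCLM (A * B) (d * c) := by
  refine ContinuousLinearMap.ext fun v => ?_
  ext1 i
  simp only [ContinuousLinearMap.comp_apply, transCLM_apply, ← Matrix.mulVec_mulVec, ← mul_assoc]
  congr 1
  simp only [Matrix.mulVec, dotProduct, Finset.sum_mul, mul_assoc, transCLM_apply]

lemma eq_re_of_forall_commute {s : ℍ[ℝ]} (h : ∀ x, x * s = s * x) : s = (s.re : ℍ[ℝ]) := by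
  obtain ⟨i, hi0, hi1, hi2, hi3⟩ : ∃ i : ℍ[ℝ], i.re = 0 ∧ i.imI = 1 ∧ i.imJ = 0 ∧ i.imK = 0 :=
    ⟨⟨0, 1, 0, 0⟩, rfl, rfl, rfl, rfl⟩
  obtain ⟨j, hj0, hj1, hj2, hj3⟩ : ∃ j : ℍ[ℝ], j.re = 0 ∧ j.imI = 0 ∧ j.imJ = 1 ∧ j.imK = 0 :=
    ⟨⟨0, 0, 1, 0⟩, rfl, rfl, rfl, rfl⟩
  have h1 : (i * s).imK = (s * i).imK := by rw [h]
  have h2 : (i * s).imJ = (s * i).imJ := by rw [h]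
  have h3 : (j * s).imK = (s * j).imK := by rw [h]
  rw [Quaternion.imK_mul, Quaternion.imK_mul, hi0, hi1, hi2, hi3] at h1
  rw [Quaternion.imJ_mul, Quaternion.imJ_mul, hi0, hi1, hi2, hi3] at h2
  rw [Quaternion.imK_mul, Quaternion.imK_mul, hj0, hj1, hj2, hj3] at h3
  refine Quaternion.ext _ _ (Quaternion.re_coe _).symm ?_ ?_ ?_
  · rw [Quaternion.imI_coe]; linarith
  · rw [Quaternion.imJ_coe]; linarith
  · rw [Quaternion.imK_coe]; linarith

/-- A transition map does not determine its matrix g; the differential v ↦ A v a⁻¹ determines A up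
to sign. Equality of determinants gives |a| = |b|, and b⁻¹a turns out to be central, hence real,
hence ±1. Positivity of n provides a nonzero entry of B. -/
lemma eq_or_eq_neg_of_transCLM_eq {A B : Matrix (Fin n) (Fin n) ℍ[ℝ]} {a b : ℍ[ℝ]} (hn : 0 < n)
    (ha : a ≠ 0) (hb : b ≠ 0) (hA : (tau A).det = (((‖a‖ ^ 2)⁻¹ : ℝ) : ℂ))
    (hB : (tau B).det = (((‖b‖ ^ 2)⁻¹ : ℝ) : ℂ)) (h : transCLM A a⁻¹ = transCLM B b⁻¹) :
    ‖a‖ = ‖b‖ ∧ (A = B ∨ A = -B) := by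
  have ha' := norm_ne_zero_iff.2 ha
  have hb' := norm_ne_zero_iff.2 hb
  have hdet : ∀ (X : Matrix (Fin n) (Fin n) ℍ[ℝ]) (x : ℍ[ℝ]), x ≠ 0 →
      (tau X).det = (((‖x‖ ^ 2)⁻¹ : ℝ) : ℂ) → (transCLM X x⁻¹).det = (‖x‖ ^ (4 * n + 4))⁻¹ := by
    intro X x hx hX
    have := norm_ne_zero_iff.2 hx
    rw [det_transCLM, hX, Complex.normSq_ofReal, norm_inv, inv_pow, pow_add]
    field_simp
  have hnorm : ‖a‖ = ‖b‖ := by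
    have h1 := hdet A a ha hA
    rw [h, hdet B b hb hB, inv_inj] at h1
    exact (pow_left_inj₀ (norm_nonneg _) (norm_nonneg _) (by omega)).1 h1.symm
  refine ⟨hnorm, ?_⟩
  -- Taking x = 1 gives A = B s with s = b⁻¹a. Substituting back, s commutes with every x as soon as
  -- some entry of B is nonzero.
  have key : ∀ i j x, A i j * x = B i j * (x * (b⁻¹ * a)) := by
    intro i j x
    have h1 := congrFun (DFunLike.congr_fun h (Pi.single j x)) i
    simp only [transCLM_apply, Matrix.mulVec_single, Pi.smul_apply, MulOpposite.smul_eq_mul_unop,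
      MulOpposite.unop_op, Matrix.col_apply] at h1
    calc A i j * x = A i j * x * a⁻¹ * a := by rw [inv_mul_cancel_right₀ ha]
      _ = _ := by rw [h1]; simp only [mul_assoc]
  have key1 : ∀ i j, A i j = B i j * (b⁻¹ * a) := fun i j => by simpa using key i j 1
  have hB0 : ∃ i j, B i j ≠ 0 := by
    by_contra hcon
    push Not at hcon
    have h0 : tau B = 0 := by
      ext i j
      simp [tau, hcon, tauQ_zero]
    have : Nonempty (Fin (n * 2)) := ⟨⟨0, by omega⟩⟩
    rw [h0, Matrix.det_zero] at hB
    have h2 : (‖b‖ ^ 2)⁻¹ ≠ 0 := by positivity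
    exact h2 (by exact_mod_cast hB.symm)
  obtain ⟨i, j, hij⟩ := hB0
  have hcomm : ∀ x, x * (b⁻¹ * a) = b⁻¹ * a * x := by
    intro x
    have h1 := key i j x
    rw [key1, mul_assoc] at h1
    exact (mul_left_cancel₀ hij h1).symm
  have hre := eq_re_of_forall_commute hcomm
  have hs1 : ‖b⁻¹ * a‖ = 1 := by rw [norm_mul, norm_inv, hnorm, inv_mul_cancel₀ hb']
  have hr : (b⁻¹ * a).re = 1 ∨ (b⁻¹ * a).re = -1 := by
    rw [hre, Quaternion.norm_coe] at hs1
    exact eq_or_eq_neg_of_abs_eq hs1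
  rcases hr with hr | hr
  · left
    ext1 i j
    rw [key1, hre, hr]
    simp
  · right
    ext1 i j
    rw [key1, hre, hr]
    simp

variable {M : Type*} [TopologicalSpace M] {e e' e'' : OpenPartialHomeomorph M (Hn n)}
  {g g₁ g₂ : Matrix (Fin (n + 1)) (Fin (n + 1)) ℍ[ℝ]}

/-- The chain rule and uniqueness of the differential. The sign stays undetermined, which is
harmless for elements of even degree. -/
lemma IsTransition.cocycle (hn : 0 < n) (h₁ : IsTransition g₁ e' e) (h₂ : IsTransition g₂ e'' e)
    (hg : IsTransition g e' e'') {x : M} (hx : x ∈ e.source) (hx' : x ∈ e'.source)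
    (hx'' : x ∈ e''.source) : ‖J1 g₁ (e' x)‖ = ‖J1 g₂ (e'' x)‖ * ‖J1 g (e' x)‖ ∧
      (J2 g₁ (e' x) = J2 g₂ (e'' x) * J2 g (e' x) ∨
        J2 g₁ (e' x) = -(J2 g₂ (e'' x) * J2 g (e' x))) := by
  have d₁ := h₁.hasFDerivAt ⟨hx', hx⟩
  have d₂ := h₂.hasFDerivAt ⟨hx'', hx⟩
  have d := hg.hasFDerivAt ⟨hx', hx''⟩
  have j₁ := (h₁.2 x ⟨hx', hx⟩).1
  have j₂ := (h₂.2 x ⟨hx'', hx⟩).1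
  have j := (hg.2 x ⟨hx', hx''⟩).1
  have hcomp : HasFDerivAt (fun q => e (e'.symm q))
      ((transCLM (J2 g₂ (e'' x)) (J1 g₂ (e'' x))⁻¹).comp
        (transCLM (J2 g (e' x)) (J1 g (e' x))⁻¹)) (e' x) := by
    have d₂' : HasFDerivAt (fun q => e (e''.symm q))
        (transCLM (J2 g₂ (e'' x)) (J1 g₂ (e'' x))⁻¹) (e'' (e'.symm (e' x))) := by
      rwa [e'.left_inv hx']
    refine (d₂'.comp (e' x) d).congr_of_eventuallyEq ?_
    filter_upwards [hg.eventually ⟨hx', hx''⟩] with q hq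
    simp only [Function.comp_apply, e''.left_inv hq.1.2]
  have heq := d₁.unique hcomp
  rw [transCLM_comp, ← mul_inv_rev] at heq
  have hdet : (tau (J2 g₂ (e'' x) * J2 g (e' x))).det =
      (((‖J1 g₂ (e'' x) * J1 g (e' x)‖ ^ 2)⁻¹ : ℝ) : ℂ) := by
    rw [tau_mul, Matrix.det_mul, det_tau_J2 h₂.1 j₂, det_tau_J2 hg.1 j, norm_mul, mul_pow, mul_inv,
      Complex.ofReal_mul]
  have := eq_or_eq_neg_of_transCLM_eq hn j₁ (mul_ne_zero j₂ j) (det_tau_J2 h₁.1 j₁) hdet heq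
  rwa [norm_mul] at this

lemma IsTransition.self (hn : 0 < n) (h : IsTransition g e e) {x : M} (hx : x ∈ e.source) :
    ‖J1 g (e x)‖ = 1 ∧ (J2 g (e x) = 1 ∨ J2 g (e x) = -1) := by
  have d := h.hasFDerivAt ⟨hx, hx⟩
  have j := (h.2 x ⟨hx, hx⟩).1
  have hid : HasFDerivAt (fun q => e (e.symm q)) (ContinuousLinearMap.id ℝ (Hn n)) (e x) :=
    (hasFDerivAt_id _).congr_of_eventuallyEq ((h.eventually ⟨hx, hx⟩).mono fun q hq => hq.2.1)
  have h1 : transCLM (1 : Matrix (Fin n) (Fin n) ℍ[ℝ]) (1 : ℍ[ℝ])⁻¹ =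
      ContinuousLinearMap.id ℝ (Hn n) := by
    refine ContinuousLinearMap.ext fun v => ?_
    ext1 i
    simp
  have := eq_or_eq_neg_of_transCLM_eq hn j one_ne_zero (det_tau_J2 h.1 j)
    (by simp [tau_one]) ((d.unique hid).trans h1.symm)
  simpa using this

variable [ChartedSpace (Hn n) M]

lemma LineSection.baston_glue {u : LineSection n M} (hu : u.IsC2) (he : e ∈ atlas (Hn n) M)
    (he' : e' ∈ atlas (Hn n) M) (hg : IsTransition g e e') {x : M}
    (hx : x ∈ e.source ∩ e'.source) : baston (u.rep e) (e x) =
      (((‖J1 g (e x)‖ ^ 4)⁻¹ : ℝ) : ℂ) •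
        grActHom (tau (J2 g (e x))).transpose (baston (u.rep e') (e' x)) := by
  obtain ⟨hJ, hf⟩ := hg.2 x hx
  have hu' : ContDiffAt ℝ 2 (u.rep e') (frac g (e x)) := by
    rw [← hf]
    exact (hu e' he').contDiffAt (e'.open_target.mem_nhds (e'.map_source hx.2))
  rw [hf]
  refine baston_transform hJ hu'
    ((hu e he).contDiffAt (e.open_target.mem_nhds (e.map_source hx.1))) ?_
  filter_upwards [hg.eventually hx] with q hq
  have h1 := u.glue e he e' he' g hg _ hq.1
  rwa [hq.2.1, hq.2.2.2] at h1

lemma LineSection.baston_mem {u : LineSection n M} (hu : u.IsC2) (he : e ∈ atlas (Hn n) M)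
    {q : Hn n} (hq : q ∈ e.target) : baston (u.rep e) q ∈ ⋀[ℂ]^2 (Fin (n * 2) → ℂ) := by
  rw [baston_eq_Lam ((hu e he).contDiffAt (e.open_target.mem_nhds hq))]
  exact Lam_mem _

end Cocycle

/-! ### Strongly positive test forms supported in a chart -/

section TestForm

open Filter
open scoped Topology

variable {n p : ℕ}

/-- The pull back of `ω̃^β` as a linear function of the row vector. -/
def pullFormL (n : ℕ) (β : Fin 2) : Hn n →L[ℝ] Gr n :=
  LinearMap.toContinuousLinearMap
    { toFun := fun η => pullForm η β
      map_add' := fun η ξ => pullForm_add η ξ β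
      map_smul' := fun r η => pullForm_smul r η β }

lemma contDiff_elemForm : ContDiff ℝ ω (elemForm : (Fin n → ℍ[ℝ]) → Gr n) :=
  (pullFormL n 0).contDiff.mul (pullFormL n 1).contDiff

lemma contDiffAt_list_prod {k : WithTop ℕ∞} {f : Fin p → Hn n → Gr n} {q : Hn n}
    (hf : ∀ j, ContDiffAt ℝ k (f j) q) :
    ContDiffAt ℝ k (fun q => (List.ofFn fun j => f j q).prod) q := by
  induction p with
  | zero => simpa using contDiffAt_const
  | succ p ih =>
    simp only [List.ofFn_succ, List.prod_cons]
    exact (hf 0).mul (ih fun j => hf j.succ)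

/-- The pull back of `χ ξ₁^* ω̃⁰ ∧ ξ₁^* ω̃¹ ∧ ⋯` by the fractional linear transformation of `g`. -/
def pullTest (w : ℕ) (χ : Hn n → ℝ) (ξ : Fin p → Fin n → ℍ[ℝ])
    (g : Matrix (Fin (n + 1)) (Fin (n + 1)) ℍ[ℝ]) (q : Hn n) : Gr n :=
  (((‖J1 g q‖ ^ (2 * w))⁻¹ * χ (frac g q) : ℝ) : ℂ) •
    (List.ofFn fun j => elemForm (Matrix.vecMul (ξ j) (J2 g q))).prod

lemma contDiffAt_J2 {g : Matrix (Fin (n + 1)) (Fin (n + 1)) ℍ[ℝ]} {q : Hn n} (h : J1 g q ≠ 0)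
    (i j : Fin n) : ContDiffAt ℝ ω (fun q => J2 g q i j) q :=
  contDiffAt_const.sub (((contDiff_numer g i).contDiffAt.mul (contDiffAt_J1_inv h)).mul
    contDiffAt_const)

lemma contDiffAt_pullTest (w : ℕ) {χ : Hn n → ℝ} (hχ : ContDiff ℝ ∞ χ)
    (ξ : Fin p → Fin n → ℍ[ℝ]) {g : Matrix (Fin (n + 1)) (Fin (n + 1)) ℍ[ℝ]} {q : Hn n}
    (h : J1 g q ≠ 0) : ContDiffAt ℝ ∞ (pullTest w χ ξ g) q := by
  have h1 : ContDiffAt ℝ ∞ (fun q => (‖J1 g q‖ ^ (2 * w))⁻¹ * χ (frac g q)) q := by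
    refine ContDiffAt.mul (ContDiffAt.inv ?_ (pow_ne_zero _ (norm_ne_zero_iff.2 h)))
      (hχ.contDiffAt.comp q ((contDiffAt_frac h).of_le le_top))
    simp only [pow_mul]
    exact ((((contDiff_J1 g).norm_sq ℝ).contDiffAt).of_le le_top).pow w
  have h2 : ContDiffAt ℝ ∞ (fun q =>
      (List.ofFn fun j => elemForm (Matrix.vecMul (ξ j) (J2 g q))).prod) q := by
    refine contDiffAt_list_prod fun j => contDiff_elemForm.contDiffAt.of_le le_top |>.comp q ?_
    refine contDiffAt_pi.2 fun i => ?_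
    simp only [Matrix.vecMul, dotProduct]
    exact ContDiffAt.sum fun l _ => contDiffAt_const.mul ((contDiffAt_J2 h l i).of_le le_top)
  exact h1.smul h2

/-- Absorbs the sign ambiguity of `IsTransition.cocycle` and `IsTransition.self`. -/
lemma elemForm_neg (η : Fin n → ℍ[ℝ]) : elemForm (-η) = elemForm η := by
  have := elemForm_smul (-1) η
  simpa using this

lemma grActHom_list_prod (A : Matrix (Fin n) (Fin n) ℍ[ℝ]) (ξ : Fin p → Fin n → ℍ[ℝ]) :
    grActHom (tau A).transpose (List.ofFn fun j => elemForm (ξ j)).prod =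
      (List.ofFn fun j => elemForm (Matrix.vecMul (ξ j) A)).prod := by
  rw [map_list_prod, List.map_ofFn]
  congr 2
  funext j
  exact grActHom_elemForm A (ξ j)

/-- Invertibility over the quaternions is read off from τ: if v A = 0, then τ(v) τ(A) = 0, and τ is
injective. -/
lemma linearIndependent_vecMul {A : Matrix (Fin n) (Fin n) ℍ[ℝ]} (hA : (tau A).det ≠ 0)
    {ξ : Fin p → Fin n → ℍ[ℝ]} (hξ : LinearIndependent ℍ[ℝ] ξ) :
    LinearIndependent ℍ[ℝ] fun j => Matrix.vecMul (ξ j) A := by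
  set L : (Fin n → ℍ[ℝ]) →ₗ[ℍ[ℝ]] (Fin n → ℍ[ℝ]) :=
    { toFun := fun v => Matrix.vecMul v A
      map_add' := fun v w => Matrix.add_vecMul A v w
      map_smul' := fun c v => Matrix.smul_vecMul c v A } with hL
  refine hξ.map' L (LinearMap.ker_eq_bot'.2 fun v hv => ?_)
  have h1 : (Matrix.of fun _ : Fin 1 => v) * A = 0 := by
    ext1 i j
    exact congrFun hv j
  have h2 : tau (Matrix.of fun _ : Fin 1 => v) * tau A = 0 := by
    rw [← tau_mul, h1]
    ext i j
    simp [tau, tauQ_zero]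
  have h3 : tau (Matrix.of fun _ : Fin 1 => v) = 0 := by
    rw [← Matrix.mul_one (tau _), ← Matrix.mul_nonsing_inv (tau A) (isUnit_iff_ne_zero.2 hA),
      ← Matrix.mul_assoc, h2, Matrix.zero_mul]
  have h4 : (Matrix.of fun _ : Fin 1 => v) = 0 := tau_inj (h3.trans (by
    ext i j
    simp [tau, tauQ_zero]))
  exact congrFun h4 0

variable {M : Type*} [TopologicalSpace M] {e e' e'' : OpenPartialHomeomorph M (Hn n)}
  {g g₁ g₂ : Matrix (Fin (n + 1)) (Fin (n + 1)) ℍ[ℝ]}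

lemma pullTest_glue (hn : 0 < n) (w : ℕ) (χ : Hn n → ℝ) (ξ : Fin p → Fin n → ℍ[ℝ])
    (h₁ : IsTransition g₁ e' e) (h₂ : IsTransition g₂ e'' e) (hg : IsTransition g e' e'') {x : M}
    (hx : x ∈ e.source) (hx' : x ∈ e'.source) (hx'' : x ∈ e''.source) :
    pullTest w χ ξ g₁ (e' x) = (((‖J1 g (e' x)‖ ^ (2 * w))⁻¹ : ℝ) : ℂ) •
      grAct (tau (J2 g (e' x))).transpose (pullTest w χ ξ g₂ (e'' x)) := by
  obtain ⟨hJ, hA⟩ := h₁.cocycle hn h₂ hg hx hx' hx''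
  have hrow : ∀ j, elemForm (Matrix.vecMul (ξ j) (J2 g₁ (e' x))) =
      elemForm (Matrix.vecMul (Matrix.vecMul (ξ j) (J2 g₂ (e'' x))) (J2 g (e' x))) := by
    intro j
    rw [Matrix.vecMul_vecMul]
    rcases hA with hA | hA
    · rw [hA]
    · rw [hA, Matrix.vecMul_neg, elemForm_neg]
  rw [grAct_eq, pullTest, pullTest, map_smul, grActHom_list_prod, smul_smul, ← Complex.ofReal_mul,
    ← (h₁.2 x ⟨hx', hx⟩).2, ← (h₂.2 x ⟨hx'', hx⟩).2, hJ]
  simp only [hrow]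
  rw [mul_pow, mul_inv, mul_comm (‖J1 g₂ (e'' x)‖ ^ (2 * w))⁻¹, mul_assoc]

/-- A matrix representing the identity transition need not be the identity, but it has |J₁| = 1 and
J₂ = ±1. -/
lemma pullTest_self (hn : 0 < n) (w : ℕ) (χ : Hn n → ℝ) (ξ : Fin p → Fin n → ℍ[ℝ])
    (h : IsTransition g e e) {x : M} (hx : x ∈ e.source) :
    pullTest w χ ξ g (e x) = ((χ (e x) : ℝ) : ℂ) • (List.ofFn fun j => elemForm (ξ j)).prod := by
  obtain ⟨hJ, hA⟩ := h.self hn hx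
  have hrow : ∀ j, elemForm (Matrix.vecMul (ξ j) (J2 g (e x))) = elemForm (ξ j) := by
    intro j
    rcases hA with hA | hA
    · rw [hA, Matrix.vecMul_one]
    · rw [hA, Matrix.vecMul_neg, Matrix.vecMul_one, elemForm_neg]
  rw [pullTest, hJ, ← (h.2 x ⟨hx, hx⟩).2]
  simp only [hrow, one_pow, inv_one, one_mul]

variable [ChartedSpace (Hn n) M]

/-- A transition matrix between two charts. -/
def transMatrix (e' e : OpenPartialHomeomorph M (Hn n)) :
    Matrix (Fin (n + 1)) (Fin (n + 1)) ℍ[ℝ] :=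
  Classical.epsilon fun g => IsTransition g e' e

lemma isTransition_transMatrix (hM : IsLocallyProjectiveFlat n M) (he' : e' ∈ atlas (Hn n) M)
    (he : e ∈ atlas (Hn n) M) : IsTransition (transMatrix e' e) e' e :=
  Classical.epsilon_spec (hM e' he' e he)

open Classical in
/-- The section of `⋀^{2p} E^*[-w]` which is `χ ξ₁^* ω̃⁰ ∧ ξ₁^* ω̃¹ ∧ ⋯` in the chart `e` and
vanishes outside its domain. -/
def testSection (hM : IsLocallyProjectiveFlat n M) (hn : 0 < n) (he : e ∈ atlas (Hn n) M)
    (w : ℕ) (χ : Hn n → ℝ) (ξ : Fin p → Fin n → ℍ[ℝ]) : FormSection n M (2 * p) w where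
  rep e' q := if e'.symm q ∈ e.source then pullTest w χ ξ (transMatrix e' e) q else 0
  mem e' he' x hx := by
    split_ifs with h
    · exact Submodule.smul_mem _ _ (list_prod_mem _ fun j => elemForm_mem _)
    · exact Submodule.zero_mem _
  glue e' he' e'' he'' g hg x hx := by
    rw [e'.left_inv hx.1, e''.left_inv hx.2]
    split_ifs with h
    · exact pullTest_glue hn w χ ξ (isTransition_transMatrix hM he' he)
        (isTransition_transMatrix hM he'' he) hg h hx.1 hx.2
    · rw [grAct_eq, map_zero, smul_zero]

variable (hM : IsLocallyProjectiveFlat n M) (hn : 0 < n) (he : e ∈ atlas (Hn n) M)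
  (w : ℕ) {χ : Hn n → ℝ} (ξ : Fin p → Fin n → ℍ[ℝ])

lemma testSection_rep_self {q : Hn n} (hq : q ∈ e.target) :
    (testSection hM hn he w χ ξ).rep e q =
      ((χ q : ℝ) : ℂ) • (List.ofFn fun j => elemForm (ξ j)).prod := by
  have h := pullTest_self hn w χ ξ (isTransition_transMatrix hM he he) (e.map_target hq)
  rw [e.right_inv hq] at h
  exact (if_pos (e.map_target hq)).trans h

lemma testSection_rep_eq_zero (he' : e' ∈ atlas (Hn n) M) {x : M} (hx : x ∈ e'.source)
    (h : x ∈ e.source → χ (e x) = 0) : (testSection hM hn he w χ ξ).rep e' (e' x) = 0 := by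
  by_cases hxe : x ∈ e.source
  swap
  · exact if_neg (by rwa [e'.left_inv hx])
  refine (if_pos (by rwa [e'.left_inv hx])).trans ?_
  rw [pullTest, ← ((isTransition_transMatrix hM he' he).2 x ⟨hx, hxe⟩).2, h hxe]
  simp

/-- The preimage of the support in M is compact, hence closed as M is Hausdorff; the extension by
zero is therefore smooth across the boundary of the chart domain. -/
lemma testSection_isTest [T2Space M] (hχ : ContDiff ℝ ∞ χ) (hc : HasCompactSupport χ)
    (hs : tsupport χ ⊆ e.target) : (testSection hM hn he w χ ξ).IsTest := by
  have hK : IsCompact (e.symm '' tsupport χ) :=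
    hc.isCompact.image_of_continuousOn (e.continuousOn_symm.mono hs)
  have hz : ∀ x ∉ e.symm '' tsupport χ, x ∈ e.source → χ (e x) = 0 := fun x hx hxe =>
    image_eq_zero_of_notMem_tsupport fun h => hx ⟨_, h, e.left_inv hxe⟩
  refine ⟨fun e' he' => contDiffOn_gr_iff.1 fun q hq => ContDiffAt.contDiffWithinAt ?_,
    _, hK, fun e' he' x hx hxK => testSection_rep_eq_zero hM hn he w ξ he' hx (hz x hxK)⟩
  have htr := isTransition_transMatrix hM he' he
  obtain ⟨x, hx, rfl⟩ : ∃ x ∈ e'.source, e' x = q :=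
    ⟨e'.symm q, e'.map_target hq, e'.right_inv hq⟩
  by_cases hxe : x ∈ e.source
  · refine (contDiffAt_pullTest w hχ ξ (htr.2 x ⟨hx, hxe⟩).1).congr_of_eventuallyEq ?_
    filter_upwards [htr.eventually ⟨hx, hxe⟩] with q hq using if_pos hq.1.2
  · refine (contDiffAt_const (c := (0 : Gr n))).congr_of_eventuallyEq ?_
    have hxK : x ∈ (e.symm '' tsupport χ)ᶜ := by
      rintro ⟨y, hy, rfl⟩
      exact hxe (e.map_target (hs hy))
    filter_upwards [(e'.tendsto_symm hx).eventually (hK.isClosed.isOpen_compl.mem_nhds hxK),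
      e'.open_target.mem_nhds (e'.map_source hx)] with q h1 h2
    have := testSection_rep_eq_zero hM hn he w ξ he' (e'.map_target h2) (hz _ h1)
    rwa [e'.right_inv h2] at this

lemma testSection_isStronglyPositive (hχ : ∀ q, 0 ≤ χ q) (hξ : LinearIndependent ℍ[ℝ] ξ) :
    (testSection hM hn he w χ ξ).IsStronglyPositive := by
  intro e' he' x hx
  by_cases hxe : x ∈ e.source
  · have htr := isTransition_transMatrix hM he' he
    have hJ := (htr.2 x ⟨hx, hxe⟩).1
    have hrep : (testSection hM hn he w χ ξ).rep e' (e' x) =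
        pullTest w χ ξ (transMatrix e' e) (e' x) := if_pos (by rwa [e'.left_inv hx])
    rw [hrep]
    have hc : 0 ≤ (‖J1 (transMatrix e' e) (e' x)‖ ^ (2 * w))⁻¹ *
        χ (frac (transMatrix e' e) (e' x)) := mul_nonneg (by positivity) (hχ _)
    refine Submodule.smul_mem (stronglyPositiveCone n p) (⟨_, hc⟩ : ℝ≥0)
      (Submodule.subset_span ⟨_, linearIndependent_vecMul ?_ hξ, rfl⟩)
    rw [det_tau_J2 htr.1 hJ]
    have := norm_ne_zero_iff.2 hJ
    exact Complex.ofReal_ne_zero.2 (by positivity)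
  · rw [testSection_rep_eq_zero hM hn he w ξ he' hx fun h => absurd h hxe]
    exact Submodule.zero_mem _

end TestForm

/-! ### Plurisubharmonic sections have nonnegative trace on quaternionic lines -/

section Positivity

open MeasureTheory Filter
open scoped Topology

lemma continuousOn_fderiv_fderiv_apply {V : Type*} [NormedAddCommGroup V] [NormedSpace ℝ V]
    {u : V → ℝ} {U : Set V} (hU : IsOpen U) (hu : ContDiffOn ℝ 2 u U) (a b : V) :
    ContinuousOn (fun q => fderiv ℝ (fderiv ℝ u) q a b) U :=
  (((hu.fderiv_of_isOpen hU (m := 1) (by norm_num)).continuousOn_fderiv_of_isOpen hU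
    (by norm_num)).clm_apply continuousOn_const).clm_apply continuousOn_const

variable {n p : ℕ}

lemma continuousOn_lineAvg {u : Hn n → ℝ} {U : Set (Hn n)} (hU : IsOpen U)
    (hu : ContDiffOn ℝ 2 u U) (v : Hn n) :
    ContinuousOn (fun q => lineAvg (fderiv ℝ (fderiv ℝ u) q) v v) U := by
  simp only [lineAvg_apply]
  exact continuousOn_finsetSum _ fun m _ => continuousOn_fderiv_fderiv_apply hU hu _ _

lemma continuous_topCoeff : Continuous (topCoeff : Gr n → ℂ) := (coeffLR Finset.univ).continuous

variable {M : Type*} [TopologicalSpace M] [ChartedSpace (Hn n) M]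
  {e : OpenPartialHomeomorph M (Hn n)}

/-- With p + 1 = n the exponents add up: 4 + 2(2p + 1) = 4n + 2. -/
lemma isDensity_baston_mul {u : LineSection n M} (hu : u.IsC2) (hp : p + 1 = n)
    (η : FormSection n M (2 * p) (2 * p + 1)) :
    IsDensity fun e q => topCoeff (baston (u.rep e) q * η.rep e q) := by
  refine isDensity_topCoeff (Φ := fun e q => baston (u.rep e) q * η.rep e q)
    (fun e he x hx => ?_) fun e he e' he' g hg x hx => ?_
  · have := SetLike.mul_mem_graded (A := fun i : ℕ => ⋀[ℂ]^i (Fin (n * 2) → ℂ))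
      (LineSection.baston_mem hu he (e.map_source hx)) (η.mem e he x hx)
    rwa [show 2 + 2 * p = 2 * n by omega] at this
  · rw [LineSection.baston_glue hu he he' hg hx, η.glue e he e' he' g hg x hx, grAct_eq,
      smul_mul_smul_comm, ← map_mul, ← Complex.ofReal_mul, ← mul_inv, ← pow_add,
      show 4 + 2 * (2 * p + 1) = 4 * n + 2 by omega]

variable [T2Space M] [MeasurableSpace M] [BorelSpace M]

/-- Positivity of the current on `testSection`, rewritten as a Lebesgue integral in the chart. -/
lemma LineSection.integral_nonneg_of_isPSH (hM : IsLocallyProjectiveFlat n M)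
    {dV : VolumeForm n M} {u : LineSection n M} (hu : u.IsC2) (hpsh : u.IsPSH dV)
    (he : e ∈ atlas (Hn n) M) (hp : p + 1 = n) {ξ : Fin p → Fin n → ℍ[ℝ]}
    (hξ : LinearIndependent ℍ[ℝ] ξ) {χ : Hn n → ℝ} (hχ : ContDiff ℝ ∞ χ)
    (hc : HasCompactSupport χ) (hs : tsupport χ ⊆ e.target) (hχ0 : ∀ q, 0 ≤ χ q) :
    0 ≤ ∫ q in tsupport χ, (χ q : ℂ) *
      topCoeff (baston (u.rep e) q * (List.ofFn fun j => elemForm (ξ j)).prod) := by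
  have hn : 0 < n := by omega
  set η := testSection hM hn he (2 * p + 1) χ ξ with hη
  have hT : η.IsTest := testSection_isTest hM hn he _ ξ hχ hc hs
  have h0 := hpsh.2 p hp η hT (testSection_isStronglyPositive hM hn he _ ξ hχ0 hξ)
  set K : Set M := e.symm '' tsupport χ with hK
  have hKc : IsCompact K := hc.isCompact.image_of_continuousOn (e.continuousOn_symm.mono hs)
  have hKe : K ⊆ e.source := by
    rintro _ ⟨q, hq, rfl⟩; exact e.map_target (hs hq)
  have himg : e '' K = tsupport χ := by
    rw [hK, Set.image_image]
    exact (Set.image_congr fun q hq => e.right_inv (hs hq)).trans (Set.image_id' _)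
  have hcont : ContinuousOn (fun q => topCoeff (baston (u.rep e) q * η.rep e q)) e.target :=
    continuous_topCoeff.comp_continuousOn ((continuousOn_baston e.open_target (hu e he)).mul
      (contDiffOn_gr_iff.2 (hT.1 e he)).continuousOn)
  have h1 : u.bastonCurrent dV η.rep =
      dV.formIntegral (fun e q => baston (u.rep e) q * η.rep e q) K := by
    rw [LineSection.bastonCurrent, VolumeForm.formIntegral, setIntegral_univ]
    refine (setIntegral_eq_integral_of_forall_compl_eq_zero fun x hx => ?_).symm
    have : η.rep (chartAt (Hn n) x) (chartAt (Hn n) x x) = 0 :=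
      testSection_rep_eq_zero hM hn he _ ξ (chart_mem_atlas _ x) (mem_chart_source _ x)
        fun hxe => image_eq_zero_of_notMem_tsupport fun h => hx ⟨_, h, e.left_inv hxe⟩
    simp only [VolumeForm.ratio, this, mul_zero]
    rw [← topL_apply, map_zero, zero_div]
  rw [h1, (dV.integrable_and_integral_chart hM (isDensity_baston_mul hu hp η) he hcont
    hKc.measurableSet hKe).2, himg] at h0
  refine h0.trans_eq (setIntegral_congr_fun (isClosed_tsupport χ).measurableSet fun q hq => ?_)
  rw [hη, testSection_rep_self hM hn he _ ξ (hs hq), mul_smul_comm, ← topL_apply, map_smul,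
    topL_apply, smul_eq_mul]

/-- If the trace on the line through v were negative at q, it would be negative nearby. A bump
supported there, times the elementary element of the rows annihilating v, would give the current a
negative value. -/
lemma LineSection.linePSD_of_isPSH (hM : IsLocallyProjectiveFlat n M) (hn : 0 < n)
    {dV : VolumeForm n M} {u : LineSection n M} (hu : u.IsC2) (hpsh : u.IsPSH dV)
    (he : e ∈ atlas (Hn n) M) {q : Hn n} (hq : q ∈ e.target) :
    LinePSD (fderiv ℝ (fderiv ℝ (u.rep e)) q) := by
  obtain ⟨p, rfl⟩ : ∃ p, n = p + 1 := ⟨n - 1, by omega⟩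
  have hat : ∀ q ∈ e.target, ContDiffAt ℝ 2 (u.rep e) q := fun q hq =>
    (hu e he).contDiffAt (e.open_target.mem_nhds hq)
  have hgen : ∀ v : Hn (p + 1), v 0 ≠ 0 → 0 ≤ lineAvg (fderiv ℝ (fderiv ℝ (u.rep e)) q) v v := by
    intro v hv
    by_contra hneg
    push Not at hneg
    set h : Hn (p + 1) → ℝ := fun q => 1 / 4 * (‖v 0‖ ^ 2)⁻¹ *
      lineAvg (fderiv ℝ (fderiv ℝ (u.rep e)) q) v v with hh
    have hv' : 0 < 1 / 4 * (‖v 0‖ ^ 2)⁻¹ := by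
      have := norm_pos_iff.2 hv
      positivity
    have hcont : ContinuousOn h e.target :=
      continuousOn_const.mul (continuousOn_lineAvg e.open_target (hu e he) v)
    have hhq : h q < 0 := mul_neg_of_pos_of_neg hv' hneg
    have hO : IsOpen (e.target ∩ h ⁻¹' Set.Iio 0) :=
      hcont.isOpen_inter_preimage e.open_target isOpen_Iio
    obtain ⟨χ, hχ, hc, hs, hχ0, hχ1⟩ := exists_cutoff hO (isCompact_singleton (x := q))
      (Set.singleton_subset_iff.2 ⟨hq, hhq⟩)
    have hs' : tsupport χ ⊆ e.target := hs.trans Set.inter_subset_left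
    have h0 := u.integral_nonneg_of_isPSH hM hu hpsh he rfl (linearIndependent_annihRow v) hχ hc
      hs' hχ0
    have h1 : ∫ q in tsupport χ, (χ q : ℂ) * topCoeff (baston (u.rep e) q *
        (List.ofFn fun j => elemForm (annihRow v j)).prod) =
        ((∫ q, χ q * h q : ℝ) : ℂ) := by
      have e1 : ∫ q, χ q * h q = ∫ q in tsupport χ, χ q * h q :=
        (setIntegral_eq_integral_of_forall_compl_eq_zero fun q hq => by
          rw [image_eq_zero_of_notMem_tsupport hq, zero_mul]).symm
      rw [e1, ← integral_complex_ofReal]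
      refine setIntegral_congr_fun (isClosed_tsupport χ).measurableSet fun q hq => ?_
      rw [baston_eq_Lam (hat q (hs' hq)), topCoeff_Lam_mul_annihRow v hv
        (fderiv_fderiv_symm (hat q (hs' hq)))]
      push_cast [hh]
      rfl
    rw [h1, Complex.zero_le_real] at h0
    have hz : ∀ q ∉ tsupport χ, -(χ q * h q) = 0 := fun q hq => by
      rw [image_eq_zero_of_notMem_tsupport hq, zero_mul, neg_zero]
    have hcc : Continuous fun q => -(χ q * h q) :=
      continuous_of_zero_off e.open_target (isClosed_tsupport χ) hs'
        (hχ.continuous.continuousOn.mul hcont).neg hz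
    have hpos := hcc.integral_pos_of_hasCompactSupport_nonneg_nonzero (μ := volume)
      (HasCompactSupport.intro hc hz) (fun x => by
        by_cases hx : x ∈ tsupport χ
        · have := (hs hx).2
          exact neg_nonneg.2 (mul_nonpos_of_nonneg_of_nonpos (hχ0 x) (le_of_lt this))
        · exact (hz x hx).ge) (x := q) (by
        rw [hχ1 q rfl, one_mul]
        exact neg_ne_zero.2 hhq.ne)
    rw [integral_neg] at hpos
    linarith
  intro v
  by_cases hv : v 0 = 0
  -- The annihilating rows require v₀ ≠ 0; the remaining vectors are limits of such.
  · set B := lineAvg (fderiv ℝ (fderiv ℝ (u.rep e)) q)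
    set w : Hn (p + 1) := Pi.single 0 1 with hw
    have hc : Continuous fun t : ℝ => B (v + t • w) (v + t • w) := by
      simp only [map_add, map_smul, add_apply, smul_apply]
      fun_prop
    have hlim : Tendsto (fun t : ℝ => B (v + t • w) (v + t • w))
        (𝓝[>] 0) (𝓝 (B v v)) := by
      have := hc.tendsto 0
      simp only [zero_smul, add_zero] at this
      exact tendsto_nhdsWithin_of_tendsto_nhds this
    refine ge_of_tendsto hlim ?_
    filter_upwards [self_mem_nhdsWithin] with t ht
    refine hgen _ ?_
    simpa [hv, hw] using (ne_of_gt ht)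
  · exact hgen v hv

end Positivity

/-! ### The estimate on manifolds -/

section Global

open MeasureTheory Filter
open scoped Topology

variable {n : ℕ} {M : Type*} [TopologicalSpace M] [ChartedSpace (Hn n) M]
  {e : OpenPartialHomeomorph M (Hn n)}

lemma list_prod_smul {p : ℕ} (c : ℂ) (f : Fin p → Gr n) :
    (List.ofFn fun i => c • f i).prod = c ^ p • (List.ofFn f).prod := by
  induction p with
  | zero => simp
  | succ p ih =>
    rw [List.ofFn_succ, List.ofFn_succ, List.prod_cons, List.prod_cons, ih fun i => f i.succ,
      smul_mul_smul_comm, pow_succ']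

/-- The factor u₀ contributes exponent 2 and each of the n Baston forms 4, in total 4n + 2. -/
lemma isDensity_monge {u : Fin (n + 1) → LineSection n M} (hu : ∀ i, (u i).IsC2) :
    IsDensity fun e q => topCoeff (monge u e q) := by
  refine isDensity_topCoeff (fun e he x hx => ?_) fun e he e' he' g hg x hx => ?_
  · exact Submodule.smul_mem _ _ (list_prod_mem _ fun i =>
      LineSection.baston_mem (hu i.succ) he (e.map_source hx))
  · have h1 : ∀ i : Fin n, baston ((u i.succ).rep e) (e x) = (((‖J1 g (e x)‖ ^ 4)⁻¹ : ℝ) : ℂ) •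
        grActHom (tau (J2 g (e x))).transpose (baston ((u i.succ).rep e') (e' x)) := fun i =>
      LineSection.baston_glue (hu i.succ) he he' hg hx
    rw [monge, monge]
    simp only [h1]
    rw [list_prod_smul, map_smul, map_list_prod, List.map_ofFn, (u 0).glue e he e' he' g hg x hx,
      smul_smul, smul_smul, ← Complex.ofReal_pow, ← Complex.ofReal_mul, ← Complex.ofReal_mul]
    congr 2
    rw [inv_pow, ← pow_mul, pow_add, mul_inv]
    ring

lemma topRe_prod_baston_nonneg {U : Set (Hn n)} (hU : IsOpen U) {u : Fin n → Hn n → ℝ}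
    (hu : ∀ i, ContDiffOn ℝ 2 (u i) U)
    (hpsd : ∀ i, ∀ q ∈ U, LinePSD (fderiv ℝ (fderiv ℝ (u i)) q)) {q : Hn n} (hq : q ∈ U) :
    0 ≤ topCoeff (List.ofFn fun i => baston (u i) q).prod := by
  refine topCoeff_list_prod_nonneg _ (fun w hw => ?_) (by simp)
  obtain ⟨i, rfl⟩ := (List.mem_ofFn' _ _).1 hw
  exact isPos2_baston ((hu i).contDiffAt (hU.mem_nhds hq)) (hpsd i q hq)

lemma topCoeff_monge {u : Fin (n + 1) → LineSection n M} (hu : ∀ i, (u i).IsC2)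
    (he : e ∈ atlas (Hn n) M)
    (hpsd : ∀ i, ∀ q ∈ e.target, LinePSD (fderiv ℝ (fderiv ℝ ((u i).rep e)) q)) {q : Hn n}
    (hq : q ∈ e.target) : topCoeff (monge u e q) = ((-(u 0).rep e q *
      topRe n (List.ofFn fun i : Fin n => baston ((u i.succ).rep e) q).prod : ℝ) : ℂ) := by
  have h := topRe_prod_baston_nonneg e.open_target (fun i : Fin n => hu i.succ e he)
    (fun i => hpsd i.succ) hq
  have h2 := Complex.eq_re_of_ofReal_le (r := 0) (by simpa using h)
  rw [monge, ← topL_apply, map_smul, topL_apply, h2, Complex.ofReal_mul, smul_eq_mul]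
  rfl

lemma LineSection.weight_mul_abs_le (hM : IsLocallyProjectiveFlat n M) (h : LineMetric n M)
    (u : LineSection n M) (he : e ∈ atlas (Hn n) M) {q : Hn n} (hq : q ∈ e.target) :
    ENNReal.ofReal (h.weight e q * |u.rep e q|) ≤ u.supNorm h := by
  obtain ⟨x, hx, rfl⟩ : ∃ x ∈ e.source, e x = q := ⟨e.symm q, e.map_target hq, e.right_inv hq⟩
  obtain ⟨g, hg⟩ := hM e he (chartAt (Hn n) x) (chart_mem_atlas _ x)
  have hx' : x ∈ e.source ∩ (chartAt (Hn n) x).source := ⟨hx, mem_chart_source _ x⟩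
  have hJ := norm_ne_zero_iff.2 (hg.2 x hx').1
  refine le_of_eq_of_le (congrArg ENNReal.ofReal ?_) (le_iSup (fun x : M => ENNReal.ofReal
    (h.weight (chartAt (Hn n) x) (chartAt (Hn n) x x) *
      |u.rep (chartAt (Hn n) x) (chartAt (Hn n) x x)|)) x)
  rw [h.glue e he _ (chart_mem_atlas _ x) g hg x hx',
    u.glue e he _ (chart_mem_atlas _ x) g hg x hx',
    abs_mul, abs_of_nonneg (by positivity : 0 ≤ (‖J1 g (e x)‖ ^ 2)⁻¹)]
  field_simp

/-- Ensures that a product of norms with one infinite factor is infinite, since 0 · ∞ = 0 in `ℝ≥0∞`.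
-/
lemma LineSection.supNorm_ne_zero [Nonempty M] (h : LineMetric n M) {u : LineSection n M}
    (hu : u.IsNegative) : u.supNorm h ≠ 0 := by
  obtain ⟨x⟩ := ‹Nonempty M›
  have hx := mem_chart_target (Hn n) x
  have h1 : 0 < ENNReal.ofReal (h.weight (chartAt (Hn n) x) (chartAt (Hn n) x x) *
      |u.rep (chartAt (Hn n) x) (chartAt (Hn n) x x)|) :=
    ENNReal.ofReal_pos.2 (mul_pos (h.pos _ (chart_mem_atlas _ x) _ hx)
      (abs_pos.2 (hu _ (chart_mem_atlas _ x) _ hx).ne))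
  exact (h1.trans_le (le_iSup (fun x : M => ENNReal.ofReal
    (h.weight (chartAt (Hn n) x) (chartAt (Hn n) x x) *
      |u.rep (chartAt (Hn n) x) (chartAt (Hn n) x x)|)) x)).ne'

variable [T2Space M] [MeasurableSpace M] [BorelSpace M]

/-- The hypotheses on the sections in the Chern–Levine–Nirenberg estimate. -/
def IsAdmissible (dV : VolumeForm n M) (u : Fin (n + 1) → LineSection n M) : Prop :=
  ∀ i, (u i).IsC2 ∧ (u i).IsNegative ∧ (u i).IsPSH dV

lemma ratio_monge (hM : IsLocallyProjectiveFlat n M) (hn : 0 < n) {dV : VolumeForm n M}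
    {u : Fin (n + 1) → LineSection n M} (hu : IsAdmissible dV u) (x : M) :
    0 ≤ dV.ratio (monge u) x := by
  have he := chart_mem_atlas (Hn n) x
  have hx := mem_chart_target (Hn n) x
  have hpsd : ∀ i, ∀ q ∈ (chartAt (Hn n) x).target,
      LinePSD (fderiv ℝ (fderiv ℝ ((u i).rep (chartAt (Hn n) x))) q) := fun i q hq =>
    LineSection.linePSD_of_isPSH hM hn (hu i).1 (hu i).2.2 he hq
  rw [VolumeForm.ratio, topCoeff_monge (fun i => (hu i).1) he hpsd hx, ← Complex.ofReal_div,
    Complex.zero_le_real]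
  have h1 := topRe_prod_baston_nonneg (chartAt (Hn n) x).open_target
    (fun i : Fin n => (hu i.succ).1 _ he) (fun i => hpsd i.succ) hx
  exact div_nonneg (mul_nonneg (neg_nonneg.2 ((hu 0).2.1 _ he _ hx).le) (Complex.le_def.1 h1).1)
    (dV.pos _ he _ hx).le

/-- The factor -u₀ is bounded by its supremum, as the product of Baston forms is nonnegative;
`local_estimate` with r = 0 bounds the rest. The constant is fixed before dV, which has disappeared
from the integral in the chart. -/
lemma chart_estimate (hM : IsLocallyProjectiveFlat n M) (hn : 0 < n) (h : LineMetric n M)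
    (he : e ∈ atlas (Hn n) M) {T : Set M} (hT : IsCompact T) (hTe : T ⊆ e.source) :
    ∃ C : ℝ≥0, ∀ (dV : VolumeForm n M) (u : Fin (n + 1) → LineSection n M), IsAdmissible dV u →
      dV.FormIntegrableOn (monge u) T ∧
      ENNReal.ofReal (dV.formIntegral (monge u) T).re ≤ C * ∏ i, (u i).supNorm h := by
  have hK : IsCompact (e '' T) := hT.image_of_continuousOn (e.continuousOn.mono hTe)
  have hKe : e '' T ⊆ e.target := by
    rintro _ ⟨x, hx, rfl⟩; exact e.map_source (hTe hx)
  obtain ⟨C, hC, K', hK', hKe', hest⟩ := local_estimate e.open_target n 0 rfl hK hKe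
  -- The minimum of the weight of the metric on the relevant compact set gives |u| ≤ b⁻¹ ‖u‖ there.
  obtain ⟨b, hb, hbw⟩ : ∃ b : ℝ, 0 < b ∧ ∀ q ∈ e '' T ∪ K', b ≤ h.weight e q := by
    have hsub : e '' T ∪ K' ⊆ e.target := Set.union_subset hKe hKe'
    rcases (e '' T ∪ K').eq_empty_or_nonempty with h0 | h0
    · exact ⟨1, one_pos, by simp [h0]⟩
    · obtain ⟨q, hq, hmin⟩ := (hK.union hK').exists_isMinOn h0 ((h.cont e he).mono hsub)
      exact ⟨_, h.pos e he q (hsub hq), fun p hp => hmin hp⟩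
  -- One factor b⁻¹ for each of the n + 1 sections. The added 1 makes the constant positive, so the
  -- bound is ∞ when some norm is infinite.
  refine ⟨(C * b⁻¹ ^ (n + 1) + 1).toNNReal, fun dV u hu => ?_⟩
  have hpsd : ∀ i, ∀ q ∈ e.target, LinePSD (fderiv ℝ (fderiv ℝ ((u i).rep e)) q) :=
    fun i q hq => LineSection.linePSD_of_isPSH hM hn (hu i).1 (hu i).2.2 he hq
  have hc2 : ∀ i, ContDiffOn ℝ 2 ((u i).rep e) e.target := fun i => (hu i).1 e he
  set P : Hn n → ℝ := fun q =>
    topRe n (List.ofFn fun i : Fin n => baston ((u i.succ).rep e) q).prod with hP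
  have hPc : ContinuousOn P e.target := by
    have := continuousOn_prod_baston e.open_target 1 (fun i : Fin n => (u i.succ).rep e)
      fun i => hc2 i.succ
    simp only [mul_one] at this
    exact (topRe n).continuous.comp_continuousOn this
  have hP0 : ∀ q ∈ e.target, 0 ≤ P q := fun q hq => (Complex.le_def.1
    (topRe_prod_baston_nonneg e.open_target (fun i : Fin n => hc2 i.succ)
      (fun i => hpsd i.succ) hq)).1
  have htop : ∀ q ∈ e.target, topCoeff (monge u e q) = ((-(u 0).rep e q * P q : ℝ) : ℂ) :=
    fun q hq => topCoeff_monge (fun i => (hu i).1) he hpsd hq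
  have hFc : ContinuousOn (fun q => -(u 0).rep e q * P q) e.target :=
    (hc2 0).continuousOn.neg.mul hPc
  have hcont : ContinuousOn (fun q => topCoeff (monge u e q)) e.target :=
    (Complex.continuous_ofReal.comp_continuousOn hFc).congr htop
  obtain ⟨hint, hval⟩ := dV.integrable_and_integral_chart hM
    (isDensity_monge fun i => (hu i).1) he hcont hT.measurableSet hTe
  refine ⟨hint ((hcont.mono hKe).integrableOn_compact hK), ?_⟩
  have hre : (dV.formIntegral (monge u) T).re = ∫ q in e '' T, -(u 0).rep e q * P q := by
    rw [hval, setIntegral_congr_fun hK.measurableSet fun q hq => htop q (hKe hq),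
      integral_complex_ofReal, Complex.ofReal_re]
  rcases T.eq_empty_or_nonempty with rfl | ⟨x, -⟩
  · rw [hre]; simp
  have : Nonempty M := ⟨x⟩
  by_cases hfin : ∀ i, (u i).supNorm h ≠ ⊤
  swap
  · push Not at hfin
    obtain ⟨i, hi⟩ := hfin
    have h1 : ∏ i, (u i).supNorm h = ⊤ := by
      rw [← Finset.mul_prod_erase _ _ (Finset.mem_univ i), hi, ENNReal.top_mul]
      exact Finset.prod_ne_zero_iff.2 fun j _ => LineSection.supNorm_ne_zero h (hu j).2.1
    rw [h1, ENNReal.mul_top]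
    · exact le_top
    · simp only [ne_eq, ENNReal.coe_eq_zero, Real.toNNReal_eq_zero, not_le]
      positivity
  set m : Fin (n + 1) → ℝ := fun i => b⁻¹ * ((u i).supNorm h).toReal with hm
  have hm0 : ∀ i, 0 ≤ m i := fun i => by positivity
  have hum : ∀ i, ∀ q ∈ e '' T ∪ K', |(u i).rep e q| ≤ m i := by
    intro i q hq
    have hqt : q ∈ e.target := Set.union_subset hKe hKe' hq
    have h1 := (ENNReal.ofReal_le_iff_le_toReal (hfin i)).1
      ((u i).weight_mul_abs_le hM h he hqt)
    rw [hm, le_inv_mul_iff₀ hb]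
    exact (mul_le_mul_of_nonneg_right (hbw q hq) (abs_nonneg _)).trans h1
  have hbound : (dV.formIntegral (monge u) T).re ≤ C * ∏ i, m i := by
    rw [hre]
    calc ∫ q in e '' T, -(u 0).rep e q * P q ≤ ∫ q in e '' T, m 0 * P q := by
          refine setIntegral_mono_on ((hFc.mono hKe).integrableOn_compact hK)
            (((continuousOn_const.mul hPc).mono hKe).integrableOn_compact hK)
            hK.measurableSet fun q hq => ?_
          exact mul_le_mul_of_nonneg_right ((neg_le_abs _).trans (hum 0 q (Or.inl hq)))
            (hP0 q (hKe hq))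
      _ = m 0 * ∫ q in e '' T, P q := integral_const_mul _ _
      _ ≤ m 0 * (C * ∏ i : Fin n, m i.succ) := by
          refine mul_le_mul_of_nonneg_left ?_ (hm0 0)
          have := hest (fun i => (u i.succ).rep e) (fun i => hc2 i.succ) (fun i => hpsd i.succ)
            (fun i => m i.succ) (fun i => hm0 _) fun i q hq => hum i.succ q (Or.inr hq)
          simpa only [pow_zero, mul_one] using this
      _ = C * ∏ i, m i := by rw [Fin.prod_univ_succ]; ring
  have hprod : ∏ i, m i = b⁻¹ ^ (n + 1) * ∏ i, ((u i).supNorm h).toReal := by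
    simp [hm, Finset.prod_mul_distrib]
  have hs0 : 0 ≤ ∏ i, ((u i).supNorm h).toReal := Finset.prod_nonneg fun i _ => by positivity
  calc ENNReal.ofReal (dV.formIntegral (monge u) T).re
      ≤ ENNReal.ofReal ((C * b⁻¹ ^ (n + 1) + 1) * ∏ i, ((u i).supNorm h).toReal) := by
        refine ENNReal.ofReal_le_ofReal (hbound.trans ?_)
        rw [hprod, ← mul_assoc]
        exact mul_le_mul_of_nonneg_right (by linarith) hs0
    _ = _ := by
        rw [ENNReal.ofReal_mul (by positivity),
          ENNReal.ofReal_prod_of_nonneg fun i _ => by positivity]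
        congr 1
        exact Finset.prod_congr rfl fun i _ => ENNReal.ofReal_toReal (hfin i)

/-- Compactness reduces to compact neighbourhoods inside charts. The integrand is real and
nonnegative, so passing to `lintegral` makes the bounds subadditive over the cover and monotone in
the set. -/
lemma compact_estimate (hM : IsLocallyProjectiveFlat n M) (hn : 0 < n) (h : LineMetric n M)
    {K : Set M} (hK : IsCompact K) :
    ∃ C : ℝ≥0, ∀ (dV : VolumeForm n M) (u : Fin (n + 1) → LineSection n M), IsAdmissible dV u →
      dV.FormIntegrableOn (monge u) K ∧ 0 ≤ dV.formIntegral (monge u) K ∧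
      ENNReal.ofReal (dV.formIntegral (monge u) K).re ≤ C * ∏ i, (u i).supNorm h := by
  have hlc : LocallyCompactSpace M := ChartedSpace.locallyCompactSpace (Hn n) M
  have hcoe : ∀ {dV : VolumeForm n M} {u : Fin (n + 1) → LineSection n M}, IsAdmissible dV u →
      ∀ x, dV.ratio (monge u) x = (((dV.ratio (monge u) x).re : ℝ) : ℂ) := fun hu x =>
    Complex.eq_re_of_ofReal_le (r := 0) (by simpa using ratio_monge hM hn hu x)
  have hval : ∀ {dV : VolumeForm n M} {u : Fin (n + 1) → LineSection n M}, IsAdmissible dV u →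
      ∀ T, dV.formIntegral (monge u) T =
        ((∫ x in T, (dV.ratio (monge u) x).re ∂dV.measure : ℝ) : ℂ) := fun hu T => by
    rw [VolumeForm.formIntegral, ← integral_complex_ofReal]
    exact integral_congr_ae (Eventually.of_forall fun x => hcoe hu x)
  have hlint : ∀ {dV : VolumeForm n M} {u : Fin (n + 1) → LineSection n M}, IsAdmissible dV u →
      ∀ T, dV.FormIntegrableOn (monge u) T → ENNReal.ofReal (dV.formIntegral (monge u) T).re =
        ∫⁻ x in T, ENNReal.ofReal (dV.ratio (monge u) x).re ∂dV.measure := fun hu T hT => by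
    rw [hval hu, Complex.ofReal_re]
    exact ofReal_integral_eq_lintegral_ofReal hT.re
      (Eventually.of_forall fun x => (Complex.le_def.1 (ratio_monge hM hn hu x)).1)
  -- The claim concerns some superset T of the given set, which makes it monotone and stable under
  -- unions as the induction on compact sets demands; no measurability of T is needed.
  have key : ∃ T, K ⊆ T ∧ ∃ C : ℝ≥0, ∀ (dV : VolumeForm n M) (u : Fin (n + 1) → LineSection n M),
      IsAdmissible dV u → dV.FormIntegrableOn (monge u) T ∧
      ∫⁻ x in T, ENNReal.ofReal (dV.ratio (monge u) x).re ∂dV.measure ≤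
        C * ∏ i, (u i).supNorm h := by
    refine hK.induction_on
      ⟨∅, le_rfl, 0, fun dV u _ => ⟨integrableOn_empty, by simp⟩⟩
      (fun s t hst ht => ?_) (fun s t hs ht => ?_) fun x hx => ?_
    · obtain ⟨T, hT, hC⟩ := ht
      exact ⟨T, hst.trans hT, hC⟩
    · obtain ⟨S, hS, C, hC⟩ := hs
      obtain ⟨T, hT, C', hC'⟩ := ht
      refine ⟨S ∪ T, Set.union_subset_union hS hT, C + C', fun dV u hu =>
        ⟨(hC dV u hu).1.union (hC' dV u hu).1, ?_⟩⟩
      rw [ENNReal.coe_add, add_mul]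
      exact (lintegral_union_le _ _ _).trans (add_le_add (hC dV u hu).2 (hC' dV u hu).2)
    · obtain ⟨T, hTx, hTe, hT⟩ := local_compact_nhds
        ((chartAt (Hn n) x).open_source.mem_nhds (mem_chart_source (Hn n) x))
      obtain ⟨C, hC⟩ := chart_estimate hM hn h (chart_mem_atlas (Hn n) x) hT hTe
      refine ⟨T, mem_nhdsWithin_of_mem_nhds hTx, T, le_rfl, C, fun dV u hu =>
        ⟨(hC dV u hu).1, ?_⟩⟩
      rw [← hlint hu T (hC dV u hu).1]
      exact (hC dV u hu).2
  obtain ⟨T, hKT, C, hC⟩ := key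
  refine ⟨C, fun dV u hu => ?_⟩
  have hint : dV.FormIntegrableOn (monge u) K := (hC dV u hu).1.mono_set hKT
  refine ⟨hint, ?_, ?_⟩
  · rw [hval hu, Complex.zero_le_real]
    exact integral_nonneg fun x => (Complex.le_def.1 (ratio_monge hM hn hu x)).1
  · rw [hlint hu K hint]
    exact (lintegral_mono_set hKT).trans (hC dV u hu).2

end Global

end QuatProj

end

theorem mainTheorem7 {n : ℕ} (hn : 0 < n) {M : Type*} [TopologicalSpace M] [T2Space M]
    [SecondCountableTopology M] [MeasurableSpace M] [BorelSpace M]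
    [ChartedSpace (QuatProj.Hn n) M] (hM : QuatProj.IsLocallyProjectiveFlat n M)
    (h : QuatProj.LineMetric n M) :
    (CompactSpace M →
      ∃ C : ℝ≥0, ∀ (dV : QuatProj.VolumeForm n M) (u : Fin (n + 1) → QuatProj.LineSection n M),
        (∀ i, (u i).IsC2 ∧ (u i).IsNegative ∧ (u i).IsPSH dV) →
          dV.FormIntegrableOn (QuatProj.monge u) Set.univ ∧
          0 ≤ dV.formIntegral (QuatProj.monge u) Set.univ ∧
          ENNReal.ofReal (dV.formIntegral (QuatProj.monge u) Set.univ).re ≤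
            C * ∏ i, (u i).supNorm h) ∧
    (∀ K : Set M, IsCompact K →
      ∃ C : ℝ≥0, ∀ (dV : QuatProj.VolumeForm n M) (u : Fin (n + 1) → QuatProj.LineSection n M),
        (∀ i, (u i).IsC2 ∧ (u i).IsNegative ∧ (u i).IsPSH dV) →
          dV.FormIntegrableOn (QuatProj.monge u) K ∧
          0 ≤ dV.formIntegral (QuatProj.monge u) K ∧
          ENNReal.ofReal (dV.formIntegral (QuatProj.monge u) K).re ≤
            C * ∏ i, (u i).supNorm h) := by
  exact ⟨fun _ => QuatProj.compact_estimate hM hn h isCompact_univ,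
    fun K hK => QuatProj.compact_estimate hM hn h hK⟩
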